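/- Let $\mathcal{E}$ be the set of all pairs $(u,\mu)$, where $u\in H^1(\mathbb{R})$ is real-valued (and identified with its continuous representative) and $\mu$ is a non-negative finite Borel measure on $\mathbb{R}$ with $\mu(B)\ge\int_B u(x)^2+u'(x)^2\,dx$ for every Borel set $B\subseteq\mathbb{R}$, such that, for both choices of the sign, $$\int_{\mathbb{R}} e^{\pm x}\bigl(u'(x)\mp u(x)\bigr)^2dx+\int_{\mathbb{R}} e^{\pm x}\,d\upsilon(x)<\infty,$$ where $\upsilon$ is the non-negative finite Borel measure defined by $\mu(B)=\int_B u^2+u'^2\,dx+\upsilon(B)$. Put $\omega(h)=\int_{\mathbb{R}} u h\,dx+\int_{\mathbb{R}} u'h'\,dx$. Fix $(u,\mu)\in\mathcal{E}$. For $z\in\mathbb{C}$, a solution of $$-f''+\tfrac14 f=z\,\omega f+z^2\upsilon f \qquad (*)$$ is a function $f\in H^1_{\mathrm{loc}}(\mathbb{R})$ (continuous, complex-valued) such that $$\int_{\mathbb{R}} f'h'\,dx+\frac14\int_{\mathbb{R}} fh\,dx=z\,\omega(fh)+z^2\int_{\mathbb{R}} fh\,d\upsilon$$ for every compactly supported $h\in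 H^1(\mathbb{R})$. The spectrum $\sigma$ is the set of all $z\in\mathbb{C}$ for which $(*)$ has a nontrivial solution in $H^1(\mathbb{R})$. For every $z\in\mathbb{C}$ there are unique solutions $\phi_+(z,\cdot)$ and $\phi_-(z,\cdot)$ of $(*)$ with $\phi_\pm(z,x)\sim e^{\mp x/2}$ as $x\to\pm\infty$, and there is a (necessarily unique) number $W(z)$ such that $W(z)=\phi_+(z,x)\phi_-'(z,x)-\phi_+'(z,x)\phi_-(z,x)$ for almost all $x\in\mathbb{R}$. Moreover: 1. For each fixed $x\in\mathbb{R}$, the functions $\phi_+(\cdot,x)$, $\phi_-(\cdot,x)$ and $W$ are real entire of Cartwright class (that is, entire, real on $\mathbb{R}$, of exponential type, and with $\int_{\mathbb{R}}\frac{\log^+|F(t)|}{1+t^2}dt<\infty$), and all their roots are real and nonzero. 2. For each fixed $x\in\mathbb{R}$, the function $$z\mapsto\frac{z\,\phi_-(z,x)\,\phi_+(z,x)}{W(z)}$$ is a meromorphic Herglotz–Nevanlinna function: it is meromorphic on $\mathbb{C}$, holomorphic on $\mathbb{C}\setminus\mathbb{R}$, satisfies $M(\overline{z})=\overline{M(z)}$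 there, and has non-negative imaginary part on the open upper half-plane. 3. The spectrum $\sigma$ coincides with the set of zeros of $W$. Hence $\sigma$ consists of nonzero reals, is discrete (each disc $\{|z|\le r\}$ contains only finitely many points of $\sigma$), and has convergence exponent at most one, that is, $\sum_{\lambda\in\sigma}|\lambda|^{-p}<\infty$ for every $p>1$. -/

import Mathlib

open MeasureTheory Filter

noncomputable section

namespace CamassaHolm

/-- `H¹(ℝ)`, through the (unique) continuous representative: locally absolutely continuous,
with the function and its derivative (which exists almost everywhere) square integrable. -/
structure MemH1 {E : Type*} [NormedAddCommGroup E] [NormedSpace ℝ E] (f : ℝ → E) : Prop where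
  ac : ∀ a b : ℝ, AbsolutelyContinuousOnInterval f a b
  sq : MemLp f 2 volume
  sq_deriv : MemLp (deriv f) 2 volume

/-- `H¹_loc(ℝ)`, through the (unique) continuous representative. -/
structure MemH1Loc {E : Type*} [NormedAddCommGroup E] [NormedSpace ℝ E] (f : ℝ → E) : Prop where
  ac : ∀ a b : ℝ, AbsolutelyContinuousOnInterval f a b
  sq_deriv : ∀ a b : ℝ, MemLp (deriv f) 2 (volume.restrict (Set.Icc a b))

/-- The absolutely continuous measure `(u² + u'²) dx`. -/
def energyMeasure (u : ℝ → ℝ) : Measure ℝ :=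
  volume.withDensity fun x => ENNReal.ofReal (u x ^ 2 + deriv u x ^ 2)

/-- The set `𝒟` of pairs `(u, μ)`: `u` is a real-valued function in `H¹(ℝ)` and `μ` is a
non-negative finite Borel measure with `μ(B) ≥ ∫_B u² + u'² dx` for all Borel sets `B`. -/
structure MemD (u : ℝ → ℝ) (μ : Measure ℝ) : Prop where
  h1 : MemH1 u
  finite : IsFiniteMeasure μ
  le : ∀ B : Set ℝ, MeasurableSet B →
    ∫⁻ x in B, ENNReal.ofReal (u x ^ 2 + deriv u x ^ 2) ≤ μ B

/-- The measure `υ` with `μ(B) = ∫_B u² + u'² dx + υ(B)` (see `MemD.energy_add_upsilon`). -/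
def upsilon (u : ℝ → ℝ) (μ : Measure ℝ) : Measure ℝ := μ - energyMeasure u

theorem MemD.energyMeasure_le {u : ℝ → ℝ} {μ : Measure ℝ} (h : MemD u μ) :
    energyMeasure u ≤ μ := by
  refine Measure.le_iff.2 fun B hB => ?_
  rw [energyMeasure, withDensity_apply _ hB]
  exact h.le B hB

/-- The defining property of `υ`. -/
theorem MemD.energy_add_upsilon {u : ℝ → ℝ} {μ : Measure ℝ} (h : MemD u μ) (B : Set ℝ)
    (hB : MeasurableSet B) :
    μ B = (∫⁻ x in B, ENNReal.ofReal (u x ^ 2 + deriv u x ^ 2)) + upsilon u μ B := by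
  have := h.finite
  have : IsFiniteMeasure (energyMeasure u) := isFiniteMeasure_of_le μ h.energyMeasure_le
  have key := Measure.sub_add_cancel_of_le h.energyMeasure_le
  rw [← withDensity_apply _ hB, ← energyMeasure, add_comm]
  conv_lhs => rw [← key]
  rfl

/-- The growth condition `∫ e^{sx} (u' - s u)² dx + ∫ e^{sx} dυ < ∞`; `s = 1` gives `ℰ₊` and
`s = -1` gives `ℰ₋`. -/
def DecayCond (s : ℝ) (u : ℝ → ℝ) (μ : Measure ℝ) : Prop :=
  (∫⁻ x, ENNReal.ofReal (Real.exp (s * x) * (deriv u x - s * u x) ^ 2)) +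
    (∫⁻ x, ENNReal.ofReal (Real.exp (s * x)) ∂(upsilon u μ)) < ⊤

/-- The class `ℰ = ℰ₊ ∩ ℰ₋`. -/
structure MemE (u : ℝ → ℝ) (μ : Measure ℝ) : Prop where
  memD : MemD u μ
  decay_pos : DecayCond 1 u μ
  decay_neg : DecayCond (-1) u μ

/-- The distribution `ω = u - u''`, that is, `ω(h) = ∫ u h dx + ∫ u' h' dx`. -/
def omega (u : ℝ → ℝ) (h : ℝ → ℂ) : ℂ :=
  (∫ x, (u x : ℂ) * h x) + ∫ x, ((deriv u x : ℝ) : ℂ) * deriv h x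

/-- `f` is a solution of `-f'' + f / 4 = z ω f + z² υ f` in the weak sense: `f ∈ H¹_loc(ℝ)` and
`∫ f' h' dx + (1/4) ∫ f h dx = z ω(f h) + z² ∫ f h dυ` for all `h ∈ H¹_c(ℝ)`. -/
def IsSolution (u : ℝ → ℝ) (μ : Measure ℝ) (z : ℂ) (f : ℝ → ℂ) : Prop :=
  MemH1Loc f ∧ ∀ h : ℝ → ℂ, MemH1 h → HasCompactSupport h →
    (∫ x, deriv f x * deriv h x) + (1 / 4 : ℂ) * ∫ x, f x * h x =
      z * omega u (fun x => f x * h x) + z ^ 2 * ∫ x, f x * h x ∂(upsilon u μ)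

/-- The solution `φ₊(z, ·)`: asymptotically equivalent to `e^{-x/2}` as `x → +∞`. -/
def IsPhiPlus (u : ℝ → ℝ) (μ : Measure ℝ) (z : ℂ) (f : ℝ → ℂ) : Prop :=
  IsSolution u μ z f ∧
    Asymptotics.IsEquivalent atTop f fun x : ℝ => (Real.exp (-(x / 2)) : ℂ)

/-- The solution `φ₋(z, ·)`: asymptotically equivalent to `e^{x/2}` as `x → -∞`. -/
def IsPhiMinus (u : ℝ → ℝ) (μ : Measure ℝ) (z : ℂ) (f : ℝ → ℂ) : Prop :=
  IsSolution u μ z f ∧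
    Asymptotics.IsEquivalent atBot f fun x : ℝ => (Real.exp (x / 2) : ℂ)

/-- The spectrum `σ`: all `z ∈ ℂ` for which there is a nontrivial solution in `H¹(ℝ)`. -/
def spectralSet (u : ℝ → ℝ) (μ : Measure ℝ) : Set ℂ :=
  {z | ∃ f : ℝ → ℂ, IsSolution u μ z f ∧ f ≠ 0 ∧ MemH1 f}

/-- Real entire functions of Cartwright class: entire, real on the real line, of exponential type,
with finite logarithmic integral. -/
structure IsRealCartwright (F : ℂ → ℂ) : Prop where
  entire : Differentiable ℂ F
  real : ∀ t : ℝ, (F t).im = 0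
  expType : ∃ A B : ℝ, ∀ z : ℂ, ‖F z‖ ≤ A * Real.exp (B * ‖z‖)
  logIntegral :
    ∫⁻ t : ℝ, ENNReal.ofReal (max 0 (Real.log ‖F t‖) / (1 + t ^ 2)) < ⊤

/-- Meromorphic Herglotz–Nevanlinna functions: meromorphic on `ℂ`, holomorphic on `ℂ \ ℝ`,
symmetric with respect to the real line, and with non-negative imaginary part on the open upper
half-plane. -/
structure IsMeromorphicHerglotz (M : ℂ → ℂ) : Prop where
  meromorphic : ∀ z : ℂ, MeromorphicAt M z
  holomorphic : DifferentiableOn ℂ M {z : ℂ | z.im ≠ 0}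
  symm : ∀ z : ℂ, z.im ≠ 0 →
    M ((starRingEnd ℂ) z) = (starRingEnd ℂ) (M z)
  im_nonneg : ∀ z : ℂ, 0 < z.im → 0 ≤ (M z).im

/-- All roots of `F` are real and nonzero. -/
def HasOnlyNonzeroRealRoots (F : ℂ → ℂ) : Prop :=
  ∀ z : ℂ, F z = 0 → z.im = 0 ∧ z ≠ 0

end CamassaHolm

end

/-!
The substitution `f = cosh (x / 2) F` turns the differential equation into a first order system with
finite total mass. Let `ν` be the measure `dx / cosh² (x / 2)`, let `κ` be the measure
`cosh² (x / 2) dυ`, and let `w` be the antiderivative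
`cosh² (x / 2) u' - cosh (x / 2) sinh (x / 2) u - ½ ∫ u`. Then `ω (cosh² (x / 2) K) = ∫ w K' dx` for
test functions `K`, and `f` solves the equation if and only if

  `dF = (z w F + G) dν`,  `dG = -z w (z w F + G) dν - z² F dκ`

for some function `G` of bounded variation. Both `ν` and `κ` are finite and `w` belongs to `L² (ν)`;
this is precisely the content of the growth conditions that define the class `ℰ`. All solutions
therefore extend to both endpoints `±∞`, and since `cosh (x / 2) ν (-∞, x) = 2 e^{x/2}` and
`cosh (x / 2) ν [x, ∞) = 2 e^{-x/2}`, the functions `φ₋` and `φ₊` correspond to the solutions `F`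
that vanish at `-∞` and at `∞`, while their Wronskian is a multiple of the value at `∞` of the
solution vanishing at `-∞`.

The statements about the dependence on `z` are read off from the system. It becomes linear in `z`
for the pair `(z F, G)`, so that its solutions are power series in `z` whose coefficients are
iterated integrals of order `Tⁿ / n!` (`CoeffData.isSys_solX`, `CoeffData.isSys_solF`); hence they
are entire of exponential type. The Lagrange identity (`CoeffData.IsSys.lagrange`), applied to a
solution and its complex conjugate, gives an energy identity. It shows that the roots are real and
that the diagonal Green's function is a Herglotz–Nevanlinna function
(`CoeffData.isMeromorphicHerglotz_green`). It also provides an entire function of exponential type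
that has modulus at least one on the closed upper half-plane and dominates the solutions on the real
line (`CoeffData.majorant`). The logarithm of the modulus of such a function is a non-negative
harmonic function there, so that its boundary values have a finite Poisson integral
(`lintegral_log_norm_lt_top`), which is the finiteness of the logarithmic integrals.

Conversely, every weak solution comes from the system: by the lemma of du Bois-Reymond, the
Wronskian of any two weak solutions is constant almost everywhere
(`IsSolution.wronskian_ae_const`), so that a weak solution is a linear combination of two solutions
obtained from the system (`IsSolution.exists_isSys`). Such a solution belongs to `H¹(ℝ)` if and only
if `F` vanishes at both endpoints, which identifies the spectrum with the zero set of `W`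
(`mem_spectralSet_iff`). As `W` is of exponential type with `W(0) ≠ 0`, dividing out zeros and
the maximum principle bound the number of its zeros in a disc linearly in the radius
(`exists_card_zeros_le`), and this gives discreteness and the convergence exponent.
-/

namespace CamassaHolm

open scoped Topology ENNReal

/-! ### Locally absolutely continuous functions -/

/-- Locally absolutely continuous functions on the real line. -/
def LocAC {E : Type*} [NormedAddCommGroup E] (f : ℝ → E) : Prop :=
  ∀ a b : ℝ, AbsolutelyContinuousOnInterval f a b

section LocAC

variable {E E' : Type*} [NormedAddCommGroup E] [NormedAddCommGroup E']

theorem LocAC.continuous {f : ℝ → E} (hf : LocAC f) : Continuous f := by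
  refine continuous_iff_continuousAt.2 fun x => ?_
  refine ((hf (x - 1) (x + 1)).continuousOn).continuousAt ?_
  rw [Set.uIcc_of_le (by linarith)]
  exact Icc_mem_nhds (by linarith) (by linarith)

theorem LocAC.comp_lipschitzWith {f : ℝ → E} (hf : LocAC f) {g : E → E'} {K : NNReal}
    (hg : LipschitzWith K g) : LocAC fun x => g (f x) := by
  intro a b
  have h := hf a b
  unfold AbsolutelyContinuousOnInterval at h ⊢
  replace h := Tendsto.const_mul (K : ℝ) h
  rw [mul_zero] at h
  refine squeeze_zero (fun _ => Finset.sum_nonneg fun _ _ => dist_nonneg) (fun I => ?_) h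
  rw [Finset.mul_sum]
  exact Finset.sum_le_sum fun i _ => hg.dist_le_mul _ _

theorem LocAC.re {f : ℝ → ℂ} (hf : LocAC f) : LocAC fun x => (f x).re :=
  hf.comp_lipschitzWith (g := Complex.re) (K := 1) <| LipschitzWith.of_dist_le_mul fun x y => by
    simpa [Real.dist_eq, dist_eq_norm] using Complex.abs_re_le_norm (x - y)

theorem LocAC.im {f : ℝ → ℂ} (hf : LocAC f) : LocAC fun x => (f x).im :=
  hf.comp_lipschitzWith (g := Complex.im) (K := 1) <| LipschitzWith.of_dist_le_mul fun x y => by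
    simpa [Real.dist_eq, dist_eq_norm] using Complex.abs_im_le_norm (x - y)

theorem LocAC.ofReal {f : ℝ → ℝ} (hf : LocAC f) : LocAC fun x => (f x : ℂ) :=
  hf.comp_lipschitzWith (g := Complex.ofReal) (K := 1) Complex.isometry_ofReal.lipschitz

theorem LocAC.mul {f g : ℝ → ℂ} (hf : LocAC f) (hg : LocAC g) : LocAC fun x => f x * g x :=
  fun a b => (hf a b).smul (hg a b)

theorem LocAC.add {f g : ℝ → E} (hf : LocAC f) (hg : LocAC g) : LocAC fun x => f x + g x :=
  fun a b => (hf a b).add (hg a b)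

theorem LocAC.const (c : E) : LocAC fun _ : ℝ => c := fun a b =>
  LipschitzOnWith.absolutelyContinuousOnInterval (K := 0) (by
    intro x _ y _; simp)

theorem LocAC.const_mul (c : ℂ) {f : ℝ → ℂ} (hf : LocAC f) : LocAC fun x => c * f x :=
  (LocAC.const c).mul hf

theorem LocAC.of_contDiff [NormedSpace ℝ E] {f : ℝ → E} (hf : ContDiff ℝ 1 f) : LocAC f :=
  fun _ _ => hf.contDiffOn.absolutelyContinuousOnInterval

theorem LocAC.ae_differentiableAt_real {f : ℝ → ℝ} (hf : LocAC f) :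
    ∀ᵐ x, DifferentiableAt ℝ f x := by
  have h : ∀ n : ℕ, ∀ᵐ x : ℝ, x ∈ Set.uIcc (-(n : ℝ)) n → DifferentiableAt ℝ f x :=
    fun n => (hf _ _).ae_differentiableAt
  filter_upwards [ae_all_iff.2 h] with x hx
  obtain ⟨n, hn⟩ := exists_nat_ge |x|
  refine hx n ?_
  rw [Set.uIcc_of_le (by linarith [abs_nonneg x])]
  exact abs_le.1 hn

theorem hasDerivAt_of_re_im {f : ℝ → ℂ} {x a b : ℝ} (h1 : HasDerivAt (fun x => (f x).re) a x)
    (h2 : HasDerivAt (fun x => (f x).im) b x) :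
    HasDerivAt f ((a : ℂ) + b * Complex.I) x := by
  have h := h1.ofReal_comp.add (h2.ofReal_comp.mul_const Complex.I)
  refine h.congr_of_eventuallyEq (Eventually.of_forall fun y => ?_)
  exact (Complex.re_add_im (f y)).symm

theorem LocAC.ae_differentiableAt {f : ℝ → ℂ} (hf : LocAC f) :
    ∀ᵐ x, DifferentiableAt ℝ f x := by
  filter_upwards [hf.re.ae_differentiableAt_real, hf.im.ae_differentiableAt_real] with x h1 h2
  exact (hasDerivAt_of_re_im h1.hasDerivAt h2.hasDerivAt).differentiableAt

theorem LocAC.deriv_eq_re_im {f : ℝ → ℂ} (hf : LocAC f) :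
    ∀ᵐ x, deriv f x = ((deriv (fun x => (f x).re) x : ℝ) : ℂ)
      + ((deriv (fun x => (f x).im) x : ℝ) : ℂ) * Complex.I := by
  filter_upwards [hf.re.ae_differentiableAt_real, hf.im.ae_differentiableAt_real] with x h1 h2
  exact (hasDerivAt_of_re_im h1.hasDerivAt h2.hasDerivAt).deriv

theorem LocAC.intervalIntegrable_deriv {f : ℝ → ℂ} (hf : LocAC f) (a b : ℝ) :
    IntervalIntegrable (deriv f) volume a b := by
  have h1 : IntervalIntegrable (fun x => ((deriv (fun x => (f x).re) x : ℝ) : ℂ)) volume a b :=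
    ⟨(hf.re a b).intervalIntegrable_deriv.1.ofReal, (hf.re a b).intervalIntegrable_deriv.2.ofReal⟩
  have h2 : IntervalIntegrable (fun x => ((deriv (fun x => (f x).im) x : ℝ) : ℂ) * Complex.I)
      volume a b := IntervalIntegrable.mul_const
    ⟨(hf.im a b).intervalIntegrable_deriv.1.ofReal, (hf.im a b).intervalIntegrable_deriv.2.ofReal⟩ _
  refine (h1.add h2).congr_ae ?_
  filter_upwards [ae_restrict_of_ae hf.deriv_eq_re_im] with x hx
  rw [hx]

theorem LocAC.integral_deriv {f : ℝ → ℂ} (hf : LocAC f) (a b : ℝ) :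
    ∫ x in a..b, deriv f x = f b - f a := by
  have h1 : IntervalIntegrable (fun x => ((deriv (fun x => (f x).re) x : ℝ) : ℂ)) volume a b :=
    ⟨(hf.re a b).intervalIntegrable_deriv.1.ofReal, (hf.re a b).intervalIntegrable_deriv.2.ofReal⟩
  have h2 : IntervalIntegrable (fun x => ((deriv (fun x => (f x).im) x : ℝ) : ℂ) * Complex.I)
      volume a b := IntervalIntegrable.mul_const
    ⟨(hf.im a b).intervalIntegrable_deriv.1.ofReal, (hf.im a b).intervalIntegrable_deriv.2.ofReal⟩ _
  rw [intervalIntegral.integral_congr_ae (g := fun x =>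
      ((deriv (fun x => (f x).re) x : ℝ) : ℂ)
      + ((deriv (fun x => (f x).im) x : ℝ) : ℂ) * Complex.I)
      (hf.deriv_eq_re_im.mono fun x hx _ => hx)]
  rw [intervalIntegral.integral_add h1 h2, intervalIntegral.integral_mul_const,
    intervalIntegral.integral_ofReal, intervalIntegral.integral_ofReal,
    (hf.re a b).integral_deriv_eq_sub, (hf.im a b).integral_deriv_eq_sub]
  apply Complex.ext <;> simp

theorem LocAC.locallyIntegrable_deriv {f : ℝ → ℂ} (hf : LocAC f) :
    LocallyIntegrable (deriv f) volume := by
  intro x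
  refine ⟨Set.Icc (x - 1) (x + 1), Icc_mem_nhds (by linarith) (by linarith), ?_⟩
  exact (intervalIntegrable_iff_integrableOn_Icc_of_le (by linarith)).1
    (hf.intervalIntegrable_deriv _ _)

theorem LocAC.real_integral {g : ℝ → ℝ} (hg : LocallyIntegrable g volume) (c : ℝ) :
    LocAC fun x => ∫ y in c..x, g y := by
  intro a b
  have hi : IntervalIntegrable g volume (min c (min a b)) (max c (max a b)) :=
    (hg.integrableOn_isCompact isCompact_uIcc).intervalIntegrable
  have hle : min c (min a b) ≤ max c (max a b) := (min_le_left _ _).trans (le_max_left _ _)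
  refine (hi.absolutelyContinuousOnInterval_intervalIntegral (c := c) ?_).mono ?_
  · rw [Set.uIcc_of_le hle]
    exact ⟨min_le_left _ _, le_max_left _ _⟩
  · rw [Set.uIcc_of_le hle]
    exact Set.Icc_subset_Icc (min_le_right _ _) (le_max_right _ _)

theorem LocAC.integral {g : ℝ → ℂ} (hg : LocallyIntegrable g volume) (c : ℝ) :
    LocAC fun x => ∫ y in c..x, g y := by
  have hi : ∀ p q : ℝ, IntervalIntegrable g volume p q := fun p q =>
    (hg.integrableOn_isCompact isCompact_uIcc).intervalIntegrable
  have hre : LocallyIntegrable (fun x => (g x).re) volume := fun x => by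
    obtain ⟨s, hs, h⟩ := hg x
    exact ⟨s, hs, h.re⟩
  have him : LocallyIntegrable (fun x => (g x).im) volume := fun x => by
    obtain ⟨s, hs, h⟩ := hg x
    exact ⟨s, hs, h.im⟩
  have h := (LocAC.real_integral hre c).ofReal.add
    ((LocAC.const Complex.I).mul (LocAC.real_integral him c).ofReal)
  convert h using 2 with x
  have e1 := Complex.reCLM.intervalIntegral_comp_comm (hi c x)
  have e2 := Complex.imCLM.intervalIntegral_comp_comm (hi c x)
  simp only [Complex.reCLM_apply, Complex.imCLM_apply] at e1 e2
  rw [e1, e2, mul_comm]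
  exact (Complex.re_add_im _).symm

theorem LocAC.integral_deriv_of_hasCompactSupport {f : ℝ → ℂ} (hf : LocAC f)
    (hs : HasCompactSupport f) : ∫ x, deriv f x = 0 := by
  obtain ⟨R, hR0, hR⟩ := hs.isCompact.isBounded.subset_ball_lt 0 0
  have hz : ∀ x, x ∉ Metric.ball (0 : ℝ) R → f x = 0 := fun x hx =>
    image_eq_zero_of_notMem_tsupport fun h => hx (hR h)
  rw [← intervalIntegral.integral_eq_integral_of_support_subset (a := -R) (b := R),
    hf.integral_deriv, hz R (by simp [le_abs_self]), hz (-R) (by simp [le_abs_self]), sub_zero]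
  intro x hx
  have := hR (support_deriv_subset hx)
  simp only [Metric.mem_ball, dist_zero_right, Real.norm_eq_abs, abs_lt] at this
  exact ⟨this.1, this.2.le⟩

theorem LocAC.ae_deriv_mul {f g : ℝ → ℂ} (hf : LocAC f) (hg : LocAC g) :
    ∀ᵐ x, deriv (fun x => f x * g x) x = deriv f x * g x + f x * deriv g x := by
  filter_upwards [hf.ae_differentiableAt, hg.ae_differentiableAt] with x h1 h2
  exact deriv_fun_mul h1 h2

end LocAC

/-! ### Products with compactly supported test functions -/

theorem MemH1.locAC {E : Type*} [NormedAddCommGroup E] [NormedSpace ℝ E] {f : ℝ → E}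
    (hf : MemH1 f) : LocAC f := hf.ac

theorem MemH1Loc.locAC {E : Type*} [NormedAddCommGroup E] [NormedSpace ℝ E] {f : ℝ → E}
    (hf : MemH1Loc f) : LocAC f := hf.ac

/-- The product of two locally square integrable functions, one of which vanishes outside of a
compact interval, is integrable. -/
theorem integrable_mul_of_memLp {f h : ℝ → ℂ} {a b : ℝ}
    (hf : MemLp f 2 (volume.restrict (Set.Icc a b))) (hh : MemLp h 2 volume)
    (hs : ∀ x, x ∉ Set.Icc a b → h x = 0) : Integrable fun x => f x * h x := by
  have h1 : IntegrableOn (fun x => f x * h x) (Set.Icc a b) := hf.integrable_mul (hh.restrict _)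
  rw [← integrable_indicator_iff measurableSet_Icc] at h1
  refine h1.congr (ae_of_all _ fun x => ?_)
  by_cases hx : x ∈ Set.Icc a b <;> simp [hx, hs x]

theorem exists_Icc_of_hasCompactSupport {h : ℝ → ℂ} (hs : HasCompactSupport h) :
    ∃ R : ℝ, (∀ x, x ∉ Set.Icc (-R) R → h x = 0) ∧ ∀ x, x ∉ Set.Icc (-R) R → deriv h x = 0 := by
  obtain ⟨R, hR⟩ := hs.isCompact.isBounded.subset_closedBall 0
  rw [Real.closedBall_eq_Icc, zero_sub, zero_add] at hR
  exact ⟨R, fun x hx => image_eq_zero_of_notMem_tsupport fun h => hx (hR h),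
    fun x hx => by
      by_contra h0
      exact hx (hR (support_deriv_subset h0))⟩

theorem MemH1Loc.mul_memH1 {f h : ℝ → ℂ} (hf : MemH1Loc f) (hh : MemH1 h)
    (hs : HasCompactSupport h) : MemH1 fun x => f x * h x := by
  have hfc := hf.locAC.continuous
  have hhc := hh.locAC.continuous
  obtain ⟨R, hR, hR'⟩ := exists_Icc_of_hasCompactSupport hs
  refine ⟨hf.locAC.mul hh.locAC, (hfc.mul hhc).memLp_of_hasCompactSupport hs.mul_left, ?_⟩
  obtain ⟨C, hC⟩ := isCompact_Icc.exists_bound_of_continuousOn (s := Set.Icc (-R) R)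
    hfc.continuousOn
  obtain ⟨D, hD⟩ := isCompact_Icc.exists_bound_of_continuousOn (s := Set.Icc (-R) R)
    hhc.continuousOn
  have hm : ∀ᵐ x ∂(volume.restrict (Set.Icc (-R) R)), x ∈ Set.Icc (-R) R :=
    ae_restrict_mem measurableSet_Icc
  have m1 : MemLp (fun x => deriv f x * h x) 2 (volume.restrict (Set.Icc (-R) R)) := by
    refine (hf.sq_deriv (-R) R).of_le_mul (c := D)
      ((hf.sq_deriv _ _).1.mul hhc.aestronglyMeasurable) (hm.mono fun x hx => ?_)
    rw [norm_mul, mul_comm]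
    exact mul_le_mul_of_nonneg_right (hD x hx) (norm_nonneg _)
  have m2 : MemLp (fun x => f x * deriv h x) 2 (volume.restrict (Set.Icc (-R) R)) := by
    refine (hh.sq_deriv.restrict (Set.Icc (-R) R)).of_le_mul (c := C)
      (hfc.aestronglyMeasurable.mul (hh.sq_deriv.restrict _).1) (hm.mono fun x hx => ?_)
    rw [norm_mul]
    exact mul_le_mul_of_nonneg_right (hC x hx) (norm_nonneg _)
  have m3 := (memLp_indicator_iff_restrict measurableSet_Icc).2 (m1.add m2)
  refine m3.ae_eq ?_
  filter_upwards [hf.locAC.ae_deriv_mul hh.locAC] with x hx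
  rw [hx]
  by_cases hx : x ∈ Set.Icc (-R) R
  · simp [hx]
  · simp [hx, hR x hx, hR' x hx]

theorem memH1_of_contDiff {h : ℝ → ℝ} (hh : ContDiff ℝ 1 h) (hs : HasCompactSupport h) :
    MemH1 fun x => (h x : ℂ) := by
  have hc : ContDiff ℝ 1 fun x => (h x : ℂ) := Complex.ofRealCLM.contDiff.comp hh
  have hs' : HasCompactSupport fun x => (h x : ℂ) := hs.comp_left Complex.ofReal_zero
  exact ⟨LocAC.of_contDiff hc, hc.continuous.memLp_of_hasCompactSupport hs',
    (hc.continuous_deriv le_rfl).memLp_of_hasCompactSupport hs'.deriv⟩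

/-! ### The Wronskian of two weak solutions -/

/-- **Du Bois-Reymond lemma**: a function with vanishing weak derivative is constant. -/
theorem ae_const_of_integral_deriv_eq_zero {g : ℝ → ℂ} (hg : LocallyIntegrable g volume)
    (h0 : ∀ h : ℝ → ℝ, ContDiff ℝ 1 h → HasCompactSupport h →
      ∫ x, ((deriv h x : ℝ) : ℂ) * g x = 0) :
    ∃ c : ℂ, ∀ᵐ x, g x = c := by
  let B : ContDiffBump (0 : ℝ) := default
  let η : ℝ → ℝ := B.normed volume
  have ηc : Continuous η := B.continuous_normed
  have ηs : HasCompactSupport η := B.hasCompactSupport_normed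
  refine ⟨∫ x, (η x : ℂ) * g x, ?_⟩
  refine ae_eq_of_integral_contDiff_smul_eq hg (locallyIntegrable_const _) fun ψ ψd ψs => ?_
  have ψc := ψd.continuous
  -- `ψ - (∫ ψ) η` has integral zero, hence is the derivative of a test function
  let φ : ℝ → ℝ := fun x => ψ x - (∫ y, ψ y) * η x
  have φc : Continuous φ := ψc.sub (continuous_const.mul ηc)
  have φs : HasCompactSupport φ := ψs.sub ηs.mul_left
  have φi : ∫ x, φ x = 0 := by
    rw [integral_sub (ψc.integrable_of_hasCompactSupport ψs)
      ((ηc.integrable_of_hasCompactSupport ηs).const_mul _), integral_const_mul,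
      B.integral_normed, mul_one, sub_self]
  obtain ⟨R, hR⟩ := φs.isCompact.isBounded.subset_ball 0
  have φz : ∀ x, x ∉ Metric.ball (0 : ℝ) R → φ x = 0 := fun x hx =>
    image_eq_zero_of_notMem_tsupport fun h => hx (hR h)
  let h : ℝ → ℝ := fun x => ∫ y in (-R)..x, φ y
  have hd : ∀ x, HasDerivAt h (φ x) x := fun x =>
    intervalIntegral.integral_hasDerivAt_right (φc.intervalIntegrable _ _)
      (φc.stronglyMeasurableAtFilter _ _) φc.continuousAt
  have hd' : deriv h = φ := funext fun x => (hd x).deriv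
  have hC1 : ContDiff ℝ 1 h := by
    rw [contDiff_one_iff_deriv]
    exact ⟨fun x => (hd x).differentiableAt, by rwa [hd']⟩
  have hs : HasCompactSupport h := by
    refine HasCompactSupport.of_support_subset_isCompact (isCompact_Icc (a := -R) (b := R)) ?_
    intro x hx
    by_contra hx'
    apply hx
    rw [Set.mem_Icc, not_and_or, not_le, not_le] at hx'
    rcases hx' with hx' | hx'
    · refine intervalIntegral.integral_zero_ae (ae_of_all _ fun y hy => φz y ?_)
      rw [Set.uIoc_of_ge hx'.le] at hy
      rw [Metric.mem_ball, dist_zero_right, Real.norm_eq_abs, not_lt, le_abs]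
      right; linarith [hy.2]
    · change ∫ y in (-R)..x, φ y = 0
      rw [intervalIntegral.integral_eq_integral_of_support_subset, φi]
      intro y hy
      have := hR (subset_tsupport _ hy)
      simp only [Metric.mem_ball, dist_zero_right, Real.norm_eq_abs, abs_lt] at this
      exact ⟨this.1, by linarith⟩
  have key := h0 h hC1 hs
  have iψ : Integrable fun x => (ψ x : ℂ) * g x := by
    simpa using hg.integrable_smul_left_of_hasCompactSupport ψc ψs
  have iη : Integrable fun x => (η x : ℂ) * g x := by
    simpa using hg.integrable_smul_left_of_hasCompactSupport ηc ηs
  have e : (fun x => ((deriv h x : ℝ) : ℂ) * g x)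
      = fun x => (ψ x : ℂ) * g x - ((∫ y, ψ y : ℝ) : ℂ) * ((η x : ℂ) * g x) := by
    funext x
    rw [hd']
    simp only [φ]
    push_cast
    ring
  rw [e, integral_sub iψ (iη.const_mul _), integral_const_mul, sub_eq_zero] at key
  simp only [Complex.real_smul]
  rw [key, integral_mul_const, integral_complex_ofReal]

/-- The Wronskian of two weak solutions is constant: testing the equation for `f` with `g h` and
the equation for `g` with `f h` gives the same right-hand side. -/
theorem IsSolution.wronskian_ae_const {u : ℝ → ℝ} {μ : Measure ℝ} {z : ℂ} {f g : ℝ → ℂ}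
    (hf : IsSolution u μ z f) (hg : IsSolution u μ z g) :
    ∃ c : ℂ, ∀ᵐ x, f x * deriv g x - deriv f x * g x = c := by
  have fc := hf.1.locAC.continuous
  have gc := hg.1.locAC.continuous
  have li : LocallyIntegrable (fun x => f x * deriv g x - deriv f x * g x) volume := by
    refine (hg.1.locAC.locallyIntegrable_deriv.continuous_mul fc).sub ?_
    simpa only [mul_comm] using hf.1.locAC.locallyIntegrable_deriv.continuous_mul gc
  refine ae_const_of_integral_deriv_eq_zero li fun h hC hs => ?_
  have hh := memH1_of_contDiff hC hs
  have hs' : HasCompactSupport fun x => (h x : ℂ) := hs.comp_left Complex.ofReal_zero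
  have mf := hf.1.mul_memH1 hh hs'
  have mg := hg.1.mul_memH1 hh hs'
  have e1 := hf.2 _ mg hs'.mul_left
  have e2 := hg.2 _ mf hs'.mul_left
  have c1 : (fun x => f x * (g x * (h x : ℂ))) = fun x => g x * (f x * (h x : ℂ)) := by
    funext x; ring
  rw [c1, ← e2] at e1
  replace e1 := add_right_cancel e1
  have i1 : Integrable fun x => deriv f x * deriv (fun x => g x * (h x : ℂ)) x := by
    obtain ⟨R, -, hR⟩ := exists_Icc_of_hasCompactSupport (hs'.mul_left (f := g))
    exact integrable_mul_of_memLp (hf.1.sq_deriv _ _) mg.sq_deriv hR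
  have i2 : Integrable fun x => deriv g x * deriv (fun x => f x * (h x : ℂ)) x := by
    obtain ⟨R, -, hR⟩ := exists_Icc_of_hasCompactSupport (hs'.mul_left (f := f))
    exact integrable_mul_of_memLp (hg.1.sq_deriv _ _) mf.sq_deriv hR
  rw [← sub_eq_zero, ← integral_sub i1 i2] at e1
  rw [← neg_eq_zero, ← integral_neg, ← e1]
  refine integral_congr_ae ?_
  filter_upwards [hf.1.locAC.ae_deriv_mul hh.locAC, hg.1.locAC.ae_deriv_mul hh.locAC] with x h1 h2
  rw [h1, h2]
  have : deriv (fun x => (h x : ℂ)) x = ((deriv h x : ℝ) : ℂ) :=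
    ((hC.differentiable one_ne_zero x).hasDerivAt.ofReal_comp).deriv
  rw [this]
  ring

/-! ### Power series with factorially decaying real coefficients -/

/-- The sum of the power series with real coefficients `c`. -/
noncomputable def ser (c : ℕ → ℝ) (z : ℂ) : ℂ := ∑' n, (c n : ℂ) * z ^ n

/-- Coefficients of the size of those of `C exp (T z)`. -/
def FactorialBound (C T : ℝ) (c : ℕ → ℝ) : Prop := ∀ n, |c n| ≤ C * T ^ n / n.factorial

theorem FactorialBound.norm_term_le {C T : ℝ} {c : ℕ → ℝ} (hc : FactorialBound C T c) (z : ℂ)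
    (n : ℕ) : ‖(c n : ℂ) * z ^ n‖ ≤ C * ((T * ‖z‖) ^ n / n.factorial) := by
  rw [norm_mul, norm_pow, Complex.norm_real, Real.norm_eq_abs]
  refine (mul_le_mul_of_nonneg_right (hc n) (by positivity)).trans_eq ?_
  rw [mul_pow]
  ring

theorem hasSum_exp_real (C x : ℝ) : HasSum (fun n : ℕ => C * (x ^ n / n.factorial))
    (C * Real.exp x) := by
  have := NormedSpace.expSeries_div_hasSum_exp x
  rw [← Real.exp_eq_exp_ℝ] at this
  exact this.mul_left C

theorem FactorialBound.summable {C T : ℝ} {c : ℕ → ℝ} (hc : FactorialBound C T c) (z : ℂ) :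
    Summable fun n => (c n : ℂ) * z ^ n :=
  Summable.of_norm_bounded (hasSum_exp_real C (T * ‖z‖)).summable (hc.norm_term_le z)

theorem FactorialBound.norm_ser_le {C T : ℝ} {c : ℕ → ℝ} (hc : FactorialBound C T c) (z : ℂ) :
    ‖ser c z‖ ≤ C * Real.exp (T * ‖z‖) :=
  tsum_of_norm_bounded (hasSum_exp_real C (T * ‖z‖)) (hc.norm_term_le z)

theorem FactorialBound.differentiable {C T : ℝ} {c : ℕ → ℝ} (hc : FactorialBound C T c)
    (hC : 0 ≤ C) (hT : 0 ≤ T) : Differentiable ℂ (ser c) := by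
  intro z
  have h : DifferentiableOn ℂ (ser c) (Metric.ball 0 (‖z‖ + 1)) := by
    refine Complex.differentiableOn_tsum_of_summable_norm
      (hasSum_exp_real C (T * (‖z‖ + 1))).summable (fun n => ?_) Metric.isOpen_ball
      fun n y hy => (hc.norm_term_le y n).trans ?_
    · exact ((differentiable_id.pow n).const_mul _).differentiableOn
    · have : ‖y‖ ≤ ‖z‖ + 1 := by simpa using (Metric.mem_ball.1 hy).le
      gcongr
  exact (h z (by simp)).differentiableAt (Metric.isOpen_ball.mem_nhds (by simp))

theorem ser_conj (c : ℕ → ℝ) (z : ℂ) : ser c (starRingEnd ℂ z) = starRingEnd ℂ (ser c z) := by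
  simp [ser, Complex.conj_tsum]

theorem FactorialBound.ser_succ {C T : ℝ} {c : ℕ → ℝ} (hc : FactorialBound C T c) (z : ℂ) :
    ser c z = c 0 + z * ser (fun n => c (n + 1)) z := by
  rw [ser, (hc.summable z).tsum_eq_zero_add, ser, ← tsum_mul_left]
  congr 1
  · simp
  · exact tsum_congr fun n => by ring

/-! ### Integrals over half-lines -/

/-- The half-line of all real numbers to the left of the extended real number `x`. -/
def below (x : EReal) : Set ℝ := {y | (y : EReal) < x}

theorem measurableSet_below (x : EReal) : MeasurableSet (below x) :=
  measurable_coe_real_ereal measurableSet_Iio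

@[simp] theorem below_bot : below ⊥ = ∅ := by ext; simp [below]

@[simp] theorem below_top : below ⊤ = Set.univ := by ext; simp [below]

@[simp] theorem below_coe (x : ℝ) : below (x : EReal) = Set.Iio x := by ext; simp [below]

theorem Iio_subset_below {x : EReal} {s : ℝ} (hs : s ∈ below x) : Set.Iio s ⊆ below x :=
  fun _ hy => lt_trans (EReal.coe_lt_coe_iff.2 hy) hs

theorem measurable_integral_Iio {E : Type*} [NormedAddCommGroup E] [NormedSpace ℝ E]
    [MeasurableSpace E] [BorelSpace E] [SecondCountableTopology E]
    (m : Measure ℝ) [IsFiniteMeasure m] {φ : ℝ → E}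
    (hφ : Measurable φ) : Measurable fun x : ℝ => ∫ y in Set.Iio x, φ y ∂m := by
  have hA : MeasurableSet {q : ℝ × ℝ | q.2 < q.1} := measurableSet_lt measurable_snd measurable_fst
  have h : StronglyMeasurable ({q : ℝ × ℝ | q.2 < q.1}.indicator fun q => φ q.2) :=
    ((hφ.comp measurable_snd).indicator hA).stronglyMeasurable
  have h2 := (StronglyMeasurable.integral_prod_right' (ν := m) h).measurable
  convert h2 using 2 with x
  rw [← integral_indicator measurableSet_Iio]
  rfl

theorem tendsto_integral_Iio_atTop {m : Measure ℝ} {φ : ℝ → ℂ} (hφ : Integrable φ m) :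
    Tendsto (fun x : ℝ => ∫ y in Set.Iio x, φ y ∂m) atTop (𝓝 (∫ y, φ y ∂m)) :=
  (aecover_Iio tendsto_id).integral_tendsto_of_countably_generated hφ

theorem tendsto_integral_Iio_atBot {m : Measure ℝ} {φ : ℝ → ℂ} (hφ : Integrable φ m) :
    Tendsto (fun x : ℝ => ∫ y in Set.Iio x, φ y ∂m) atBot (𝓝 0) := by
  have h : Tendsto (fun x : ℝ => ∫ y in Set.Ici x, φ y ∂m) atBot (𝓝 (∫ y, φ y ∂m)) :=
    (aecover_Ici tendsto_id).integral_tendsto_of_countably_generated hφ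
  have h2 := (tendsto_const_nhds (x := ∫ y, φ y ∂m)).sub h
  rw [sub_self] at h2
  refine h2.congr fun x => ?_
  rw [← integral_add_compl (measurableSet_Iio (a := x)) hφ, Set.compl_Iio]
  ring

/-- Splitting a product of integrals along the diagonal, which carries no mass. -/
theorem integral_mul_integral_eq (α β : Measure ℝ) [SFinite α] [IsFiniteMeasure β]
    [NullSingletonClass α] {p q : ℝ → ℂ} (hp : Integrable p α) (hq : Integrable q β) :
    Integrable (fun s => p s * ∫ r in Set.Iio s, q r ∂β) α ∧
    Integrable (fun r => q r * ∫ s in Set.Iio r, p s ∂α) β ∧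
    (∫ s, p s ∂α) * (∫ r, q r ∂β) =
      (∫ s, p s * ∫ r in Set.Iio s, q r ∂β ∂α) + ∫ r, q r * ∫ s in Set.Iio r, p s ∂α ∂β := by
  have hA : MeasurableSet {x : ℝ × ℝ | x.2 < x.1} := measurableSet_lt measurable_snd measurable_fst
  have hΦ : Integrable (fun x : ℝ × ℝ => p x.1 * q x.2) (α.prod β) := hp.mul_prod hq
  have h1 := hΦ.indicator hA
  have h2 := hΦ.indicator hA.compl
  have e1 : (fun s => ∫ r, {x : ℝ × ℝ | x.2 < x.1}.indicator (fun x => p x.1 * q x.2) (s, r) ∂β)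
      = fun s => p s * ∫ r in Set.Iio s, q r ∂β := by
    funext s
    rw [← integral_const_mul, ← integral_indicator measurableSet_Iio]
    rfl
  have e2 : (fun r => ∫ s, {x : ℝ × ℝ | x.2 < x.1}ᶜ.indicator (fun x => p x.1 * q x.2) (s, r) ∂α)
      = fun r => q r * ∫ s in Set.Iio r, p s ∂α := by
    funext r
    rw [← integral_Iic_eq_integral_Iio, ← integral_const_mul,
      ← integral_indicator measurableSet_Iic]
    refine integral_congr_ae (ae_of_all _ fun s => ?_)
    by_cases h : r < s
    · simp [h, not_le.2 h]
    · simp [h, not_lt.1 h, mul_comm]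
  refine ⟨e1 ▸ h1.integral_prod_left, e2 ▸ h2.integral_prod_right, ?_⟩
  rw [← integral_prod_mul, ← integral_add_compl hA hΦ, ← integral_indicator hA,
    ← integral_indicator hA.compl, integral_prod _ h1, integral_prod_symm _ h2, e1, e2]

theorem setIntegral_below_mul (α β : Measure ℝ) [IsFiniteMeasure α] [IsFiniteMeasure β]
    [NullSingletonClass α] {p q : ℝ → ℂ} (hp : Integrable p α) (hq : Integrable q β) (x : EReal) :
    IntegrableOn (fun s => p s * ∫ r in Set.Iio s, q r ∂β) (below x) α ∧
    IntegrableOn (fun r => q r * ∫ s in Set.Iio r, p s ∂α) (below x) β ∧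
    (∫ s in below x, p s ∂α) * (∫ r in below x, q r ∂β) =
      (∫ s in below x, p s * ∫ r in Set.Iio s, q r ∂β ∂α)
        + ∫ r in below x, q r * ∫ s in Set.Iio r, p s ∂α ∂β := by
  have hN : NullSingletonClass (α.restrict (below x)) := inferInstance
  obtain ⟨-, -, h⟩ := integral_mul_integral_eq (α.restrict (below x)) (β.restrict (below x))
    hp.restrict hq.restrict
  obtain ⟨i1, i2, -⟩ := integral_mul_integral_eq α β hp hq
  refine ⟨i1.integrableOn, i2.integrableOn, ?_⟩
  have key : ∀ (m : Measure ℝ) (φ : ℝ → ℂ) (s : ℝ), s ∈ below x →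
      ∫ r in Set.Iio s, φ r ∂(m.restrict (below x)) = ∫ r in Set.Iio s, φ r ∂m := by
    intro m φ s hs
    rw [Measure.restrict_restrict measurableSet_Iio,
      Set.inter_eq_left.2 (Iio_subset_below hs)]
  rw [h]
  congr 1
  · exact setIntegral_congr_fun (measurableSet_below x) fun s hs => by
      simp only [key β q s hs]
  · exact setIntegral_congr_fun (measurableSet_below x) fun s hs => by
      simp only [key α p s hs]

/-! ### Iterated integrals -/

/-- The measure of the simplex `y₁ < y₂ < ⋯ < yₙ < x`. -/
noncomputable def simplexMass (τ : Measure ℝ) : ℕ → EReal → ℝ≥0∞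
  | 0, _ => 1
  | n + 1, x => ∫⁻ y in below x, simplexMass τ n y ∂τ

theorem measurable_simplexMass (τ : Measure ℝ) [IsFiniteMeasure τ] (n : ℕ) :
    Measurable fun x : ℝ => simplexMass τ n x := by
  induction n with
  | zero => exact measurable_const
  | succ n ih =>
    have hA : MeasurableSet {q : ℝ × ℝ | q.2 < q.1} :=
      measurableSet_lt measurable_snd measurable_fst
    have h : Measurable ({q : ℝ × ℝ | q.2 < q.1}.indicator fun q => simplexMass τ n q.2) :=
      (ih.comp measurable_snd).indicator hA
    have h2 := Measurable.lintegral_prod_right' (ν := τ) h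
    convert h2 using 2 with x
    rw [simplexMass, below_coe, ← lintegral_indicator measurableSet_Iio]
    rfl

/-- Inserting a further point into an ordered `n`-tuple gives `n + 1` disjoint sets of ordered
`n + 1`-tuples; points may carry mass, so this is only an inequality. -/
theorem simplexMass_succ_le (τ : Measure ℝ) [IsFiniteMeasure τ] (n : ℕ) (x : EReal) :
    (n + 1) * simplexMass τ (n + 1) x ≤ τ (below x) * simplexMass τ n x := by
  induction n generalizing x with
  | zero => simp [simplexMass]
  | succ n ih =>
    have hm := measurable_simplexMass τ n
    let τ' := τ.restrict (below x)
    have key : ∀ s ∈ below x, τ' (Set.Iio s) = τ (Set.Iio s) := fun s hs => by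
      rw [Measure.restrict_apply measurableSet_Iio, Set.inter_eq_left.2 (Iio_subset_below hs)]
    have e1 : (n + 1) * simplexMass τ (n + 2) x
        ≤ ∫⁻ s, simplexMass τ n s * τ' (Set.Iio s) ∂τ' := by
      rw [simplexMass, ← lintegral_const_mul _ (measurable_simplexMass τ (n + 1))]
      refine setLIntegral_mono' (measurableSet_below x) fun s hs => (ih s).trans_eq ?_
      rw [key s hs, below_coe, mul_comm]
    have e2 : simplexMass τ (n + 2) x = ∫⁻ s, simplexMass τ n s * τ' (Set.Ioi s) ∂τ' := by
      have hA : MeasurableSet {q : ℝ × ℝ | q.2 < q.1} :=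
        measurableSet_lt measurable_snd measurable_fst
      have h : Measurable ({q : ℝ × ℝ | q.2 < q.1}.indicator fun q => simplexMass τ n q.2) :=
        (hm.comp measurable_snd).indicator hA
      have h1 : simplexMass τ (n + 2) x = ∫⁻ r, ∫⁻ s,
          {q : ℝ × ℝ | q.2 < q.1}.indicator (fun q => simplexMass τ n q.2) (r, s) ∂τ' ∂τ' := by
        rw [simplexMass]
        refine setLIntegral_congr_fun (measurableSet_below x) fun r hr => ?_
        rw [simplexMass, below_coe, ← Set.inter_eq_left.2 (Iio_subset_below hr),
          ← Measure.restrict_restrict measurableSet_Iio, ← lintegral_indicator measurableSet_Iio]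
        rfl
      rw [h1, lintegral_lintegral_swap (f := fun r s =>
        {q : ℝ × ℝ | q.2 < q.1}.indicator (fun q => simplexMass τ n q.2) (r, s)) h.aemeasurable]
      refine lintegral_congr fun s => ?_
      rw [← lintegral_indicator_const measurableSet_Ioi]
      rfl
    calc ((n + 1 : ℕ) + 1) * simplexMass τ (n + 1 + 1) x
        = (n + 1) * simplexMass τ (n + 2) x + simplexMass τ (n + 2) x := by
          push_cast; ring
      _ ≤ ∫⁻ s, simplexMass τ n s * τ' (Set.Iio s) ∂τ'
          + ∫⁻ s, simplexMass τ n s * τ' (Set.Ioi s) ∂τ' := add_le_add e1 e2.le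
      _ = ∫⁻ s, simplexMass τ n s * (τ' (Set.Iio s) + τ' (Set.Ioi s)) ∂τ' := by
          rw [← lintegral_add_right]
          · simp_rw [mul_add]
          · refine hm.mul ?_
            exact Antitone.measurable fun a b hab => measure_mono (Set.Ioi_subset_Ioi hab)
      _ ≤ ∫⁻ s, simplexMass τ n s * τ' Set.univ ∂τ' := by
          refine lintegral_mono fun s => ?_
          gcongr
          rw [← measure_union _ measurableSet_Ioi]
          · exact measure_mono (Set.subset_univ _)
          · exact Set.disjoint_left.2 fun y (h1 : y < s) (h2 : s < y) => lt_asymm h1 h2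
      _ = τ (below x) * simplexMass τ (n + 1) x := by
          rw [lintegral_mul_const _ hm, Measure.restrict_apply_univ, mul_comm]
          rfl

theorem simplexMass_le (τ : Measure ℝ) [IsFiniteMeasure τ] (n : ℕ) (x : EReal) :
    n.factorial * simplexMass τ n x ≤ τ Set.univ ^ n := by
  induction n with
  | zero => simp [simplexMass]
  | succ n ih =>
    calc ((n + 1).factorial : ℝ≥0∞) * simplexMass τ (n + 1) x
        = n.factorial * ((n + 1) * simplexMass τ (n + 1) x) := by
          rw [Nat.factorial_succ]; push_cast; ring
      _ ≤ n.factorial * (τ (below x) * simplexMass τ n x) := by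
          exact mul_le_mul' le_rfl (simplexMass_succ_le τ n x)
      _ ≤ n.factorial * (τ Set.univ * simplexMass τ n x) := by
          gcongr; exact Set.subset_univ _
      _ = τ Set.univ * (n.factorial * simplexMass τ n x) := by ring
      _ ≤ τ Set.univ * τ Set.univ ^ n := by gcongr
      _ = τ Set.univ ^ (n + 1) := by rw [pow_succ']

/-! ### The first order system -/

/-- The coefficients of the first order system: a diffuse finite measure `ν`, a finite measure `κ`
and a function `w` that is square integrable with respect to `ν`. -/
structure CoeffData where
  ν : Measure ℝ
  κ : Measure ℝ
  w : ℝ → ℝ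
  finite_ν : IsFiniteMeasure ν
  finite_κ : IsFiniteMeasure κ
  diffuse : NullSingletonClass ν
  measurable_w : Measurable w
  integrable_sq : Integrable (fun x => w x ^ 2) ν

attribute [instance] CoeffData.finite_ν CoeffData.finite_κ CoeffData.diffuse

namespace CoeffData

variable (D : CoeffData)

theorem integrable_w : Integrable D.w D.ν := by
  refine ((integrable_const (1 : ℝ)).add D.integrable_sq).mono'
    D.measurable_w.aestronglyMeasurable (ae_of_all _ fun x => ?_)
  simp only [Pi.add_apply, Real.norm_eq_abs]
  nlinarith [sq_nonneg (|D.w x| - 1), sq_abs (D.w x)]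

/-- Bounded measurable complex functions on the line. -/
def BddMeas (φ : ℝ → ℂ) : Prop := Measurable φ ∧ ∃ C, ∀ x, ‖φ x‖ ≤ C

theorem BddMeas.mul {φ ψ : ℝ → ℂ} (hφ : BddMeas φ)
    (hψ : BddMeas ψ) : BddMeas fun x => φ x * ψ x := by
  obtain ⟨h1, C, hC⟩ := hφ
  obtain ⟨h2, C', hC'⟩ := hψ
  refine ⟨h1.mul h2, C * C', fun x => ?_⟩
  rw [norm_mul]
  exact mul_le_mul (hC x) (hC' x) (norm_nonneg _) ((norm_nonneg _).trans (hC x))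

theorem BddMeas.integrable_mul {φ : ℝ → ℂ} (hφ : BddMeas φ) {m : Measure ℝ} {k : ℝ → ℝ}
    (hk : Integrable k m) : Integrable (fun x => (k x : ℂ) * φ x) m := by
  obtain ⟨h1, C, hC⟩ := hφ
  refine (hk.norm.mul_const C).mono' (hk.ofReal.1.mul h1.aestronglyMeasurable)
    (ae_of_all _ fun x => ?_)
  rw [norm_mul, Complex.norm_real]
  exact mul_le_mul_of_nonneg_left (hC x) (norm_nonneg _)

theorem BddMeas.integrable {φ : ℝ → ℂ} (hφ : BddMeas φ) (m : Measure ℝ) [IsFiniteMeasure m] :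
    Integrable φ m := by
  simpa using hφ.integrable_mul (integrable_const (1 : ℝ) (μ := m))

variable {D} in
theorem BddMeas.integrable_w {φ : ℝ → ℂ} (hφ : BddMeas φ) :
    Integrable (fun x => (D.w x : ℂ) * φ x) D.ν := hφ.integrable_mul D.integrable_w

variable {D} in
theorem BddMeas.integrable_w_sq {φ : ℝ → ℂ} (hφ : BddMeas φ) :
    Integrable (fun x => (D.w x : ℂ) ^ 2 * φ x) D.ν := by
  simpa using hφ.integrable_mul D.integrable_sq

/-- Solutions of the system `dF = b (a w F + G) dν`, `dG = -a b w (a w F + G) dν - a² b F dκ` on the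
extended real line. The choice `a = z`, `b = 1` is the differential equation for the quotient `F` of
a solution and `cosh (x / 2)`; the choice `a = 1`, `b = z` is the canonical system for `z F`
and `G`, which is linear in `z`. The function `G` is continuous from the left, and the values at
the endpoints are the limits there. -/
structure IsSys (a b : ℂ) (F G : EReal → ℂ) : Prop where
  bddF : BddMeas fun x : ℝ => F x
  bddG : BddMeas fun x : ℝ => G x
  eqF : ∀ x, F x = F ⊥ + ∫ y in below x, b * (a * D.w y * F y + G y) ∂D.ν
  eqG : ∀ x, G x = G ⊥ - (∫ y in below x, a * b * D.w y * (a * D.w y * F y + G y) ∂D.ν)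
    - ∫ y in below x, a ^ 2 * b * F y ∂D.κ

variable {D}
variable {a b a' b' z ζ : ℂ} {F G F' G' : EReal → ℂ}

theorem IsSys.integrable_P (h : D.IsSys a b F G) :
    Integrable (fun y : ℝ => a * D.w y * F y + G y) D.ν := by
  refine ((h.bddF.integrable_w.const_mul a).add (h.bddG.integrable D.ν)).congr
    (ae_of_all _ fun y => ?_)
  simp only [Pi.add_apply]
  ring

theorem IsSys.integrable_wP (h : D.IsSys a b F G) :
    Integrable (fun y : ℝ => D.w y * (a * D.w y * F y + G y)) D.ν := by
  refine ((h.bddF.integrable_w_sq.const_mul a).add h.bddG.integrable_w).congr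
    (ae_of_all _ fun y => ?_)
  simp only [Pi.add_apply]
  ring

theorem IsSys.integrable_PG (h : D.IsSys a b F G) (hG : BddMeas fun x : ℝ => G' x) :
    Integrable (fun y : ℝ => (a * D.w y * F y + G y) * G' y) D.ν := by
  refine (((h.bddF.mul hG).integrable_w.const_mul a).add
    ((h.bddG.mul hG).integrable D.ν)).congr (ae_of_all _ fun y => ?_)
  simp only [Pi.add_apply]
  ring

theorem IsSys.integrable_wPF (h : D.IsSys a b F G) (hF : BddMeas fun x : ℝ => F' x) :
    Integrable (fun y : ℝ => D.w y * (a * D.w y * F y + G y) * F' y) D.ν := by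
  refine (((h.bddF.mul hF).integrable_w_sq.const_mul a).add
    (h.bddG.mul hF).integrable_w).congr (ae_of_all _ fun y => ?_)
  simp only [Pi.add_apply]
  ring

theorem IsSys.integrable_PP (h : D.IsSys a b F G) (h' : D.IsSys a' b' F' G') :
    Integrable (fun y : ℝ => (a * D.w y * F y + G y) * (a' * D.w y * F' y + G' y)) D.ν := by
  refine (((h.integrable_wPF h'.bddF).const_mul a').add (h.integrable_PG h'.bddG)).congr
    (ae_of_all _ fun y => ?_)
  simp only [Pi.add_apply]
  ring

/-- The product rule for the first component of one and the second component of another solution. -/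
theorem IsSys.mul_formula (h : D.IsSys a b F G) (h' : D.IsSys a' b' F' G') (x : EReal) :
    F' x * G x = F' ⊥ * G ⊥
      + (b' * ∫ y in below x, (a' * D.w y * F' y + G' y) * G y ∂D.ν)
      - (a * b * ∫ y in below x, D.w y * (a * D.w y * F y + G y) * F' y ∂D.ν)
      - a ^ 2 * b * ∫ y in below x, F y * F' y ∂D.κ := by
  have ip : Integrable (fun y : ℝ => b' * (a' * D.w y * F' y + G' y)) D.ν :=
    h'.integrable_P.const_mul _
  have i1 : Integrable (fun y : ℝ => a * b * D.w y * (a * D.w y * F y + G y)) D.ν := by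
    simpa only [mul_assoc] using h.integrable_wP.const_mul (a * b)
  have i2 : Integrable (fun y : ℝ => a ^ 2 * b * F y) D.κ := (h.bddF.integrable D.κ).const_mul _
  obtain ⟨j1, j2, e1⟩ := setIntegral_below_mul D.ν D.ν ip i1 x
  obtain ⟨j3, j4, e2⟩ := setIntegral_below_mul D.ν D.κ ip i2 x
  have k0 : ∫ y in below x, b' * (a' * D.w y * F' y + G' y) * G y ∂D.ν
      = (∫ y in below x, b' * (a' * D.w y * F' y + G' y) ∂D.ν) * G ⊥
        - (∫ y in below x, b' * (a' * D.w y * F' y + G' y)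
            * ∫ r in Set.Iio y, a * b * D.w r * (a * D.w r * F r + G r) ∂D.ν ∂D.ν)
        - ∫ y in below x, b' * (a' * D.w y * F' y + G' y)
            * ∫ r in Set.Iio y, a ^ 2 * b * F r ∂D.κ ∂D.ν := by
    have j5 : IntegrableOn (fun y : ℝ => b' * (a' * D.w y * F' y + G' y) * G ⊥
        - b' * (a' * D.w y * F' y + G' y)
          * ∫ r in Set.Iio y, a * b * D.w r * (a * D.w r * F r + G r) ∂D.ν) (below x) D.ν :=
      (ip.integrableOn.mul_const _).sub j1
    rw [← integral_mul_const, ← integral_sub (ip.integrableOn.mul_const _) j1,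
      ← integral_sub j5 j3]
    refine integral_congr_ae (ae_of_all _ fun y => ?_)
    simp only [h.eqG y, below_coe]
    ring
  have k1 : ∫ y in below x, a * b * D.w y * (a * D.w y * F y + G y) * F' y ∂D.ν
      = F' ⊥ * (∫ y in below x, a * b * D.w y * (a * D.w y * F y + G y) ∂D.ν)
        + ∫ y in below x, a * b * D.w y * (a * D.w y * F y + G y)
            * ∫ r in Set.Iio y, b' * (a' * D.w r * F' r + G' r) ∂D.ν ∂D.ν := by
    rw [← integral_const_mul, ← integral_add (i1.integrableOn.const_mul _) j2]
    refine integral_congr_ae (ae_of_all _ fun y => ?_)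
    simp only [h'.eqF y, below_coe]
    ring
  have k2 : ∫ y in below x, a ^ 2 * b * F y * F' y ∂D.κ
      = F' ⊥ * (∫ y in below x, a ^ 2 * b * F y ∂D.κ)
        + ∫ y in below x, a ^ 2 * b * F y
            * ∫ r in Set.Iio y, b' * (a' * D.w r * F' r + G' r) ∂D.ν ∂D.κ := by
    rw [← integral_const_mul, ← integral_add (i2.integrableOn.const_mul _) j4]
    refine integral_congr_ae (ae_of_all _ fun y => ?_)
    simp only [h'.eqF y, below_coe]
    ring
  have l0 : (b' * ∫ y in below x, (a' * D.w y * F' y + G' y) * G y ∂D.ν)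
      = ∫ y in below x, b' * (a' * D.w y * F' y + G' y) * G y ∂D.ν := by
    simp only [← integral_const_mul, mul_assoc]
  have l1 : (a * b * ∫ y in below x, D.w y * (a * D.w y * F y + G y) * F' y ∂D.ν)
      = ∫ y in below x, a * b * D.w y * (a * D.w y * F y + G y) * F' y ∂D.ν := by
    simp only [← integral_const_mul, mul_assoc]
  have l2 : (a ^ 2 * b * ∫ y in below x, F y * F' y ∂D.κ)
      = ∫ y in below x, a ^ 2 * b * F y * F' y ∂D.κ := by
    simp only [← integral_const_mul, mul_assoc]
  rw [l0, l1, l2, k0, k1, k2, h.eqG x, h'.eqF x]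
  linear_combination -e1 - e2

/-- The Wronskian of two solutions at the same spectral parameter is constant. -/
theorem IsSys.wronskian_eq (h : D.IsSys z 1 F G) (h' : D.IsSys z 1 F' G') (x : EReal) :
    F' x * G x - G' x * F x = F' ⊥ * G ⊥ - G' ⊥ * F ⊥ := by
  have e1 := h.mul_formula h' x
  have e2 := h'.mul_formula h x
  have e3 : ∫ y in below x, F' y * F y ∂D.κ = ∫ y in below x, F y * F' y ∂D.κ := by
    simp only [mul_comm]
  have e4 : (∫ y in below x, (z * D.w y * F' y + G' y) * G y ∂D.ν)
      + (z * ∫ y in below x, D.w y * (z * D.w y * F' y + G' y) * F y ∂D.ν)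
      = (∫ y in below x, (z * D.w y * F y + G y) * G' y ∂D.ν)
      + z * ∫ y in below x, D.w y * (z * D.w y * F y + G y) * F' y ∂D.ν := by
    rw [← integral_const_mul, ← integral_const_mul,
      ← integral_add (h'.integrable_PG h.bddG).integrableOn
        ((h'.integrable_wPF h.bddF).const_mul _).integrableOn,
      ← integral_add (h.integrable_PG h'.bddG).integrableOn
        ((h.integrable_wPF h'.bddF).const_mul _).integrableOn]
    refine integral_congr_ae (ae_of_all _ fun y => ?_)
    ring
  rw [e3] at e2
  linear_combination e1 - e2 + e4

/-- The **Lagrange identity** for the canonical system. -/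
theorem IsSys.lagrange (h : D.IsSys 1 z F G) (h' : D.IsSys 1 ζ F' G') (x : EReal) :
    F' x * G x - G' x * F x = F' ⊥ * G ⊥ - G' ⊥ * F ⊥
      + (ζ - z) * ((∫ y in below x, (D.w y * F y + G y) * (D.w y * F' y + G' y) ∂D.ν)
        + ∫ y in below x, F y * F' y ∂D.κ) := by
  have e1 := h.mul_formula h' x
  have e2 := h'.mul_formula h x
  have e3 : ∫ y in below x, F' y * F y ∂D.κ = ∫ y in below x, F y * F' y ∂D.κ := by
    simp only [mul_comm]
  have f1 : (∫ y in below x, (1 * D.w y * F y + G y) * (1 * D.w y * F' y + G' y) ∂D.ν)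
      = (∫ y in below x, D.w y * (1 * D.w y * F y + G y) * F' y ∂D.ν)
        + ∫ y in below x, (1 * D.w y * F y + G y) * G' y ∂D.ν := by
    rw [← integral_add (h.integrable_wPF h'.bddF).integrableOn
        (h.integrable_PG h'.bddG).integrableOn]
    refine integral_congr_ae (ae_of_all _ fun y => ?_)
    ring
  have f2 : (∫ y in below x, (1 * D.w y * F y + G y) * (1 * D.w y * F' y + G' y) ∂D.ν)
      = (∫ y in below x, D.w y * (1 * D.w y * F' y + G' y) * F y ∂D.ν)
        + ∫ y in below x, (1 * D.w y * F' y + G' y) * G y ∂D.ν := by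
    rw [← integral_add (h'.integrable_wPF h.bddF).integrableOn
        (h'.integrable_PG h.bddG).integrableOn]
    refine integral_congr_ae (ae_of_all _ fun y => ?_)
    ring
  have e4 : ∫ y in below x, ((D.w y : ℂ) * F y + G y) * (D.w y * F' y + G' y) ∂D.ν
      = ∫ y in below x, (1 * D.w y * F y + G y) * (1 * D.w y * F' y + G' y) ∂D.ν := by
    simp only [one_mul]
  rw [e3] at e2
  rw [e4]
  linear_combination e1 - e2 - ζ * f2 + z * f1

theorem BddMeas.conj {φ : ℝ → ℂ} (h : BddMeas φ) : BddMeas fun x => starRingEnd ℂ (φ x) := by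
  obtain ⟨h1, C, hC⟩ := h
  exact ⟨Complex.continuous_conj.measurable.comp h1, C, fun x => by simpa using hC x⟩

theorem BddMeas.const_mul {φ : ℝ → ℂ} (h : BddMeas φ) (c : ℂ) : BddMeas fun x => c * φ x :=
  BddMeas.mul ⟨measurable_const, ‖c‖, fun _ => le_rfl⟩ h

theorem BddMeas.add {φ ψ : ℝ → ℂ} (hφ : BddMeas φ) (hψ : BddMeas ψ) :
    BddMeas fun x => φ x + ψ x := by
  obtain ⟨h1, C, hC⟩ := hφ
  obtain ⟨h2, C', hC'⟩ := hψ
  exact ⟨h1.add h2, C + C', fun x => (norm_add_le _ _).trans (add_le_add (hC x) (hC' x))⟩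

theorem IsSys.conj (h : D.IsSys a b F G) : D.IsSys (starRingEnd ℂ a) (starRingEnd ℂ b)
    (fun x => starRingEnd ℂ (F x)) fun x => starRingEnd ℂ (G x) := by
  refine ⟨h.bddF.conj, h.bddG.conj, fun x => ?_, fun x => ?_⟩
  · rw [h.eqF x, map_add, ← integral_conj]
    simp
  · rw [h.eqG x, map_sub, map_sub, ← integral_conj, ← integral_conj]
    simp

theorem IsSys.const_mul (h : D.IsSys a b F G) (c : ℂ) :
    D.IsSys a b (fun x => c * F x) fun x => c * G x := by
  refine ⟨h.bddF.const_mul c, h.bddG.const_mul c, fun x => ?_, fun x => ?_⟩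
  · rw [h.eqF x, mul_add, ← integral_const_mul]
    congr 2
    funext y
    ring
  · rw [h.eqG x, mul_sub, mul_sub, ← integral_const_mul, ← integral_const_mul]
    congr 2
    · congr 1
      funext y
      ring
    · funext y
      ring

theorem IsSys.add (h : D.IsSys a b F G) (h' : D.IsSys a b F' G') :
    D.IsSys a b (fun x => F x + F' x) fun x => G x + G' x := by
  refine ⟨h.bddF.add h'.bddF, h.bddG.add h'.bddG, fun x => ?_, fun x => ?_⟩
  · have e : ∫ y in below x, b * (a * D.w y * (F y + F' y) + (G y + G' y)) ∂D.ν
        = (∫ y in below x, b * (a * D.w y * F y + G y) ∂D.ν)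
          + ∫ y in below x, b * (a * D.w y * F' y + G' y) ∂D.ν := by
      rw [← integral_add (h.integrable_P.const_mul b).integrableOn
        (h'.integrable_P.const_mul b).integrableOn]
      congr 1
      funext y
      ring
    rw [e, h.eqF x, h'.eqF x]
    ring
  · have i1 : ∀ {F G : EReal → ℂ}, D.IsSys a b F G →
        Integrable (fun y : ℝ => a * b * D.w y * (a * D.w y * F y + G y)) D.ν := fun h => by
      simpa only [mul_assoc] using h.integrable_wP.const_mul (a * b)
    have e : ∫ y in below x, a * b * D.w y * (a * D.w y * (F y + F' y) + (G y + G' y)) ∂D.ν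
        = (∫ y in below x, a * b * D.w y * (a * D.w y * F y + G y) ∂D.ν)
          + ∫ y in below x, a * b * D.w y * (a * D.w y * F' y + G' y) ∂D.ν := by
      rw [← integral_add (i1 h).integrableOn (i1 h').integrableOn]
      congr 1
      funext y
      ring
    have e' : ∫ y in below x, a ^ 2 * b * (F y + F' y) ∂D.κ
        = (∫ y in below x, a ^ 2 * b * F y ∂D.κ) + ∫ y in below x, a ^ 2 * b * F' y ∂D.κ := by
      rw [← integral_add ((h.bddF.integrable D.κ).const_mul _).integrableOn
        ((h'.bddF.integrable D.κ).const_mul _).integrableOn]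
      simp only [mul_add]
    rw [e, e', h.eqG x, h'.eqG x]
    ring

/-- The first component of the canonical system is `z` times that of the differential equation. -/
theorem IsSys.canonical (h : D.IsSys z 1 F G) : D.IsSys 1 z (fun x => z * F x) G := by
  refine ⟨h.bddF.const_mul z, h.bddG, fun x => ?_, fun x => ?_⟩
  · rw [h.eqF x, mul_add, ← integral_const_mul]
    congr 2
    funext y
    ring
  · rw [h.eqG x]
    congr 2
    · congr 1
      funext y
      ring
    · funext y
      ring

theorem IsSys.tendsto_F_top (h : D.IsSys a b F G) :
    Tendsto (fun x : ℝ => F x) atTop (𝓝 (F ⊤)) := by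
  simp only [h.eqF ⊤, below_top, Measure.restrict_univ]
  refine Tendsto.congr (fun x => ?_)
    ((tendsto_integral_Iio_atTop (h.integrable_P.const_mul b)).const_add (F ⊥))
  rw [h.eqF x, below_coe]

theorem IsSys.tendsto_F_bot (h : D.IsSys a b F G) :
    Tendsto (fun x : ℝ => F x) atBot (𝓝 (F ⊥)) := by
  have := (tendsto_integral_Iio_atBot (h.integrable_P.const_mul b)).const_add (F ⊥)
  rw [add_zero] at this
  refine this.congr fun x => ?_
  rw [h.eqF x, below_coe]

theorem IsSys.integrable_G (h : D.IsSys a b F G) :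
    Integrable (fun y : ℝ => a * b * D.w y * (a * D.w y * F y + G y)) D.ν := by
  simpa only [mul_assoc] using h.integrable_wP.const_mul (a * b)

theorem IsSys.tendsto_G_top (h : D.IsSys a b F G) :
    Tendsto (fun x : ℝ => G x) atTop (𝓝 (G ⊤)) := by
  simp only [h.eqG ⊤, below_top, Measure.restrict_univ]
  refine Tendsto.congr (fun x => ?_)
    (((tendsto_integral_Iio_atTop h.integrable_G).const_sub (G ⊥)).sub
      (tendsto_integral_Iio_atTop ((h.bddF.integrable D.κ).const_mul (a ^ 2 * b))))
  rw [h.eqG x, below_coe]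

theorem IsSys.tendsto_G_bot (h : D.IsSys a b F G) :
    Tendsto (fun x : ℝ => G x) atBot (𝓝 (G ⊥)) := by
  have := ((tendsto_integral_Iio_atBot h.integrable_G).const_sub (G ⊥)).sub
      (tendsto_integral_Iio_atBot ((h.bddF.integrable D.κ).const_mul (a ^ 2 * b)))
  rw [sub_zero, sub_zero] at this
  refine this.congr fun x => ?_
  rw [h.eqG x, below_coe]

end CoeffData
namespace CoeffData

variable (D : CoeffData)

/-! ### Power series solutions of the canonical system -/

/-- A finite measure dominating all the coefficients of the canonical system. -/
noncomputable def trace : Measure ℝ :=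
  D.ν.withDensity (fun x => ENNReal.ofReal (1 + |D.w x| + D.w x ^ 2)) + D.κ

instance : IsFiniteMeasure D.trace := by
  have h : IsFiniteMeasure
      (D.ν.withDensity (fun x => ENNReal.ofReal (1 + |D.w x| + D.w x ^ 2))) :=
    isFiniteMeasure_withDensity_ofReal
      (((integrable_const (1 : ℝ)).add D.integrable_w.abs).add D.integrable_sq).2
  unfold trace
  infer_instance

/-- The coefficients of `zⁿ` in the solution of the canonical system that starts
from `(p, q)` at `-∞`. -/
noncomputable def coeffs (p q : ℝ) : ℕ → EReal → ℝ × ℝ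
  | 0, _ => (p, q)
  | n + 1, x =>
    (∫ y in below x, D.w y * (coeffs p q n y).1 + (coeffs p q n y).2 ∂D.ν,
      -(∫ y in below x, D.w y * (D.w y * (coeffs p q n y).1 + (coeffs p q n y).2) ∂D.ν)
        - ∫ y in below x, (coeffs p q n y).1 ∂D.κ)

variable (p q : ℝ)

theorem measurable_coeffs (n : ℕ) :
    (Measurable fun x : ℝ => (D.coeffs p q n x).1) ∧
      Measurable fun x : ℝ => (D.coeffs p q n x).2 := by
  induction n with
  | zero => exact ⟨measurable_const, measurable_const⟩
  | succ n ih =>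
    obtain ⟨h1, h2⟩ := ih
    have h3 : Measurable fun y : ℝ =>
        D.w y * (D.coeffs p q n y).1 + (D.coeffs p q n y).2 := (D.measurable_w.mul h1).add h2
    simp only [coeffs, below_coe]
    exact ⟨measurable_integral_Iio _ h3,
      (measurable_integral_Iio _ (D.measurable_w.mul h3)).neg.sub (measurable_integral_Iio _ h1)⟩

theorem enorm_coeffs_le (n : ℕ) (x : EReal) :
    ‖(D.coeffs p q n x).1‖ₑ + ‖(D.coeffs p q n x).2‖ₑ
      ≤ (‖p‖ₑ + ‖q‖ₑ) * simplexMass D.trace n x := by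
  induction n generalizing x with
  | zero => simp [coeffs, simplexMass]
  | succ n ih =>
    obtain ⟨h1, h2⟩ := D.measurable_coeffs p q n
    have hw := D.measurable_w
    set f : ℝ → ℝ := fun y => (D.coeffs p q n y).1 with hf
    set g : ℝ → ℝ := fun y => (D.coeffs p q n y).2 with hg
    have hP : Measurable fun y => D.w y * f y + g y := (hw.mul h1).add h2
    have a1 : ‖(D.coeffs p q (n + 1) x).1‖ₑ ≤ ∫⁻ y in below x, ‖D.w y * f y + g y‖ₑ ∂D.ν :=
      enorm_integral_le_lintegral_enorm _
    have a2 : ‖(D.coeffs p q (n + 1) x).2‖ₑ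
        ≤ (∫⁻ y in below x, ‖D.w y * (D.w y * f y + g y)‖ₑ ∂D.ν)
          + ∫⁻ y in below x, ‖f y‖ₑ ∂D.κ := by
      simp only [coeffs]
      refine (enorm_sub_le).trans (add_le_add ?_ (enorm_integral_le_lintegral_enorm _))
      rw [enorm_neg]
      exact enorm_integral_le_lintegral_enorm _
    have a3 : ∫⁻ y in below x, (‖f y‖ₑ + ‖g y‖ₑ) ∂D.trace
        = (∫⁻ y in below x, ENNReal.ofReal (1 + |D.w y| + D.w y ^ 2)
            * (‖f y‖ₑ + ‖g y‖ₑ) ∂D.ν) + ∫⁻ y in below x, (‖f y‖ₑ + ‖g y‖ₑ) ∂D.κ := by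
      rw [trace, Measure.restrict_add, lintegral_add_measure,
        restrict_withDensity (measurableSet_below x)]
      congr 1
      rw [lintegral_withDensity_eq_lintegral_mul]
      · rfl
      · exact ((measurable_const.add hw.abs).add (hw.pow_const 2)).ennreal_ofReal
      · exact h1.enorm.add h2.enorm
    have a4 : ∀ y, ‖D.w y * f y + g y‖ₑ + ‖D.w y * (D.w y * f y + g y)‖ₑ
        ≤ ENNReal.ofReal (1 + |D.w y| + D.w y ^ 2) * (‖f y‖ₑ + ‖g y‖ₑ) := by
      intro y
      simp only [Real.enorm_eq_ofReal_abs]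
      rw [← ENNReal.ofReal_add (abs_nonneg _) (abs_nonneg _),
        ← ENNReal.ofReal_add (abs_nonneg _) (abs_nonneg _), ← ENNReal.ofReal_mul (by positivity)]
      refine ENNReal.ofReal_le_ofReal ?_
      have b1 := abs_add_le (D.w y * f y) (g y)
      rw [abs_mul] at b1
      rw [abs_mul]
      have b2 := mul_le_mul_of_nonneg_left b1 (abs_nonneg (D.w y))
      have b3 := sq_abs (D.w y)
      have b4 : 0 ≤ |D.w y| ^ 2 * |g y| := by positivity
      have b5 := abs_nonneg (f y)
      rw [← b3]
      nlinarith
    calc ‖(D.coeffs p q (n + 1) x).1‖ₑ + ‖(D.coeffs p q (n + 1) x).2‖ₑ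
        ≤ (∫⁻ y in below x, ‖D.w y * f y + g y‖ₑ ∂D.ν)
          + ((∫⁻ y in below x, ‖D.w y * (D.w y * f y + g y)‖ₑ ∂D.ν)
          + ∫⁻ y in below x, ‖f y‖ₑ ∂D.κ) := add_le_add a1 a2
      _ = (∫⁻ y in below x, (‖D.w y * f y + g y‖ₑ + ‖D.w y * (D.w y * f y + g y)‖ₑ) ∂D.ν)
          + ∫⁻ y in below x, ‖f y‖ₑ ∂D.κ := by
          rw [lintegral_add_left hP.enorm, add_assoc]
      _ ≤ ∫⁻ y in below x, (‖f y‖ₑ + ‖g y‖ₑ) ∂D.trace := by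
          rw [a3]
          exact add_le_add (lintegral_mono a4) (lintegral_mono fun y => le_self_add)
      _ ≤ ∫⁻ y in below x, (‖p‖ₑ + ‖q‖ₑ) * simplexMass D.trace n y ∂D.trace :=
          lintegral_mono fun y => ih y
      _ = (‖p‖ₑ + ‖q‖ₑ) * simplexMass D.trace (n + 1) x := by
          rw [lintegral_const_mul _ (measurable_simplexMass D.trace n)]
          rfl

/-- The total mass of the dominating measure, which bounds the exponential type of the
power series solutions. -/
noncomputable def mass : ℝ := (D.trace Set.univ).toReal

theorem abs_coeffs_le (n : ℕ) (x : EReal) :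
    |(D.coeffs p q n x).1| + |(D.coeffs p q n x).2|
      ≤ (|p| + |q|) * D.mass ^ n / n.factorial := by
  have h1 := D.enorm_coeffs_le p q n x
  have h2 := simplexMass_le D.trace n x
  have h3 : (n.factorial : ℝ≥0∞) * (‖(D.coeffs p q n x).1‖ₑ + ‖(D.coeffs p q n x).2‖ₑ)
      ≤ (‖p‖ₑ + ‖q‖ₑ) * D.trace Set.univ ^ n := by
    calc _ ≤ (n.factorial : ℝ≥0∞) * ((‖p‖ₑ + ‖q‖ₑ) * simplexMass D.trace n x) := by gcongr
      _ = (‖p‖ₑ + ‖q‖ₑ) * (n.factorial * simplexMass D.trace n x) := by ring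
      _ ≤ _ := by gcongr
  have h4 := ENNReal.toReal_mono (by finiteness) h3
  rw [ENNReal.toReal_mul, ENNReal.toReal_mul, ENNReal.toReal_add (by finiteness) (by finiteness),
    ENNReal.toReal_add (by finiteness) (by finiteness), ENNReal.toReal_pow] at h4
  simp only [toReal_enorm, Real.norm_eq_abs, ENNReal.toReal_natCast] at h4
  rw [le_div_iff₀ (by positivity), mul_comm]
  exact h4

theorem mass_nonneg : 0 ≤ D.mass := ENNReal.toReal_nonneg

theorem factorialBound_fst (x : EReal) :
    FactorialBound (|p| + |q|) D.mass fun n => (D.coeffs p q n x).1 := fun n =>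
  (le_add_of_nonneg_right (abs_nonneg _)).trans (D.abs_coeffs_le p q n x)

theorem factorialBound_snd (x : EReal) :
    FactorialBound (|p| + |q|) D.mass fun n => (D.coeffs p q n x).2 := fun n =>
  (le_add_of_nonneg_left (abs_nonneg _)).trans (D.abs_coeffs_le p q n x)

/-- First component of the solution of the canonical system that starts from `(p, q)`. -/
noncomputable def solX (z : ℂ) (x : EReal) : ℂ := ser (fun n => (D.coeffs p q n x).1) z

/-- Second component of the solution of the canonical system that starts from `(p, q)`. -/
noncomputable def solG (z : ℂ) (x : EReal) : ℂ := ser (fun n => (D.coeffs p q n x).2) z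

/-- The quotient of `solX - p` and `z`, entire in `z` as well. -/
noncomputable def solF (z : ℂ) (x : EReal) : ℂ := ser (fun n => (D.coeffs p q (n + 1) x).1) z

theorem factorialBound_solF (x : EReal) : FactorialBound ((|p| + |q|) * D.mass) D.mass
    fun n => (D.coeffs p q (n + 1) x).1 := fun n => by
  refine (D.factorialBound_fst p q x (n + 1)).trans ?_
  have := D.mass_nonneg
  rw [pow_succ', mul_assoc]
  gcongr
  exact Nat.le_succ n

variable {p q} in
theorem solX_eq (z : ℂ) (x : EReal) : D.solX p q z x = p + z * D.solF p q z x :=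
  (D.factorialBound_fst p q x).ser_succ z

@[simp] theorem solX_bot (z : ℂ) : D.solX p q z ⊥ = p := by
  rw [solX_eq, solF]
  simp [ser, coeffs]

@[simp] theorem solF_bot (z : ℂ) : D.solF p q z ⊥ = 0 := by
  simp [solF, ser, coeffs]

@[simp] theorem solG_bot (z : ℂ) : D.solG p q z ⊥ = q := by
  rw [solG, (D.factorialBound_snd p q ⊥).ser_succ]
  simp [ser, coeffs]

theorem measurable_ser {φ : ℕ → ℝ → ℝ} (hφ : ∀ n, Measurable (φ n)) {C T : ℝ}
    (hb : ∀ y, FactorialBound C T fun n => φ n y) (z : ℂ) :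
    Measurable fun y => ser (fun n => φ n y) z := by
  refine measurable_of_tendsto_metrizable
    (f := fun N y => ∑ n ∈ Finset.range N, (φ n y : ℂ) * z ^ n) (fun N => ?_) ?_
  · exact Finset.measurable_sum _ fun n _ =>
      (Complex.measurable_ofReal.comp (hφ n)).mul_const _
  · exact tendsto_pi_nhds.2 fun y => ((hb y).summable z).hasSum.tendsto_sum_nat

theorem bddMeas_ser {φ : ℕ → ℝ → ℝ} (hφ : ∀ n, Measurable (φ n)) {C T : ℝ}
    (hb : ∀ y, FactorialBound C T fun n => φ n y) (z : ℂ) :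
    BddMeas fun y => ser (fun n => φ n y) z :=
  ⟨measurable_ser hφ hb z, C * Real.exp (T * ‖z‖), fun y => (hb y).norm_ser_le z⟩

theorem bddMeas_solX (z : ℂ) : BddMeas fun x : ℝ => D.solX p q z x :=
  bddMeas_ser (fun n => (D.measurable_coeffs p q n).1) (fun y => D.factorialBound_fst p q y) z

theorem bddMeas_solG (z : ℂ) : BddMeas fun x : ℝ => D.solG p q z x :=
  bddMeas_ser (fun n => (D.measurable_coeffs p q n).2) (fun y => D.factorialBound_snd p q y) z

theorem bddMeas_solF (z : ℂ) : BddMeas fun x : ℝ => D.solF p q z x :=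
  bddMeas_ser (fun n => (D.measurable_coeffs p q (n + 1)).1)
    (fun y => D.factorialBound_solF p q y) z

/-- Integration of a power series with coefficients depending on the integration variable. -/
theorem hasSum_integral_ser {m : Measure ℝ} {k : ℝ → ℝ} (hk : Integrable k m) {φ : ℕ → ℝ → ℝ}
    (hφ : ∀ n, Measurable (φ n)) {C T : ℝ} (hb : ∀ y, FactorialBound C T fun n => φ n y) (z : ℂ) :
    HasSum (fun n => ((∫ y, k y * φ n y ∂m : ℝ) : ℂ) * z ^ n)
      (∫ y, (k y : ℂ) * ser (fun n => φ n y) z ∂m) := by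
  have hi : ∀ n, Integrable (fun y => (k y : ℂ) * ((φ n y : ℂ) * z ^ n)) m := by
    intro n
    refine BddMeas.integrable_mul (φ := fun y => (φ n y : ℂ) * z ^ n)
      ⟨(Complex.measurable_ofReal.comp (hφ n)).mul_const _, _,
      fun y => (hb y).norm_term_le z n⟩ hk
  have hs : Summable fun n => ∫ y, ‖(k y : ℂ) * ((φ n y : ℂ) * z ^ n)‖ ∂m := by
    refine Summable.of_nonneg_of_le (fun n => integral_nonneg fun y => norm_nonneg _)
      (fun n => ?_) ((hasSum_exp_real (C * ∫ y, ‖k y‖ ∂m) (T * ‖z‖)).summable)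
    have : (C * ∫ y, ‖k y‖ ∂m) * ((T * ‖z‖) ^ n / n.factorial)
        = ∫ y, ‖k y‖ * (C * ((T * ‖z‖) ^ n / n.factorial)) ∂m := by
      rw [integral_mul_const]; ring
    rw [this]
    refine integral_mono (hi n).norm (hk.norm.mul_const _) fun y => ?_
    simp only
    rw [norm_mul, Complex.norm_real]
    exact mul_le_mul_of_nonneg_left ((hb y).norm_term_le z n) (norm_nonneg _)
  have h := hasSum_integral_of_summable_integral_norm hi hs
  have e : ∀ n, ∫ y, (k y : ℂ) * ((φ n y : ℂ) * z ^ n) ∂m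
      = ((∫ y, k y * φ n y ∂m : ℝ) : ℂ) * z ^ n := by
    intro n
    rw [← integral_complex_ofReal, ← integral_mul_const]
    congr 1
    funext y
    push_cast
    ring
  simp only [e] at h
  have e2 : (fun y => (k y : ℂ) * ser (fun n => φ n y) z)
      = fun y => ∑' n, (k y : ℂ) * ((φ n y : ℂ) * z ^ n) := by
    funext y
    rw [ser, tsum_mul_left]
  rw [e2]
  exact h

theorem integrable_coeffs {m : Measure ℝ} {k : ℝ → ℝ} (hk : Integrable k m) (n : ℕ) :
    Integrable (fun y : ℝ => k y * (D.coeffs p q n y).1) m ∧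
    Integrable (fun y : ℝ => k y * (D.coeffs p q n y).2) m := by
  obtain ⟨h1, h2⟩ := D.measurable_coeffs p q n
  constructor
  · refine hk.mul_bdd h1.aestronglyMeasurable (ae_of_all _ fun y => D.factorialBound_fst p q y n)
  · refine hk.mul_bdd h2.aestronglyMeasurable (ae_of_all _ fun y => D.factorialBound_snd p q y n)

theorem solF_eq_integral (z : ℂ) (x : EReal) :
    D.solF p q z x = ∫ y in below x, (D.w y * D.solX p q z y + D.solG p q z y) ∂D.ν := by
  have h1 : HasSum _ (∫ y in below x, (D.w y : ℂ) * D.solX p q z y ∂D.ν) :=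
    hasSum_integral_ser (D.integrable_w.restrict (s := below x))
      (fun n => (D.measurable_coeffs p q n).1) (fun y => D.factorialBound_fst p q y) z
  have h2 : HasSum _ (∫ y in below x, ((1 : ℝ) : ℂ) * D.solG p q z y ∂D.ν) :=
    hasSum_integral_ser ((integrable_const (1 : ℝ) (μ := D.ν)).restrict (s := below x))
      (fun n => (D.measurable_coeffs p q n).2) (fun y => D.factorialBound_snd p q y) z
  have h3 := (h1.add h2).tsum_eq
  rw [← integral_add (D.bddMeas_solX p q z).integrable_w.restrict
    ((D.bddMeas_solG p q z).integrable_mul (integrable_const (1 : ℝ))).restrict] at h3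
  simp only [Complex.ofReal_one, one_mul] at h3
  rw [← h3, solF, ser]
  refine tsum_congr fun n => ?_
  have i1 := (D.integrable_coeffs p q D.integrable_w n).1.restrict (s := below x)
  have i2 := (D.integrable_coeffs p q (integrable_const (1 : ℝ) (μ := D.ν)) n).2.restrict
    (s := below x)
  simp only [one_mul] at i2
  rw [coeffs, integral_add i1 i2]
  push_cast
  ring

theorem solG_eq_integral (z : ℂ) (x : EReal) :
    D.solG p q z x = q
      - z * (∫ y in below x, D.w y * (D.w y * D.solX p q z y + D.solG p q z y) ∂D.ν)
      - z * ∫ y in below x, D.solX p q z y ∂D.κ := by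
  have h1 : HasSum _ (∫ y in below x, ((D.w y ^ 2 : ℝ) : ℂ) * D.solX p q z y ∂D.ν) :=
    hasSum_integral_ser (D.integrable_sq.restrict (s := below x))
      (fun n => (D.measurable_coeffs p q n).1) (fun y => D.factorialBound_fst p q y) z
  have h2 : HasSum _ (∫ y in below x, (D.w y : ℂ) * D.solG p q z y ∂D.ν) :=
    hasSum_integral_ser (D.integrable_w.restrict (s := below x))
      (fun n => (D.measurable_coeffs p q n).2) (fun y => D.factorialBound_snd p q y) z
  have h3 : HasSum _ (∫ y in below x, ((1 : ℝ) : ℂ) * D.solX p q z y ∂D.κ) :=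
    hasSum_integral_ser ((integrable_const (1 : ℝ) (μ := D.κ)).restrict (s := below x))
      (fun n => (D.measurable_coeffs p q n).1) (fun y => D.factorialBound_fst p q y) z
  have h4 := ((h1.add h2).add h3).tsum_eq
  rw [← integral_add ((D.bddMeas_solX p q z).integrable_mul D.integrable_sq).restrict
    (D.bddMeas_solG p q z).integrable_w.restrict] at h4
  have e1 : ∫ y in below x, (D.w y : ℂ) * (D.w y * D.solX p q z y + D.solG p q z y) ∂D.ν
      = ∫ y in below x, (((D.w y ^ 2 : ℝ) : ℂ) * D.solX p q z y
        + (D.w y : ℂ) * D.solG p q z y) ∂D.ν := by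
    refine integral_congr_ae (ae_of_all _ fun y => ?_)
    push_cast
    ring
  rw [← e1] at h4
  simp only [Complex.ofReal_one, one_mul] at h4
  rw [solG, (D.factorialBound_snd p q x).ser_succ, sub_sub, ← mul_add, ← h4, sub_eq_add_neg,
    ← mul_neg, ← tsum_neg, ser]
  congr 2
  refine tsum_congr fun n => ?_
  have i1 := (D.integrable_coeffs p q D.integrable_sq n).1.restrict (s := below x)
  have i2 := (D.integrable_coeffs p q D.integrable_w n).2.restrict (s := below x)
  have e2 : ∫ y in below x, D.w y * (D.w y * (D.coeffs p q n y).1 + (D.coeffs p q n y).2) ∂D.ν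
      = (∫ y in below x, D.w y ^ 2 * (D.coeffs p q n y).1 ∂D.ν)
        + ∫ y in below x, D.w y * (D.coeffs p q n y).2 ∂D.ν := by
    rw [← integral_add i1 i2]
    refine integral_congr_ae (ae_of_all _ fun y => ?_)
    ring
  rw [coeffs, e2]
  push_cast
  ring

/-- The power series solve the canonical system. -/
theorem isSys_solX (z : ℂ) : D.IsSys 1 z (D.solX p q z) (D.solG p q z) := by
  refine ⟨D.bddMeas_solX p q z, D.bddMeas_solG p q z, fun x => ?_, fun x => ?_⟩
  · rw [solX_bot, integral_const_mul, solX_eq, solF_eq_integral]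
    simp only [one_mul]
  · rw [solG_bot, solG_eq_integral, ← integral_const_mul, ← integral_const_mul]
    congr 2
    · congr 1
      funext y
      ring
    · funext y
      ring

/-- The solution of the system for the differential equation starting from `(0, 1)`. -/
theorem isSys_solF (z : ℂ) : D.IsSys z 1 (D.solF 0 1 z) (D.solG 0 1 z) := by
  have hX : ∀ y, D.solX 0 1 z y = z * D.solF 0 1 z y := fun y => by simp [solX_eq]
  refine ⟨D.bddMeas_solF 0 1 z, D.bddMeas_solG 0 1 z, fun x => ?_, fun x => ?_⟩
  · rw [solF_bot, zero_add, solF_eq_integral]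
    congr 1
    funext y
    rw [hX]
    ring
  · rw [solG_bot, solG_eq_integral, ← integral_const_mul, ← integral_const_mul]
    congr 2
    · congr 1
      funext y
      rw [hX]
      ring
    · funext y
      rw [hX]
      ring

/-- The solution of the system for the differential equation starting from `(1, 0)`. -/
theorem isSys_solX_one (z : ℂ) :
    D.IsSys z 1 (D.solX 1 0 z) fun x => z * D.solG 1 0 z x := by
  refine ⟨D.bddMeas_solX 1 0 z, (D.bddMeas_solG 1 0 z).const_mul z, fun x => ?_, fun x => ?_⟩
  · rw [solX_bot, solX_eq, solF_eq_integral, ← integral_const_mul]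
    congr 2
    funext y
    ring
  · rw [solG_bot, solG_eq_integral, mul_sub, mul_sub, ← mul_assoc, ← mul_assoc,
      ← integral_const_mul, ← integral_const_mul]
    congr 2
    · congr 1
      funext y
      ring
    · funext y
      ring

end CoeffData
/-! ### Logarithmic integrals -/

/-- The Cayley transform from the unit disc onto the upper half-plane. -/
noncomputable def cayley (w : ℂ) : ℂ := Complex.I * (1 + w) / (1 - w)

theorem one_sub_ne_zero_of_norm_lt {w : ℂ} (hw : ‖w‖ < 1) : 1 - w ≠ 0 := by
  intro h
  rw [sub_eq_zero] at h
  rw [← h] at hw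
  simp at hw

theorem cayley_im_nonneg {w : ℂ} (hw : ‖w‖ < 1) : 0 ≤ (cayley w).im := by
  have h1 : (cayley w).im = (1 - ‖w‖ ^ 2) / ‖1 - w‖ ^ 2 := by
    rw [cayley, Complex.div_im, ← Complex.normSq_eq_norm_sq, ← Complex.normSq_eq_norm_sq]
    simp only [Complex.normSq_apply, Complex.mul_re, Complex.mul_im, Complex.I_re, Complex.I_im,
      Complex.add_re, Complex.add_im, Complex.sub_re, Complex.sub_im, Complex.one_re,
      Complex.one_im]
    ring
  rw [h1]
  have : ‖w‖ ^ 2 ≤ 1 := by nlinarith [norm_nonneg w]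
  exact div_nonneg (by linarith) (by positivity)

theorem cayley_arctan (t : ℝ) :
    1 - circleMap 0 1 (Real.pi + 2 * Real.arctan t) ≠ 0 ∧
      cayley (circleMap 0 1 (Real.pi + 2 * Real.arctan t)) = t := by
  set c := Real.cos (Real.arctan t) with hc
  have hc0 : 0 < c := Real.cos_arctan_pos t
  have hs : Real.sin (Real.arctan t) = t * c := by
    have h := Real.tan_arctan t
    rw [Real.tan_eq_sin_div_cos, div_eq_iff hc0.ne'] at h
    exact h
  have h1 : (c : ℂ) ^ 2 * ((1 + t * Complex.I) * (1 - t * Complex.I)) = 1 := by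
    have h := Real.sin_sq_add_cos_sq (Real.arctan t)
    rw [hs, ← hc] at h
    have h' : ((c ^ 2 * (1 + t ^ 2) : ℝ) : ℂ) = 1 := by
      rw [← Complex.ofReal_one]; congr 1; linarith
    push_cast at h'
    linear_combination h' - (c : ℂ) ^ 2 * t ^ 2 * Complex.I_sq
  have e : circleMap 0 1 (Real.pi + 2 * Real.arctan t)
      = -((c : ℂ) ^ 2 * (1 + t * Complex.I) ^ 2) := by
    have h2 : Complex.exp ((Real.arctan t : ℂ) * Complex.I) = c * (1 + t * Complex.I) := by
      rw [Complex.exp_mul_I, ← Complex.ofReal_cos, ← Complex.ofReal_sin, hs, ← hc]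
      push_cast
      ring
    rw [circleMap, zero_add, Complex.ofReal_one, one_mul, Complex.ofReal_add, Complex.ofReal_mul,
      Complex.ofReal_ofNat, add_mul, Complex.exp_add, Complex.exp_pi_mul_I, mul_assoc, two_mul,
      Complex.exp_add, h2]
    ring
  have hne : (1 : ℂ) + t * Complex.I ≠ 0 := fun h => by
    have := congrArg Complex.re h
    simp at this
  have e2 : 1 - circleMap 0 1 (Real.pi + 2 * Real.arctan t)
      = 2 * (c : ℂ) ^ 2 * (1 + t * Complex.I) := by
    rw [e]; linear_combination -h1
  have hne2 : 1 - circleMap 0 1 (Real.pi + 2 * Real.arctan t) ≠ 0 := by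
    rw [e2]
    exact mul_ne_zero (mul_ne_zero two_ne_zero (pow_ne_zero _ (by exact_mod_cast hc0.ne'))) hne
  refine ⟨hne2, ?_⟩
  rw [cayley, div_eq_iff hne2, e2, e]
  linear_combination (-Complex.I) * h1 - 2 * (c : ℂ) ^ 2 * (1 + t * Complex.I) * t * Complex.I_sq

theorem hasDerivAt_pi_add_two_arctan (t : ℝ) :
    HasDerivAt (fun t => Real.pi + 2 * Real.arctan t) (2 / (1 + t ^ 2)) t := by
  have := ((Real.hasDerivAt_arctan t).const_mul 2).const_add Real.pi
  convert! this using 1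
  ring

/-- An entire function that is at least one in modulus on the closed upper half-plane has a finite
logarithmic integral: the Poisson integral of the non-negative harmonic function `log ‖a‖`
is bounded by its value at `i`, as one sees from the mean value property on discs in the
Cayley-transformed picture and Fatou's lemma. -/
theorem lintegral_log_norm_lt_top {a : ℂ → ℂ} (ha : Differentiable ℂ a)
    (h1 : ∀ z : ℂ, 0 ≤ z.im → 1 ≤ ‖a z‖) :
    ∫⁻ t : ℝ, ENNReal.ofReal (Real.log ‖a t‖ / (1 + t ^ 2)) < ⊤ := by
  let g : ℂ → ℂ := fun w => a (cayley w)
  have hd : ∀ w, 1 - w ≠ 0 → DifferentiableAt ℂ g w := fun w hw => by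
    refine (ha _).comp w ?_
    unfold cayley
    exact DifferentiableAt.div (by fun_prop) (by fun_prop) hw
  have hg1 : ∀ w : ℂ, ‖w‖ < 1 → 1 ≤ ‖g w‖ := fun w hw => h1 _ (cayley_im_nonneg hw)
  have han : AnalyticOnNhd ℂ g (Metric.ball 0 1) :=
    DifferentiableOn.analyticOnNhd (fun w hw => (hd w (one_sub_ne_zero_of_norm_lt
      (by simpa using hw))).differentiableWithinAt) Metric.isOpen_ball
  let L := 2 * Real.pi * Real.log ‖a Complex.I‖
  let r : ℕ → ℝ := fun n => 1 - 1 / ((n : ℝ) + 1)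
  have r0 : ∀ n, 0 ≤ r n := fun n => by
    have : 1 / ((n : ℝ) + 1) ≤ 1 := by
      rw [div_le_one (by positivity)]; linarith [Nat.cast_nonneg (α := ℝ) n]
    simp only [r]; linarith
  have r1 : ∀ n, r n < 1 := fun n => by
    have : 0 < 1 / ((n : ℝ) + 1) := by positivity
    simp only [r]; linarith
  have rl : Tendsto r atTop (𝓝 1) := by
    have := tendsto_one_div_add_atTop_nhds_zero_nat (𝕜 := ℝ).const_sub 1
    simpa [r] using this
  have hn : ∀ n θ, ‖circleMap 0 (r n) θ‖ < 1 := fun n θ => by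
    simpa [abs_of_nonneg (r0 n)] using r1 n
  have hc : ∀ n, Continuous fun θ => Real.log ‖g (circleMap 0 (r n) θ)‖ := fun n => by
    refine Continuous.log ?_ fun θ => ?_
    · refine Continuous.norm (continuous_iff_continuousAt.2 fun θ => ?_)
      exact (hd _ (one_sub_ne_zero_of_norm_lt (hn n θ))).continuousAt.comp
        (continuous_circleMap 0 (r n)).continuousAt
    · linarith [hg1 _ (hn n θ)]
  have hmean : ∀ n, ∫⁻ θ in Set.Ioc 0 (2 * Real.pi),
      ENNReal.ofReal (Real.log ‖g (circleMap 0 (r n) θ)‖) = ENNReal.ofReal L := by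
    intro n
    have hsub : Metric.closedBall (0 : ℂ) |r n| ⊆ Metric.ball 0 1 := by
      rw [abs_of_nonneg (r0 n)]
      exact Metric.closedBall_subset_ball (r1 n)
    have h := AnalyticOnNhd.circleAverage_log_norm_of_ne_zero (R := r n) (c := 0) (g := g)
      (han.mono hsub) (fun w hw => by
        have := hg1 w (by simpa using hsub hw)
        intro h0
        rw [h0, norm_zero] at this
        linarith)
    have hg0 : g 0 = a Complex.I := by simp [g, cayley]
    rw [Real.circleAverage_def, hg0, smul_eq_mul, inv_mul_eq_iff_eq_mul₀ (by positivity),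
      intervalIntegral.integral_of_le (by positivity)] at h
    rw [← ofReal_integral_eq_lintegral_ofReal, h]
    · exact (hc n).integrableOn_Ioc
    · exact ae_of_all _ fun θ => Real.log_nonneg (hg1 _ (hn n θ))
  have hfatou : ∫⁻ θ in Set.Ioo 0 (2 * Real.pi),
      ENNReal.ofReal (Real.log ‖g (circleMap 0 1 θ)‖) ≤ ENNReal.ofReal L := by
    calc ∫⁻ θ in Set.Ioo 0 (2 * Real.pi), ENNReal.ofReal (Real.log ‖g (circleMap 0 1 θ)‖)
        ≤ ∫⁻ θ in Set.Ioo 0 (2 * Real.pi), liminf (fun n =>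
            ENNReal.ofReal (Real.log ‖g (circleMap 0 (r n) θ)‖)) atTop := by
          refine setLIntegral_mono' measurableSet_Ioo fun θ hθ => ?_
          have hθ' : θ = Real.pi + 2 * Real.arctan (Real.tan ((θ - Real.pi) / 2)) := by
            rw [Real.arctan_tan (by linarith [hθ.1]) (by linarith [hθ.2])]
            ring
          have hne : 1 - circleMap 0 1 θ ≠ 0 := by
            rw [hθ']
            exact (cayley_arctan _).1
          have ht : Tendsto (fun n => ‖g (circleMap 0 (r n) θ)‖) atTop
              (𝓝 ‖g (circleMap 0 1 θ)‖) := by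
            have hcm : Tendsto (fun n => circleMap 0 (r n) θ) atTop (𝓝 (circleMap 0 1 θ)) := by
              simp only [circleMap]
              exact ((Complex.continuous_ofReal.tendsto 1 |>.comp rl).mul_const _).const_add 0
            exact ((hd _ hne).continuousAt.tendsto.comp hcm).norm
          have h2 : 1 ≤ ‖g (circleMap 0 1 θ)‖ :=
            ge_of_tendsto' ht fun n => hg1 _ (hn n θ)
          exact ((ENNReal.continuous_ofReal.tendsto _).comp
            (ht.log (by linarith))).liminf_eq.ge
      _ ≤ liminf (fun n => ∫⁻ θ in Set.Ioo 0 (2 * Real.pi),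
            ENNReal.ofReal (Real.log ‖g (circleMap 0 (r n) θ)‖)) atTop :=
          lintegral_liminf_le fun n => (hc n).measurable.ennreal_ofReal
      _ ≤ liminf (fun _ : ℕ => ENNReal.ofReal L) atTop := by
          refine liminf_le_liminf (Eventually.of_forall fun n => ?_)
          rw [← hmean n]
          exact lintegral_mono_set Set.Ioo_subset_Ioc_self
      _ = ENNReal.ofReal L := by simp
  have hinj : Set.InjOn (fun t => Real.pi + 2 * Real.arctan t) Set.univ := fun s _ t _ hst => by
    have : Real.arctan s = Real.arctan t := by simp only at hst; linarith
    exact Real.arctan_injective this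
  have himg : (fun t => Real.pi + 2 * Real.arctan t) '' Set.univ ⊆ Set.Ioo 0 (2 * Real.pi) := by
    rintro _ ⟨t, -, rfl⟩
    have h2 := Real.arctan_lt_pi_div_two t
    have h3 := Real.neg_pi_div_two_lt_arctan t
    constructor <;> simp only <;> linarith
  have hcv := lintegral_image_eq_lintegral_abs_deriv_mul MeasurableSet.univ
    (fun t _ => (hasDerivAt_pi_add_two_arctan t).hasDerivWithinAt) hinj
    (fun θ => ENNReal.ofReal (Real.log ‖g (circleMap 0 1 θ)‖))
  have hle := lintegral_mono_set (μ := volume)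
    (f := fun θ => ENNReal.ofReal (Real.log ‖g (circleMap 0 1 θ)‖)) himg
  rw [hcv, Measure.restrict_univ] at hle
  refine lt_of_le_of_lt ?_ ((hle.trans hfatou).trans_lt ENNReal.ofReal_lt_top)
  refine lintegral_mono fun t => ?_
  simp only [g]
  rw [(cayley_arctan t).2, ← ENNReal.ofReal_mul (abs_nonneg _), abs_of_pos (by positivity)]
  refine ENNReal.ofReal_le_ofReal ?_
  have h2 : 0 ≤ Real.log ‖a t‖ := Real.log_nonneg (h1 t (by simp))
  rw [div_mul_eq_mul_div]
  gcongr
  linarith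

theorem lintegral_const_div_one_add_sq_lt_top (c : ℝ) :
    ∫⁻ t : ℝ, ENNReal.ofReal (c / (1 + t ^ 2)) < ⊤ := by
  have h := (integrable_inv_one_add_sq.const_mul c).lintegral_lt_top
  simpa only [div_eq_mul_inv] using h

/-- The class of functions with finite logarithmic integral is stable under pointwise bounds by
products. -/
theorem logIntegral_lt_top_of_le {φ ψ χ : ℝ → ℝ} (hψ : Continuous ψ) (c : ℝ)
    (hle : ∀ t, Real.posLog (φ t) ≤ c + Real.posLog (ψ t) + Real.posLog (χ t))
    (h1 : ∫⁻ t : ℝ, ENNReal.ofReal (max 0 (Real.log (ψ t)) / (1 + t ^ 2)) < ⊤)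
    (h2 : ∫⁻ t : ℝ, ENNReal.ofReal (max 0 (Real.log (χ t)) / (1 + t ^ 2)) < ⊤) :
    ∫⁻ t : ℝ, ENNReal.ofReal (max 0 (Real.log (φ t)) / (1 + t ^ 2)) < ⊤ := by
  have hc := lintegral_const_div_one_add_sq_lt_top c
  refine lt_of_le_of_lt (lintegral_mono (g := fun t : ℝ => ENNReal.ofReal (c / (1 + t ^ 2))
    + (ENNReal.ofReal (max 0 (Real.log (ψ t)) / (1 + t ^ 2))
      + ENNReal.ofReal (max 0 (Real.log (χ t)) / (1 + t ^ 2)))) fun t => ?_) ?_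
  · have h3 : max 0 (Real.log (φ t)) / (1 + t ^ 2)
        ≤ c / (1 + t ^ 2) + (max 0 (Real.log (ψ t)) / (1 + t ^ 2)
          + max 0 (Real.log (χ t)) / (1 + t ^ 2)) := by
      rw [← add_div, ← add_div, ← add_assoc]
      exact div_le_div_of_nonneg_right (hle t) (by positivity)
    refine (ENNReal.ofReal_le_ofReal h3).trans (ENNReal.ofReal_add_le.trans ?_)
    exact add_le_add le_rfl ENNReal.ofReal_add_le
  · rw [lintegral_add_left, lintegral_add_left]
    · exact ENNReal.add_lt_top.2 ⟨hc, ENNReal.add_lt_top.2 ⟨h1, h2⟩⟩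
    · have : Measurable fun t => max 0 (Real.log (ψ t)) :=
        measurable_const.max (Real.measurable_log.comp hψ.measurable)
      exact (this.div (by fun_prop)).ennreal_ofReal
    · exact (Measurable.div measurable_const (by fun_prop)).ennreal_ofReal

theorem logIntegral_const_lt_top (c : ℝ) :
    ∫⁻ t : ℝ, ENNReal.ofReal (max 0 (Real.log c) / (1 + t ^ 2)) < ⊤ :=
  lintegral_const_div_one_add_sq_lt_top _

theorem continuous_norm_ofReal {F : ℂ → ℂ} (hF : Differentiable ℂ F) :
    Continuous fun t : ℝ => ‖F t‖ := (hF.continuous.comp Complex.continuous_ofReal).norm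

theorem IsRealCartwright.mul {F G : ℂ → ℂ} (hF : IsRealCartwright F) (hG : IsRealCartwright G) :
    IsRealCartwright fun z => F z * G z := by
  refine ⟨hF.entire.mul hG.entire, fun t => ?_, ?_, ?_⟩
  · simp [Complex.mul_im, hF.real t, hG.real t]
  · obtain ⟨A, B, h⟩ := hF.expType
    obtain ⟨A', B', h'⟩ := hG.expType
    refine ⟨A * A', B + B', fun z => ?_⟩
    rw [norm_mul, add_mul, Real.exp_add]
    calc ‖F z‖ * ‖G z‖ ≤ (A * Real.exp (B * ‖z‖)) * (A' * Real.exp (B' * ‖z‖)) :=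
          mul_le_mul (h z) (h' z) (norm_nonneg _) ((norm_nonneg _).trans (h z))
      _ = _ := by ring
  · refine logIntegral_lt_top_of_le (continuous_norm_ofReal hF.entire) 0 (fun t => ?_)
      hF.logIntegral hG.logIntegral
    rw [norm_mul, zero_add]
    exact Real.posLog_mul

theorem IsRealCartwright.sub {F G : ℂ → ℂ} (hF : IsRealCartwright F) (hG : IsRealCartwright G) :
    IsRealCartwright fun z => F z - G z := by
  refine ⟨hF.entire.sub hG.entire, fun t => ?_, ?_, ?_⟩
  · simp [hF.real t, hG.real t]
  · obtain ⟨A, B, h⟩ := hF.expType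
    obtain ⟨A', B', h'⟩ := hG.expType
    have hA : 0 ≤ A := by simpa using (norm_nonneg _).trans (h 0)
    have hA' : 0 ≤ A' := by simpa using (norm_nonneg _).trans (h' 0)
    refine ⟨A + A', max B B', fun z => (norm_sub_le _ _).trans ?_⟩
    rw [add_mul]
    refine add_le_add ((h z).trans ?_) ((h' z).trans ?_)
    · gcongr; exact le_max_left _ _
    · gcongr; exact le_max_right _ _
  · refine logIntegral_lt_top_of_le (continuous_norm_ofReal hF.entire) (Real.log 2) (fun t => ?_)
      hF.logIntegral hG.logIntegral
    refine (Real.posLog_le_posLog (norm_nonneg _) (norm_sub_le _ _)).trans Real.posLog_add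

theorem isRealCartwright_const (c : ℝ) : IsRealCartwright fun _ => (c : ℂ) :=
  ⟨differentiable_const _, fun _ => Complex.ofReal_im c,
    ⟨‖(c : ℂ)‖, 0, fun z => by simp⟩, by simpa using logIntegral_const_lt_top |c|⟩

/-! ### Zeros of entire functions of exponential type -/

theorem exists_factorization {f : ℂ → ℂ} (hf : Differentiable ℂ f) (S : Finset ℂ)
    (hS : ∀ s ∈ S, f s = 0) :
    ∃ g : ℂ → ℂ, Differentiable ℂ g ∧ ∀ z, f z = (∏ s ∈ S, (z - s)) * g z := by
  classical
  induction S using Finset.induction_on with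
  | empty => exact ⟨f, hf, fun z => by simp⟩
  | insert a S ha ih =>
    obtain ⟨g, hg, h⟩ := ih fun s hs => hS s (Finset.mem_insert_of_mem hs)
    have hga : g a = 0 := by
      have h1 := h a
      rw [hS a (Finset.mem_insert_self a S)] at h1
      refine (mul_eq_zero.1 h1.symm).resolve_left (Finset.prod_ne_zero_iff.2 fun s hs => ?_)
      exact sub_ne_zero.2 fun e => ha (e ▸ hs)
    refine ⟨dslope g a, ?_, fun z => ?_⟩
    · exact differentiableOn_univ.1
        ((Complex.differentiableOn_dslope univ_mem).2 hg.differentiableOn)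
    · have h2 := sub_smul_dslope g a z
      rw [hga, sub_zero, smul_eq_mul] at h2
      rw [h z, Finset.prod_insert ha, ← h2]
      ring

/-- A **Jensen type bound**: dividing out the zeros in the disc of radius `r` and applying the
maximum principle on the disc of radius `3 r`, every zero contributes a factor two. -/
theorem two_pow_card_mul_norm_le {f : ℂ → ℂ} (hf : Differentiable ℂ f) {r M : ℝ} (hr : 0 < r)
    (hM : ∀ z, ‖z‖ = 3 * r → ‖f z‖ ≤ M) (S : Finset ℂ) (hS : ∀ s ∈ S, f s = 0)
    (hS' : ∀ s ∈ S, ‖s‖ ≤ r) : 2 ^ S.card * ‖f 0‖ ≤ M := by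
  obtain ⟨g, hg, h⟩ := exists_factorization hf S hS
  have hb : ∀ z ∈ frontier (Metric.ball (0 : ℂ) (3 * r)), ‖g z‖ ≤ M / (2 * r) ^ S.card := by
    intro z hz
    rw [frontier_ball _ (by positivity), mem_sphere_zero_iff_norm] at hz
    have h1 := hM z hz
    rw [h z, norm_mul, norm_prod] at h1
    have h2 : (2 * r) ^ S.card ≤ ∏ s ∈ S, ‖z - s‖ := by
      rw [← Finset.prod_const]
      refine Finset.prod_le_prod (fun _ _ => by positivity) fun s hs => ?_
      have := norm_sub_norm_le z s
      linarith [hS' s hs]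
    rw [le_div_iff₀ (by positivity), mul_comm]
    exact (mul_le_mul_of_nonneg_right h2 (norm_nonneg _)).trans h1
  have h0 : ‖g 0‖ ≤ M / (2 * r) ^ S.card :=
    Complex.norm_le_of_forall_mem_frontier_norm_le Metric.isBounded_ball hg.diffContOnCl hb
      (subset_closure (Metric.mem_ball_self (by positivity)))
  have h3 : ∏ s ∈ S, ‖0 - s‖ ≤ r ^ S.card := by
    rw [← Finset.prod_const]
    refine Finset.prod_le_prod (fun _ _ => norm_nonneg _) fun s hs => ?_
    simpa using hS' s hs
  rw [h 0, norm_mul, norm_prod]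
  calc 2 ^ S.card * ((∏ s ∈ S, ‖0 - s‖) * ‖g 0‖)
      ≤ 2 ^ S.card * (r ^ S.card * (M / (2 * r) ^ S.card)) := by gcongr
    _ = M := by
      rw [mul_pow]
      field_simp

/-- The number of zeros of an entire function of exponential type in a disc grows at most
linearly with the radius. -/
theorem exists_card_zeros_le {f : ℂ → ℂ} (hf : Differentiable ℂ f)
    (hexp : ∃ A B : ℝ, ∀ z, ‖f z‖ ≤ A * Real.exp (B * ‖z‖)) (h0 : f 0 ≠ 0) :
    ∃ C : ℝ, 0 ≤ C ∧ ∀ r : ℝ, 0 < r → ∀ S : Finset ℂ, (∀ s ∈ S, f s = 0) →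
      (∀ s ∈ S, ‖s‖ ≤ r) → (S.card : ℝ) ≤ C * (1 + r) := by
  obtain ⟨A, B, hAB⟩ := hexp
  have hA : 0 < A := by
    have := (norm_pos_iff.2 h0).trans_le (hAB 0)
    simpa using this
  have hf0 : 0 < ‖f 0‖ := norm_pos_iff.2 h0
  have hl2 : 0 < Real.log 2 := Real.log_pos (by norm_num)
  refine ⟨(|Real.log A - Real.log ‖f 0‖| + 3 * |B|) / Real.log 2, by positivity,
    fun r hr S hS hS' => ?_⟩
  have h1 := two_pow_card_mul_norm_le hf hr (M := A * Real.exp (B * (3 * r)))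
    (fun z hz => hz ▸ hAB z) S hS hS'
  have h2 := Real.log_le_log (by positivity) h1
  rw [Real.log_mul (by positivity) hf0.ne', Real.log_mul hA.ne' (Real.exp_ne_zero _),
    Real.log_pow, Real.log_exp] at h2
  rw [div_mul_eq_mul_div, le_div_iff₀ hl2]
  have h3 := le_abs_self (Real.log A - Real.log ‖f 0‖)
  have h4 := mul_le_mul_of_nonneg_right (le_abs_self B) hr.le
  nlinarith [abs_nonneg (Real.log A - Real.log ‖f 0‖), abs_nonneg B]

theorem finite_zeros_norm_le {f : ℂ → ℂ} (hf : Differentiable ℂ f)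
    (hexp : ∃ A B : ℝ, ∀ z, ‖f z‖ ≤ A * Real.exp (B * ‖z‖)) (h0 : f 0 ≠ 0) (r : ℝ) :
    {z : ℂ | f z = 0 ∧ ‖z‖ ≤ r}.Finite := by
  obtain ⟨C, hC, h⟩ := exists_card_zeros_le hf hexp h0
  by_contra hinf
  obtain ⟨S, hS, hcard⟩ := Set.Infinite.exists_subset_card_eq hinf
    (⌊C * (1 + max r 1)⌋₊ + 1)
  have h1 := h (max r 1) (by positivity) S (fun s hs => (hS hs).1)
    fun s hs => (hS hs).2.trans (le_max_left _ _)
  rw [hcard] at h1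
  have h2 := Nat.lt_floor_add_one (C * (1 + max r 1))
  push_cast at h1
  linarith

/-- The zeros of an entire function of exponential type have convergence exponent at most one. -/
theorem summable_zeros_rpow {f : ℂ → ℂ} (hf : Differentiable ℂ f)
    (hexp : ∃ A B : ℝ, ∀ z, ‖f z‖ ≤ A * Real.exp (B * ‖z‖)) (h0 : f 0 ≠ 0) {p : ℝ} (hp : 1 < p) :
    Summable fun z : {z : ℂ | f z = 0} => ‖(z : ℂ)‖ ^ (-p) := by
  classical
  obtain ⟨C, hC, hcard⟩ := exists_card_zeros_le hf hexp h0
  -- the zeros stay away from the origin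
  obtain ⟨δ, hδ, hδz⟩ : ∃ δ > 0, ∀ z, f z = 0 → δ ≤ ‖z‖ := by
    obtain ⟨δ, hδ, h⟩ := Metric.eventually_nhds_iff.1
      (hf.continuous.continuousAt.eventually_ne h0)
    exact ⟨δ, hδ, fun z hz => le_of_not_gt fun hlt => h (by simpa using hlt) hz⟩
  let k : ℂ → ℕ := fun z => Nat.log 2 (⌊‖z‖⌋₊ + 1)
  have hk1 : ∀ z, (2 : ℝ) ^ k z ≤ 1 + ‖z‖ := fun z => by
    have h1 : 2 ^ k z ≤ ⌊‖z‖⌋₊ + 1 := Nat.pow_log_le_self 2 (Nat.succ_ne_zero _)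
    have h2 := Nat.floor_le (norm_nonneg z)
    have h3 : (2 : ℝ) ^ k z ≤ ⌊‖z‖⌋₊ + 1 := by exact_mod_cast h1
    linarith
  have hk2 : ∀ z, ‖z‖ ≤ 2 ^ (k z + 1) := fun z => by
    have h1 : ⌊‖z‖⌋₊ + 1 < 2 ^ (k z + 1) := Nat.lt_pow_succ_log_self one_lt_two _
    have h2 := Nat.lt_floor_add_one ‖z‖
    have h3 : (⌊‖z‖⌋₊ : ℝ) + 1 < 2 ^ (k z + 1) := by exact_mod_cast h1
    linarith
  let q : ℝ := 2 * (2 : ℝ) ^ (-p)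
  have hq0 : 0 < q := by positivity
  have hq1 : q < 1 := by
    have : q = (2 : ℝ) ^ (1 - p) := by
      simp only [q]
      rw [sub_eq_add_neg, Real.rpow_add two_pos, Real.rpow_one]
    rw [this]
    exact Real.rpow_lt_one_of_one_lt_of_neg one_lt_two (by linarith)
  have hbase : ∀ z, f z = 0 → ‖z‖ ^ (-p) ≤ (1 + 1 / δ) ^ p * ((2 : ℝ) ^ (-p)) ^ k z := by
    intro z hz
    have hz' := hδz z hz
    have hzp : 0 < ‖z‖ := hδ.trans_le hz'
    have h1 : (2 : ℝ) ^ k z / (1 + 1 / δ) ≤ ‖z‖ := by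
      rw [div_le_iff₀ (by positivity)]
      have : 1 ≤ ‖z‖ * (1 / δ) := by
        rw [mul_one_div, le_div_iff₀ hδ]; linarith
      have := hk1 z
      linarith
    have h2 := Real.rpow_le_rpow_of_nonpos (by positivity) h1 (show -p ≤ 0 by linarith)
    refine h2.trans_eq ?_
    rw [Real.div_rpow (by positivity) (by positivity), Real.rpow_neg (x := 1 + 1 / δ)
      (by positivity), div_inv_eq_mul, mul_comm, ← Real.rpow_natCast, ← Real.rpow_natCast,
      ← Real.rpow_mul two_pos.le, ← Real.rpow_mul two_pos.le, mul_comm (k z : ℝ)]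
  have hgeo := (summable_geometric_of_lt_one hq0.le hq1).mul_left
    (C * 4 * (1 + 1 / δ) ^ p)
  refine summable_of_sum_le (c := ∑' n : ℕ, C * 4 * (1 + 1 / δ) ^ p * q ^ n)
    (fun z => by positivity) fun S => ?_
  -- group the zeros according to dyadic annuli
  rw [← Finset.sum_fiberwise_of_maps_to (s := S) (t := S.image fun z : {z : ℂ | f z = 0} => k z)
    (g := fun z => k z) fun z hz => Finset.mem_image_of_mem _ hz]
  refine le_trans (Finset.sum_le_sum (g := fun n => C * 4 * (1 + 1 / δ) ^ p * q ^ n)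
    fun n _ => ?_) (hgeo.sum_le_tsum _ fun _ _ => by positivity)
  have hc : ((S.filter fun z : {z : ℂ | f z = 0} => k z = n).card : ℝ) ≤ C * (4 * 2 ^ n) := by
    have h1 := hcard (2 ^ (n + 1)) (by positivity)
      ((S.filter fun z : {z : ℂ | f z = 0} => k z = n).map (Function.Embedding.subtype _))
      (fun s hs => ?_)
      (fun s hs => ?_)
    · rw [Finset.card_map] at h1
      refine h1.trans (mul_le_mul_of_nonneg_left ?_ hC)
      have : (1 : ℝ) ≤ 2 ^ n := one_le_pow₀ one_le_two
      rw [pow_succ]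
      linarith
    · obtain ⟨z, -, rfl⟩ := Finset.mem_map.1 hs
      exact z.2
    · obtain ⟨z, hz, rfl⟩ := Finset.mem_map.1 hs
      have := hk2 z
      rw [(Finset.mem_filter.1 hz).2] at this
      exact this
  calc ∑ z ∈ S.filter fun z : {z : ℂ | f z = 0} => k z = n, ‖(z : ℂ)‖ ^ (-p)
      ≤ ∑ z ∈ S.filter fun z : {z : ℂ | f z = 0} => k z = n,
          (1 + 1 / δ) ^ p * ((2 : ℝ) ^ (-p)) ^ n := by
        refine Finset.sum_le_sum fun z hz => ?_
        have := hbase z z.2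
        rwa [(Finset.mem_filter.1 hz).2] at this
    _ = (S.filter fun z : {z : ℂ | f z = 0} => k z = n).card
          * ((1 + 1 / δ) ^ p * ((2 : ℝ) ^ (-p)) ^ n) := by
        rw [Finset.sum_const, nsmul_eq_mul]
    _ ≤ C * (4 * 2 ^ n) * ((1 + 1 / δ) ^ p * ((2 : ℝ) ^ (-p)) ^ n) := by gcongr
    _ = C * 4 * (1 + 1 / δ) ^ p * q ^ n := by
        simp only [q]
        rw [mul_pow]
        ring

namespace CoeffData

variable {D : CoeffData} {z : ℂ} {X G : EReal → ℂ}

/-! ### The energy identity and its consequences -/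

/-- The energy of a solution of the canonical system on the half-line to the left of `x`. -/
noncomputable def energy (D : CoeffData) (X G : EReal → ℂ) (x : EReal) : ℝ :=
  (∫ y in below x, Complex.normSq (D.w y * X y + G y) ∂D.ν)
    + ∫ y in below x, Complex.normSq (X y) ∂D.κ

theorem integrable_normSq_of_mul_conj {m : Measure ℝ} {φ : ℝ → ℂ}
    (h : Integrable (fun y => φ y * starRingEnd ℂ (φ y)) m) :
    Integrable (fun y => Complex.normSq (φ y)) m := by
  refine h.re.congr (ae_of_all _ fun y => ?_)
  simp [Complex.mul_conj]

theorem IsSys.integrable_normSq (h : D.IsSys 1 z X G) :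
    Integrable (fun y : ℝ => Complex.normSq (D.w y * X y + G y)) D.ν := by
  refine integrable_normSq_of_mul_conj ?_
  have := h.integrable_PP h.conj
  simpa using this

theorem IsSys.integrable_normSq_fst (h : D.IsSys 1 z X G) :
    Integrable (fun y : ℝ => Complex.normSq (X y)) D.κ :=
  integrable_normSq_of_mul_conj ((h.bddF.mul h.bddF.conj).integrable D.κ)

theorem IsSys.energy_mono (h : D.IsSys 1 z X G) {x y : EReal} (hxy : x ≤ y) :
    D.energy X G x ≤ D.energy X G y := by
  have hs : below x ⊆ below y := fun t ht => lt_of_lt_of_le ht hxy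
  exact add_le_add
    (setIntegral_mono_set h.integrable_normSq.integrableOn
      (ae_of_all _ fun _ => Complex.normSq_nonneg _) hs.eventuallyLE)
    (setIntegral_mono_set h.integrable_normSq_fst.integrableOn
      (ae_of_all _ fun _ => Complex.normSq_nonneg _) hs.eventuallyLE)

theorem energy_nonneg (D : CoeffData) (X G : EReal → ℂ) (x : EReal) : 0 ≤ D.energy X G x :=
  add_nonneg (integral_nonneg fun _ => Complex.normSq_nonneg _)
    (integral_nonneg fun _ => Complex.normSq_nonneg _)

/-- The Lagrange identity for a solution and its complex conjugate. -/
theorem IsSys.im_conj_mul (h : D.IsSys 1 z X G) (x : EReal) :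
    (starRingEnd ℂ (X x) * G x).im
      = (starRingEnd ℂ (X ⊥) * G ⊥).im - z.im * D.energy X G x := by
  have hc : D.IsSys 1 (starRingEnd ℂ z) (fun x => starRingEnd ℂ (X x))
      fun x => starRingEnd ℂ (G x) := by simpa using h.conj
  have h1 := h.lagrange hc x
  have e1 : ∫ y in below x, ((D.w y : ℂ) * X y + G y)
        * (D.w y * starRingEnd ℂ (X y) + starRingEnd ℂ (G y)) ∂D.ν
      = ((∫ y in below x, Complex.normSq (D.w y * X y + G y) ∂D.ν : ℝ) : ℂ) := by
    rw [← integral_complex_ofReal]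
    refine integral_congr_ae (ae_of_all _ fun y => ?_)
    simp [← Complex.mul_conj]
  have e2 : ∫ y in below x, X y * starRingEnd ℂ (X y) ∂D.κ
      = ((∫ y in below x, Complex.normSq (X y) ∂D.κ : ℝ) : ℂ) := by
    rw [← integral_complex_ofReal]
    refine integral_congr_ae (ae_of_all _ fun y => ?_)
    simp [← Complex.mul_conj]
  rw [e1, e2, ← Complex.ofReal_add, ← energy] at h1
  have h2 := congrArg Complex.im h1
  simp only [Complex.sub_im, Complex.add_im, Complex.mul_im, Complex.conj_re, Complex.conj_im,
    Complex.ofReal_re, Complex.ofReal_im, Complex.sub_re] at h2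
  simp only [Complex.mul_im, Complex.conj_re, Complex.conj_im]
  linarith

theorem ae_eq_zero_of_setIntegral_normSq {m : Measure ℝ} {φ : ℝ → ℂ} {s : Set ℝ}
    (hφ : Integrable (fun y => Complex.normSq (φ y)) m)
    (h : ∫ y in s, Complex.normSq (φ y) ∂m = 0) : ∀ᵐ y ∂(m.restrict s), φ y = 0 := by
  have h2 := (integral_eq_zero_iff_of_nonneg (fun y => Complex.normSq_nonneg (φ y))
    hφ.integrableOn).1 h
  filter_upwards [h2] with y hy
  exact Complex.normSq_eq_zero.1 hy

/-- A solution that vanishes at `-∞` has no other zeros unless the spectral parameter is real. -/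
theorem IsSys.ne_zero_of_bot (h : D.IsSys 1 z X G) (hz : z.im ≠ 0) (hX : X ⊥ = 0) (hG : G ⊥ ≠ 0)
    (hν : ∀ r : ℝ, D.ν (Set.Iio r) ≠ 0) {x : EReal} (hx : x ≠ ⊥) : X x ≠ 0 := by
  intro h0
  have h1 := h.im_conj_mul x
  rw [h0, hX] at h1
  simp only [map_zero, zero_mul, Complex.zero_im, zero_sub] at h1
  have hE : D.energy X G x = 0 := (mul_eq_zero.1 (neg_eq_zero.1 h1.symm)).resolve_left hz
  have hP : ∫ y in below x, Complex.normSq (D.w y * X y + G y) ∂D.ν = 0 := by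
    refine le_antisymm ?_ (integral_nonneg fun _ => Complex.normSq_nonneg _)
    rw [← hE, energy]
    exact le_add_of_nonneg_right (integral_nonneg fun _ => Complex.normSq_nonneg _)
  have hae := ae_eq_zero_of_setIntegral_normSq h.integrable_normSq hP
  have hX0 : ∀ y : ℝ, y ∈ below x → X y = 0 := by
    intro y hy
    rw [h.eqF y, hX, zero_add, below_coe]
    refine integral_eq_zero_of_ae ?_
    filter_upwards [ae_restrict_of_ae_restrict_of_subset (Iio_subset_below hy) hae] with t ht
    simp [ht]
  have hne := h.tendsto_G_bot.eventually_ne hG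
  obtain ⟨R, hR⟩ := eventually_atBot.1 hne
  obtain ⟨b, hb⟩ : ∃ b : ℝ, b ∈ below x := by
    induction x with
    | bot => exact absurd rfl hx
    | coe x => exact ⟨x - 1, by simp⟩
    | top => exact ⟨0, by simp⟩
  have hsub : Set.Iio (min R b) ⊆ below x := fun t ht => Iio_subset_below hb
    (Set.mem_Iio.2 (lt_of_lt_of_le ht (min_le_right _ _)))
  have h3 := ae_restrict_of_ae_restrict_of_subset hsub hae
  have h4 : ∀ᵐ _y ∂(D.ν.restrict (Set.Iio (min R b))), False := by
    filter_upwards [h3, ae_restrict_mem measurableSet_Iio] with y h5 h6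
    rw [hX0 y (hsub h6), mul_zero, zero_add] at h5
    exact hR y (le_of_lt (lt_of_lt_of_le h6 (min_le_left _ _))) h5
  rw [eventually_false_iff_eq_bot, ae_eq_bot, Measure.restrict_eq_zero] at h4
  exact hν _ h4

/-- A solution that vanishes at `∞` has no other zeros unless the spectral parameter is real. -/
theorem IsSys.ne_zero_of_top (h : D.IsSys 1 z X G) (hz : z.im ≠ 0) (hX : X ⊤ = 0) (hG : G ⊤ ≠ 0)
    (hν : ∀ r : ℝ, D.ν (Set.Ici r) ≠ 0) (x : ℝ) : X x ≠ 0 := by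
  intro h0
  have h1 := h.im_conj_mul x
  have h2 := h.im_conj_mul ⊤
  rw [h0] at h1
  rw [hX] at h2
  simp only [map_zero, zero_mul, Complex.zero_im] at h1 h2
  have hE : D.energy X G ⊤ = D.energy X G x :=
    mul_left_cancel₀ hz (by linarith)
  have hsplit : ∀ (m : Measure ℝ) (φ : ℝ → ℝ), Integrable φ m →
      ∫ y, φ y ∂m = (∫ y in Set.Iio x, φ y ∂m) + ∫ y in Set.Ici x, φ y ∂m := by
    intro m φ hφ
    rw [← Set.compl_Iio]
    exact (integral_add_compl measurableSet_Iio hφ).symm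
  have hP : ∫ y in Set.Ici x, Complex.normSq (D.w y * X y + G y) ∂D.ν = 0 := by
    refine le_antisymm ?_ (integral_nonneg fun _ => Complex.normSq_nonneg _)
    simp only [energy, below_top, below_coe, Measure.restrict_univ] at hE
    rw [hsplit _ _ h.integrable_normSq, hsplit _ _ h.integrable_normSq_fst] at hE
    have : 0 ≤ ∫ y in Set.Ici x, Complex.normSq (X y) ∂D.κ :=
      integral_nonneg fun _ => Complex.normSq_nonneg _
    linarith
  have hae := ae_eq_zero_of_setIntegral_normSq h.integrable_normSq hP
  have hX0 : ∀ y : ℝ, x ≤ y → X y = 0 := by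
    intro y hy
    have e1 := h.eqF y
    have e2 := h.eqF ⊤
    rw [hX, below_top, Measure.restrict_univ,
      ← integral_add_compl (measurableSet_Iio (a := y)) (h.integrable_P.const_mul z),
      Set.compl_Iio] at e2
    rw [below_coe] at e1
    have e3 : ∫ t in Set.Ici y, z * (1 * D.w t * X t + G t) ∂D.ν = 0 := by
      refine integral_eq_zero_of_ae ?_
      filter_upwards [ae_restrict_of_ae_restrict_of_subset (Set.Ici_subset_Ici.2 hy) hae] with t ht
      simp [ht]
    rw [e3, add_zero, ← e1] at e2
    exact e2.symm
  have hne := h.tendsto_G_top.eventually_ne hG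
  obtain ⟨R, hR⟩ := eventually_atTop.1 hne
  have hsub : Set.Ici (max R x) ⊆ Set.Ici x := Set.Ici_subset_Ici.2 (le_max_right _ _)
  have h3 := ae_restrict_of_ae_restrict_of_subset hsub hae
  have h4 : ∀ᵐ _y ∂(D.ν.restrict (Set.Ici (max R x))), False := by
    filter_upwards [h3, ae_restrict_mem measurableSet_Ici] with y h5 h6
    rw [hX0 y (hsub h6), mul_zero, zero_add] at h5
    exact hR y ((le_max_left _ _).trans h6) h5
  rw [eventually_false_iff_eq_bot, ae_eq_bot, Measure.restrict_eq_zero] at h4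
  exact hν _ h4

/-! ### Cartwright class -/

/-- The majorant of the solutions, zero-free on the closed upper half-plane: the combination
`(X + i G) / 2` for the solution of the canonical system that starts from `(1, -i)`. -/
noncomputable def majorant (D : CoeffData) (z : ℂ) (x : EReal) : ℂ :=
  ((D.solX 1 0 z x + (-Complex.I) * D.solX 0 1 z x)
    + Complex.I * (D.solG 1 0 z x + (-Complex.I) * D.solG 0 1 z x)) / 2

theorem normSq_add_I_mul (a b : ℂ) : Complex.normSq (a + Complex.I * b)
    = Complex.normSq a + Complex.normSq b - 2 * (starRingEnd ℂ a * b).im := by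
  simp only [Complex.normSq_apply, Complex.mul_im, Complex.add_re, Complex.add_im, Complex.mul_re,
    Complex.I_re, Complex.I_im, Complex.conj_re, Complex.conj_im]
  ring

theorem normSq_sub_I_mul (a b : ℂ) : Complex.normSq (a - Complex.I * b)
    = Complex.normSq a + Complex.normSq b + 2 * (starRingEnd ℂ a * b).im := by
  simp only [Complex.normSq_apply, Complex.mul_im, Complex.sub_re, Complex.sub_im, Complex.mul_re,
    Complex.I_re, Complex.I_im, Complex.conj_re, Complex.conj_im]
  ring

variable (D)

theorem im_conj_mul_majorant_le {z : ℂ} (hz : 0 ≤ z.im) (x : EReal) :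
    (starRingEnd ℂ (D.solX 1 0 z x + (-Complex.I) * D.solX 0 1 z x)
      * (D.solG 1 0 z x + (-Complex.I) * D.solG 0 1 z x)).im ≤ -1 := by
  have h := ((D.isSys_solX 1 0 z).add ((D.isSys_solX 0 1 z).const_mul (-Complex.I))).im_conj_mul x
  rw [h]
  have h1 := mul_nonneg hz (D.energy_nonneg
    (fun x => D.solX 1 0 z x + (-Complex.I) * D.solX 0 1 z x)
    (fun x => D.solG 1 0 z x + (-Complex.I) * D.solG 0 1 z x) x)
  simp only [solX_bot, solG_bot, Complex.ofReal_one, Complex.ofReal_zero, mul_zero, add_zero,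
    mul_one, zero_add, map_one, one_mul, Complex.neg_im, Complex.I_im]
  linarith

/-- The energy identity makes the canonical system expansive, which bounds the majorant from below
in the closed upper half-plane. -/
theorem one_le_norm_majorant {z : ℂ} (hz : 0 ≤ z.im) (x : EReal) : 1 ≤ ‖D.majorant z x‖ := by
  have h1 := D.im_conj_mul_majorant_le hz x
  have h2 := normSq_add_I_mul (D.solX 1 0 z x + (-Complex.I) * D.solX 0 1 z x)
    (D.solG 1 0 z x + (-Complex.I) * D.solG 0 1 z x)
  have h3 := normSq_sub_I_mul (D.solX 1 0 z x + (-Complex.I) * D.solX 0 1 z x)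
    (D.solG 1 0 z x + (-Complex.I) * D.solG 0 1 z x)
  have h4 := Complex.normSq_nonneg ((D.solX 1 0 z x + (-Complex.I) * D.solX 0 1 z x)
    - Complex.I * (D.solG 1 0 z x + (-Complex.I) * D.solG 0 1 z x))
  have h5 : (2 : ℝ) ^ 2 ≤ ‖(D.solX 1 0 z x + (-Complex.I) * D.solX 0 1 z x)
      + Complex.I * (D.solG 1 0 z x + (-Complex.I) * D.solG 0 1 z x)‖ ^ 2 := by
    rw [← Complex.normSq_eq_norm_sq]
    linarith
  have h6 := le_of_sq_le_sq h5 (norm_nonneg _)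
  rw [majorant, norm_div, Complex.norm_ofNat, le_div_iff₀ two_pos]
  linarith

theorem im_ser_ofReal (c : ℕ → ℝ) (t : ℝ) : (ser c t).im = 0 := by
  have h := ser_conj c t
  rw [Complex.conj_ofReal] at h
  exact Complex.conj_eq_iff_im.1 h.symm

/-- On the real line, the majorant dominates the first components of the solutions. -/
theorem norm_le_majorant (t : ℝ) (x : EReal) :
    ‖D.solX 1 0 t x‖ ≤ 2 * ‖D.majorant t x‖ ∧ ‖D.solX 0 1 t x‖ ≤ 2 * ‖D.majorant t x‖ := by
  have h1 := D.im_conj_mul_majorant_le (z := t) (by simp) x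
  have h2 := normSq_add_I_mul (D.solX 1 0 t x + (-Complex.I) * D.solX 0 1 t x)
    (D.solG 1 0 t x + (-Complex.I) * D.solG 0 1 t x)
  have h3 : Complex.normSq (D.solX 1 0 t x + (-Complex.I) * D.solX 0 1 t x)
      = Complex.normSq (D.solX 1 0 t x) + Complex.normSq (D.solX 0 1 t x) := by
    have e1 : (D.solX 1 0 t x).im = 0 := im_ser_ofReal _ t
    have e2 : (D.solX 0 1 t x).im = 0 := im_ser_ofReal _ t
    simp [Complex.normSq_apply, e1, e2]
  have h4 : 2 * ‖D.majorant t x‖ = ‖(D.solX 1 0 t x + (-Complex.I) * D.solX 0 1 t x)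
      + Complex.I * (D.solG 1 0 t x + (-Complex.I) * D.solG 0 1 t x)‖ := by
    rw [majorant, norm_div, Complex.norm_ofNat]
    ring
  have h5 := Complex.normSq_nonneg (D.solG 1 0 t x + (-Complex.I) * D.solG 0 1 t x)
  have h6 := Complex.normSq_nonneg (D.solX 1 0 t x)
  have h7 := Complex.normSq_nonneg (D.solX 0 1 t x)
  rw [h4]
  constructor <;> refine le_of_sq_le_sq ?_ (norm_nonneg _) <;>
    rw [← Complex.normSq_eq_norm_sq, ← Complex.normSq_eq_norm_sq] <;> linarith

variable (p q : ℝ)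

theorem differentiable_solX (x : EReal) : Differentiable ℂ fun z => D.solX p q z x :=
  (D.factorialBound_fst p q x).differentiable (by positivity) D.mass_nonneg

theorem differentiable_solG (x : EReal) : Differentiable ℂ fun z => D.solG p q z x :=
  (D.factorialBound_snd p q x).differentiable (by positivity) D.mass_nonneg

theorem differentiable_solF (x : EReal) : Differentiable ℂ fun z => D.solF p q z x :=
  (D.factorialBound_solF p q x).differentiable
    (mul_nonneg (by positivity) D.mass_nonneg) D.mass_nonneg

theorem differentiable_majorant (x : EReal) : Differentiable ℂ fun z => D.majorant z x := by
  unfold majorant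
  have h1 := D.differentiable_solX 1 0 x
  have h2 := D.differentiable_solX 0 1 x
  have h3 := D.differentiable_solG 1 0 x
  have h4 := D.differentiable_solG 0 1 x
  fun_prop

theorem logIntegral_of_le_majorant {F : ℂ → ℂ} (x : EReal) {C : ℝ}
    (h : ∀ t : ℝ, ‖F t‖ ≤ C * ‖D.majorant t x‖) :
    ∫⁻ t : ℝ, ENNReal.ofReal (max 0 (Real.log ‖F t‖) / (1 + t ^ 2)) < ⊤ := by
  have hm := D.differentiable_majorant x
  have h1 := lintegral_log_norm_lt_top hm fun z hz => D.one_le_norm_majorant hz x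
  refine logIntegral_lt_top_of_le (continuous_norm_ofReal hm) 0 (χ := fun _ => C) (fun t => ?_) ?_
    (logIntegral_const_lt_top C)
  · rw [zero_add, add_comm]
    exact (Real.posLog_le_posLog (norm_nonneg _) (h t)).trans Real.posLog_mul
  · refine lt_of_le_of_lt (lintegral_mono fun t => ?_) h1
    rw [max_eq_right (Real.log_nonneg (D.one_le_norm_majorant (z := t) (by simp) x))]

theorem isRealCartwright_solX (x : EReal) : IsRealCartwright fun z => D.solX 1 0 z x :=
  ⟨D.differentiable_solX 1 0 x, fun t => im_ser_ofReal _ t,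
    ⟨_, _, fun z => (D.factorialBound_fst 1 0 x).norm_ser_le z⟩,
    D.logIntegral_of_le_majorant x fun t => (D.norm_le_majorant t x).1⟩

theorem isRealCartwright_solF (x : EReal) : IsRealCartwright fun z => D.solF 0 1 z x := by
  have hb := D.factorialBound_solF 0 1 x
  refine ⟨D.differentiable_solF 0 1 x, fun t => im_ser_ofReal _ t,
    ⟨_, _, fun z => hb.norm_ser_le z⟩,
    D.logIntegral_of_le_majorant x (C := 2 + (|0| + |1|) * D.mass * Real.exp D.mass) fun t => ?_⟩
  have hm := D.one_le_norm_majorant (z := t) (by simp) x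
  have hT := D.mass_nonneg
  have hK : 0 ≤ (|0| + |1|) * D.mass * Real.exp D.mass := by positivity
  change ‖D.solF 0 1 t x‖ ≤ _
  rcases le_total |t| 1 with ht | ht
  · have h1 : ‖D.solF 0 1 t x‖ ≤ (|0| + |1|) * D.mass * Real.exp D.mass := by
      refine (hb.norm_ser_le t).trans ?_
      gcongr
      rw [Complex.norm_real, Real.norm_eq_abs]
      exact mul_le_of_le_one_right hT ht
    nlinarith
  · have h1 := (D.norm_le_majorant t x).2
    rw [solX_eq, Complex.ofReal_zero, zero_add, norm_mul, Complex.norm_real,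
      Real.norm_eq_abs] at h1
    have h2 := mul_le_mul_of_nonneg_right ht (norm_nonneg (D.solF 0 1 t x))
    nlinarith

/-! ### The solution that vanishes at infinity -/

/-- First component of the solution that vanishes at `∞`. -/
noncomputable def topF (z : ℂ) (x : EReal) : ℂ :=
  D.solF 0 1 z ⊤ * D.solX 1 0 z x - D.solX 1 0 z ⊤ * D.solF 0 1 z x

/-- Second component of the solution that vanishes at `∞`. -/
noncomputable def topG (z : ℂ) (x : EReal) : ℂ :=
  D.solF 0 1 z ⊤ * (z * D.solG 1 0 z x) - D.solX 1 0 z ⊤ * D.solG 0 1 z x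

theorem isSys_top (z : ℂ) : D.IsSys z 1 (D.topF z) (D.topG z) := by
  have h := ((D.isSys_solX_one z).const_mul (D.solF 0 1 z ⊤)).add
    ((D.isSys_solF z).const_mul (-D.solX 1 0 z ⊤))
  convert h using 1 <;> funext x <;> simp only [topF, topG] <;> ring

theorem wronskian_sol (z : ℂ) (x : EReal) :
    D.solX 1 0 z x * D.solG 0 1 z x - z * D.solG 1 0 z x * D.solF 0 1 z x = 1 := by
  have h := (D.isSys_solF z).wronskian_eq (D.isSys_solX_one z) x
  rw [h]
  simp

@[simp] theorem topF_top (z : ℂ) : D.topF z ⊤ = 0 := by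
  rw [topF]; ring

@[simp] theorem topG_top (z : ℂ) : D.topG z ⊤ = -1 := by
  rw [topG, ← D.wronskian_sol z ⊤]; ring

theorem wronskian_top (z : ℂ) (x : EReal) :
    D.topF z x * D.solG 0 1 z x - D.topG z x * D.solF 0 1 z x = D.solF 0 1 z ⊤ := by
  have h := D.wronskian_sol z x
  simp only [topF, topG]
  linear_combination D.solF 0 1 z ⊤ * h

theorem isRealCartwright_topF (x : EReal) : IsRealCartwright fun z => D.topF z x :=
  ((D.isRealCartwright_solF ⊤).mul (D.isRealCartwright_solX x)).sub
    ((D.isRealCartwright_solX ⊤).mul (D.isRealCartwright_solF x))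

theorem solX_at_zero (x : EReal) : D.solX p q 0 x = p := by simp [solX_eq]

theorem solG_at_zero (x : EReal) : D.solG p q 0 x = q := by
  rw [solG_eq_integral, zero_mul, zero_mul, sub_zero, sub_zero]

theorem solF_at_zero (x : EReal) : D.solF 0 1 0 x = (D.ν.real (below x) : ℂ) := by
  rw [solF_eq_integral]
  simp [solX_at_zero, solG_at_zero, Measure.real]

variable {D}

theorem hasOnlyNonzeroRealRoots_solF (hν : ∀ r : ℝ, D.ν (Set.Iio r) ≠ 0) {x : EReal}
    (hx : x ≠ ⊥) : HasOnlyNonzeroRealRoots fun z => D.solF 0 1 z x := by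
  intro z hz
  constructor
  · by_contra him
    exact (D.isSys_solF z).canonical.ne_zero_of_bot him (by simp) (by simp) hν hx
      (by simp only [hz, mul_zero])
  · rintro rfl
    change D.solF 0 1 0 x = 0 at hz
    rw [solF_at_zero, Complex.ofReal_eq_zero, measureReal_eq_zero_iff] at hz
    obtain ⟨b, hb⟩ : ∃ b : ℝ, b ∈ below x := by
      induction x with
      | bot => exact absurd rfl hx
      | coe x => exact ⟨x - 1, by simp⟩
      | top => exact ⟨0, by simp⟩
    exact hν b (measure_mono_null (Iio_subset_below hb) hz)

theorem hasOnlyNonzeroRealRoots_topF (hν : ∀ r : ℝ, D.ν (Set.Ici r) ≠ 0) (x : ℝ) :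
    HasOnlyNonzeroRealRoots fun z => D.topF z x := by
  intro z hz
  constructor
  · by_contra him
    exact (D.isSys_top z).canonical.ne_zero_of_top him (by simp) (by simp) hν x
      (by simp only [hz, mul_zero])
  · rintro rfl
    simp only [topF, solX_at_zero, solF_at_zero, Complex.ofReal_one, mul_one, one_mul] at hz
    rw [← Complex.ofReal_sub, Complex.ofReal_eq_zero, below_top, below_coe,
      ← measureReal_compl measurableSet_Iio, Set.compl_Iio, measureReal_eq_zero_iff] at hz
    exact hν x hz

theorem conj_topF (z : ℂ) (x : EReal) :
    D.topF (starRingEnd ℂ z) x = starRingEnd ℂ (D.topF z x) := by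
  simp only [topF, solF, solX, ser_conj, map_sub, map_mul]

/-- The diagonal Green's function of the system is a Herglotz–Nevanlinna function. -/
theorem isMeromorphicHerglotz_green (hν : ∀ r : ℝ, D.ν (Set.Iio r) ≠ 0) {c : ℝ} (hc : 0 ≤ c)
    (x : EReal) : IsMeromorphicHerglotz fun z =>
      (c : ℂ) * (z * D.solF 0 1 z x * D.topF z x / D.solF 0 1 z ⊤) := by
  have d1 := D.differentiable_solF 0 1 x
  have d2 := (D.isRealCartwright_topF x).entire
  have d3 := D.differentiable_solF 0 1 ⊤
  have hne : ∀ z : ℂ, z.im ≠ 0 → D.solF 0 1 z ⊤ ≠ 0 := fun z hz h =>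
    hz (hasOnlyNonzeroRealRoots_solF hν (x := ⊤) (by simp) z h).1
  refine ⟨fun z => ?_, fun z hz => ?_, fun z _ => ?_, fun z hz => ?_⟩
  · exact (MeromorphicAt.const _ _).mul ((((differentiable_id.mul d1).mul d2).analyticAt
      z).meromorphicAt.div (d3.analyticAt z).meromorphicAt)
  · exact (((((differentiable_id.mul d1).mul d2) z).div (d3 z) (hne z hz)).const_mul
      _).differentiableWithinAt
  · simp only [conj_topF, solF, ser_conj, map_div₀, map_mul, Complex.conj_ofReal]
  · rw [Complex.im_ofReal_mul]
    refine mul_nonneg hc ?_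
    have hz0 : z ≠ 0 := fun h => by simp [h] at hz
    have w := D.wronskian_top z x
    have hm := (D.isSys_solF z).canonical.im_conj_mul x
    have hp := (D.isSys_top z).canonical.im_conj_mul x
    have hp' := (D.isSys_top z).canonical.im_conj_mul ⊤
    have hE := mul_nonneg hz.le (D.energy_nonneg (fun x => z * D.solF 0 1 z x) (D.solG 0 1 z) x)
    have hE' := mul_le_mul_of_nonneg_left
      ((D.isSys_top z).canonical.energy_mono (le_top (a := x))) hz.le
    simp only [solF_bot, topF_top, mul_zero, map_zero, zero_mul, Complex.zero_im] at hm hp'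
    set A := z * D.solF 0 1 z x with hA
    set B := z * D.topF z x with hB
    have e : A * D.topF z x / D.solF 0 1 z ⊤
        = A * B / (B * D.solG 0 1 z x - D.topG z x * A) := by
      rw [← w, hB, hA]
      have : z * D.topF z x * D.solG 0 1 z x - D.topG z x * (z * D.solF 0 1 z x)
          = z * (D.topF z x * D.solG 0 1 z x - D.topG z x * D.solF 0 1 z x) := by ring
      rw [this, ← mul_assoc, mul_right_comm (z * D.solF 0 1 z x) z, mul_comm _ z,
        mul_div_mul_left _ _ hz0]
    have e2 : (A * B / (B * D.solG 0 1 z x - D.topG z x * A)).im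
        = (Complex.normSq B * -(starRingEnd ℂ A * D.solG 0 1 z x).im
          + Complex.normSq A * (starRingEnd ℂ B * D.topG z x).im)
          / Complex.normSq (B * D.solG 0 1 z x - D.topG z x * A) := by
      rw [Complex.div_im]
      simp only [Complex.normSq_apply, Complex.mul_im, Complex.mul_re, Complex.sub_re,
        Complex.sub_im, Complex.conj_re, Complex.conj_im]
      ring
    rw [e, e2]
    refine div_nonneg (add_nonneg (mul_nonneg (Complex.normSq_nonneg _) ?_)
      (mul_nonneg (Complex.normSq_nonneg _) ?_)) (Complex.normSq_nonneg _) <;> linarith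

end CoeffData
namespace CoeffData

/-! ### Asymptotics at the endpoints -/

theorem sq_integral_abs_le (D : CoeffData) (s : Set ℝ) :
    (∫ y in s, |D.w y| ∂D.ν) ^ 2 ≤ (∫ y in s, D.w y ^ 2 ∂D.ν) * D.ν.real s := by
  have i1 : IntegrableOn (fun y => |D.w y|) s D.ν := D.integrable_w.abs.integrableOn
  have i2 : IntegrableOn (fun y => D.w y ^ 2) s D.ν := D.integrable_sq.integrableOn
  have h : ∀ t : ℝ, 0 ≤ D.ν.real s * (t * t) + (-2 * ∫ y in s, |D.w y| ∂D.ν) * t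
      + ∫ y in s, D.w y ^ 2 ∂D.ν := by
    intro t
    have e : ∫ y in s, (t - |D.w y|) ^ 2 ∂D.ν = D.ν.real s * (t * t)
        + (-2 * ∫ y in s, |D.w y| ∂D.ν) * t + ∫ y in s, D.w y ^ 2 ∂D.ν := by
      have e1 : (fun y => (t - |D.w y|) ^ 2)
          = fun y => (t * t - 2 * t * |D.w y|) + D.w y ^ 2 := by
        funext y
        rw [← sq_abs (D.w y)]
        ring
      have i0 : IntegrableOn (fun _ : ℝ => t * t) s D.ν := (integrable_const _).integrableOn
      have i3 : IntegrableOn (fun y => t * t - 2 * t * |D.w y|) s D.ν :=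
        i0.sub (i1.const_mul _)
      rw [e1, integral_add i3 i2, integral_sub i0 (i1.const_mul _), setIntegral_const,
        integral_const_mul, smul_eq_mul]
      ring
    rw [← e]
    exact integral_nonneg fun y => sq_nonneg _
  have := discrim_le_zero h
  rw [discrim] at this
  linarith

theorem integral_abs_le (D : CoeffData) (s : Set ℝ) :
    ∫ y in s, |D.w y| ∂D.ν ≤ √(∫ y in s, D.w y ^ 2 ∂D.ν) * √(D.ν.real s) := by
  rw [← Real.sqrt_mul (integral_nonneg fun y => sq_nonneg _)]
  exact Real.le_sqrt_of_sq_le (D.sq_integral_abs_le s)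

/-- A function given by the integral of `z w f + g` over the tails `S x` behaves like the mass of
the tail times the limit of `g`. Applying the Cauchy–Schwarz inequality once bounds `f` by the square
root of the mass of the tail, and applying it again yields the claim. -/
theorem isLittleO_tail (D : CoeffData) {S : ℝ → Set ℝ} (hS : ∀ x, MeasurableSet (S x))
    (hmono : ∀ x, ∀ y ∈ S x, S y ⊆ S x) {l : Filter ℝ}
    (hl : Tendsto (fun x => D.ν (S x)) l (𝓝 0)) {f g : ℝ → ℂ} {z γ : ℂ} (hfb : BddMeas f)
    (hgb : BddMeas g) (hf : ∀ x, f x = ∫ y in S x, (z * D.w y * f y + g y) ∂D.ν)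
    (hg : ∀ ε > 0, ∀ᶠ x in l, ∀ y ∈ S x, ‖g y - γ‖ ≤ ε) :
    (fun x => f x - γ * (D.ν.real (S x) : ℂ)) =o[l] fun x => D.ν.real (S x) := by
  have iwf : ∀ x, IntegrableOn (fun y => z * D.w y * f y) (S x) D.ν := fun x => by
    simpa only [mul_assoc] using (hfb.integrable_w.const_mul z).integrableOn
  have ig : ∀ x, IntegrableOn g (S x) D.ν := fun x => (hgb.integrable D.ν).integrableOn
  have iw : ∀ x, IntegrableOn (fun y => |D.w y|) (S x) D.ν := fun x =>
    D.integrable_w.abs.integrableOn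
  -- the contribution of `w f`, given a bound for `f`
  have hwf : ∀ x K, (∀ y ∈ S x, ‖f y‖ ≤ K) → ‖∫ y in S x, z * D.w y * f y ∂D.ν‖
      ≤ ‖z‖ * K * (√(∫ y in S x, D.w y ^ 2 ∂D.ν) * √(D.ν.real (S x))) := by
    intro x K hK
    rcases (S x).eq_empty_or_nonempty with hE | ⟨y0, hy0⟩
    · simp [hE]
    have hK0 : 0 ≤ K := (norm_nonneg _).trans (hK y0 hy0)
    calc ‖∫ y in S x, z * D.w y * f y ∂D.ν‖ ≤ ∫ y in S x, ‖z‖ * K * |D.w y| ∂D.ν := by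
          refine norm_integral_le_of_norm_le ((iw x).const_mul _) ?_
          filter_upwards [ae_restrict_mem (hS x)] with y hy
          rw [norm_mul, norm_mul, Complex.norm_real, Real.norm_eq_abs, mul_right_comm]
          gcongr
          exact hK y hy
      _ = ‖z‖ * K * ∫ y in S x, |D.w y| ∂D.ν := integral_const_mul _ _
      _ ≤ _ := by
          gcongr
          exact D.integral_abs_le _
  obtain ⟨hfm, Cf, hCf⟩ := hfb
  obtain ⟨hgm, Cg, hCg⟩ := hgb
  have hCg0 : 0 ≤ Cg := (norm_nonneg _).trans (hCg 0)
  have hCf0 : 0 ≤ Cf := (norm_nonneg _).trans (hCf 0)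
  have hm0 : ∀ x, 0 ≤ D.ν.real (S x) := fun x => measureReal_nonneg
  let K := ‖z‖ * Cf * √(∫ y, D.w y ^ 2 ∂D.ν) + Cg * √(D.ν.real Set.univ)
  have hK0 : 0 ≤ K := by positivity
  have hstep : ∀ x, ‖f x‖ ≤ K * √(D.ν.real (S x)) := by
    intro x
    rw [hf x, integral_add (iwf x) (ig x)]
    refine (norm_add_le _ _).trans ?_
    rw [add_mul]
    refine add_le_add ((hwf x Cf fun y _ => hCf y).trans ?_) ?_
    · rw [← mul_assoc]
      gcongr
      · exact ae_of_all _ fun y => sq_nonneg _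
      · exact D.integrable_sq
      · exact Measure.restrict_le_self
    · refine (norm_setIntegral_le_of_norm_le_const (measure_lt_top _ _) fun y _ => hCg y).trans ?_
      have h1 : D.ν.real (S x) = √(D.ν.real (S x)) * √(D.ν.real (S x)) :=
        (Real.mul_self_sqrt (hm0 x)).symm
      have h2 : √(D.ν.real (S x)) ≤ √(D.ν.real Set.univ) :=
        Real.sqrt_le_sqrt (measureReal_mono (Set.subset_univ _))
      calc Cg * D.ν.real (S x) = Cg * √(D.ν.real (S x)) * √(D.ν.real (S x)) := by
            rw [mul_assoc, ← h1]
        _ ≤ _ := by gcongr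
  have hω : Tendsto (fun x => ‖z‖ * K * √(∫ y in S x, D.w y ^ 2 ∂D.ν)) l (𝓝 0) := by
    have h1 := D.integrable_sq.tendsto_setIntegral_nhds_zero hl
    have h2 := (h1.sqrt).const_mul (‖z‖ * K)
    rwa [Real.sqrt_zero, mul_zero] at h2
  refine Asymptotics.isLittleO_iff.2 fun ε hε => ?_
  filter_upwards [hg (ε / 2) (by positivity), hω.eventually (gt_mem_nhds (half_pos hε))]
    with x h1 h2
  have e : f x - γ * (D.ν.real (S x) : ℂ)
      = (∫ y in S x, z * D.w y * f y ∂D.ν) + ∫ y in S x, (g y - γ) ∂D.ν := by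
    rw [integral_sub (ig x) (integrable_const _).integrableOn, setIntegral_const,
      Complex.real_smul, hf x, integral_add (iwf x) (ig x)]
    ring
  have h3 := hwf x (K * √(D.ν.real (S x))) fun y hy => (hstep y).trans
    (mul_le_mul_of_nonneg_left (Real.sqrt_le_sqrt (measureReal_mono (hmono x y hy))) hK0)
  have h4 := norm_setIntegral_le_of_norm_le_const (μ := D.ν) (measure_lt_top _ (S x)) h1
  have h5 : ‖z‖ * (K * √(D.ν.real (S x))) * (√(∫ y in S x, D.w y ^ 2 ∂D.ν) * √(D.ν.real (S x)))
      = ‖z‖ * K * √(∫ y in S x, D.w y ^ 2 ∂D.ν) * D.ν.real (S x) := by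
    have := Real.mul_self_sqrt (hm0 x)
    linear_combination ‖z‖ * K * √(∫ y in S x, D.w y ^ 2 ∂D.ν) * this
  rw [e, Real.norm_of_nonneg (hm0 x)]
  refine (norm_add_le _ _).trans ?_
  have h6 := mul_le_mul_of_nonneg_right h2.le (hm0 x)
  linarith

variable {D : CoeffData} {z : ℂ} {F G : EReal → ℂ}

theorem IsSys.isLittleO_bot (h : D.IsSys z 1 F G) (hF : F ⊥ = 0) :
    (fun x : ℝ => F x - G ⊥ * (D.ν.real (Set.Iio x) : ℂ)) =o[atBot]
      fun x : ℝ => D.ν.real (Set.Iio x) := by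
  refine D.isLittleO_tail (z := z) (fun x => measurableSet_Iio)
    (fun x y hy => Set.Iio_subset_Iio (le_of_lt hy)) ?_ h.bddF h.bddG (fun x => ?_)
    fun ε hε => ?_
  · have := tendsto_measure_iInter_atBot (μ := D.ν) (s := fun x : ℝ => Set.Iio x)
      (fun x => measurableSet_Iio.nullMeasurableSet) (fun _ _ h => Set.Iio_subset_Iio h)
      ⟨0, measure_ne_top _ _⟩
    have he : ⋂ x : ℝ, Set.Iio x = ∅ := by
      ext y
      simp only [Set.mem_iInter, Set.mem_Iio, Set.mem_empty_iff_false, iff_false, not_forall]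
      exact ⟨y, lt_irrefl y⟩
    rwa [he, measure_empty] at this
  · rw [h.eqF x, hF, zero_add, below_coe]
    simp only [one_mul]
  · have h1 := (Metric.tendsto_nhds.1 h.tendsto_G_bot) ε hε
    obtain ⟨R, hR⟩ := eventually_atBot.1 h1
    filter_upwards [eventually_le_atBot R] with x hx y hy
    have := hR y ((le_of_lt hy).trans hx)
    rw [dist_eq_norm] at this
    exact this.le

theorem IsSys.eq_sub_integral_Ici (h : D.IsSys z 1 F G) (x : ℝ) :
    F x = F ⊤ - ∫ y in Set.Ici x, (z * D.w y * F y + G y) ∂D.ν := by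
  have e1 := h.eqF x
  have e2 := h.eqF ⊤
  simp only [one_mul] at e1 e2
  rw [below_top, Measure.restrict_univ,
    ← integral_add_compl (measurableSet_Iio (a := x)) h.integrable_P, Set.compl_Iio] at e2
  rw [below_coe] at e1
  rw [e2, e1]
  ring

theorem IsSys.isLittleO_top (h : D.IsSys z 1 F G) (hF : F ⊤ = 0) :
    (fun x : ℝ => F x + G ⊤ * (D.ν.real (Set.Ici x) : ℂ)) =o[atTop]
      fun x : ℝ => D.ν.real (Set.Ici x) := by
  have key := D.isLittleO_tail (z := -z) (S := fun x => Set.Ici x) (l := atTop)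
    (f := fun x : ℝ => (-1) * F x) (g := fun x : ℝ => G x) (γ := G ⊤)
    (fun x => measurableSet_Ici)
    (fun x y hy => Set.Ici_subset_Ici.2 hy) ?_ (h.bddF.const_mul (-1)) h.bddG (fun x => ?_)
    fun ε hε => ?_
  · refine key.neg_left.congr_left fun x => ?_
    ring
  · have := tendsto_measure_iInter_atTop (μ := D.ν) (s := fun x : ℝ => Set.Ici x)
      (fun x => measurableSet_Ici.nullMeasurableSet) (fun _ _ h => Set.Ici_subset_Ici.2 h)
      ⟨0, measure_ne_top _ _⟩
    have he : ⋂ x : ℝ, Set.Ici x = ∅ := by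
      ext y
      simp only [Set.mem_iInter, Set.mem_Ici, Set.mem_empty_iff_false, iff_false, not_forall,
        not_le]
      exact ⟨y + 1, by linarith⟩
    rwa [he, measure_empty] at this
  · rw [h.eq_sub_integral_Ici x, hF, zero_sub, neg_one_mul, neg_neg]
    refine integral_congr_ae (ae_of_all _ fun y => ?_)
    ring
  · have h1 := (Metric.tendsto_nhds.1 h.tendsto_G_top) ε hε
    obtain ⟨R, hR⟩ := eventually_atTop.1 h1
    filter_upwards [eventually_ge_atTop R] with x hx y hy
    have := hR y (hx.trans hy)
    rw [dist_eq_norm] at this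
    exact this.le

end CoeffData
/-! ### The coefficients of the system for the differential equation -/

theorem hasDerivAt_cosh_half (x : ℝ) :
    HasDerivAt (fun x => Real.cosh (x / 2)) (Real.sinh (x / 2) / 2) x := by
  have := (Real.hasDerivAt_cosh (x / 2)).comp x ((hasDerivAt_id x).div_const 2)
  simpa [Function.comp_def, div_eq_mul_inv] using this

theorem hasDerivAt_sinh_half (x : ℝ) :
    HasDerivAt (fun x => Real.sinh (x / 2)) (Real.cosh (x / 2) / 2) x := by
  have := (Real.hasDerivAt_sinh (x / 2)).comp x ((hasDerivAt_id x).div_const 2)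
  simpa [Function.comp_def, div_eq_mul_inv] using this

theorem continuous_cosh_half : Continuous fun x : ℝ => Real.cosh (x / 2) :=
  Real.continuous_cosh.comp (continuous_id.div_const 2)

theorem continuous_sinh_half : Continuous fun x : ℝ => Real.sinh (x / 2) :=
  Real.continuous_sinh.comp (continuous_id.div_const 2)

theorem one_add_sq_le_cosh_half_sq (x : ℝ) : (1 + x ^ 2) ^ 2 / 64 ≤ Real.cosh (x / 2) ^ 2 := by
  have h1 : (x / 4) ^ 2 ≤ Real.sinh (x / 4) ^ 2 := by
    rw [sq_le_sq, Real.abs_sinh]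
    exact Real.self_le_sinh_iff.2 (abs_nonneg _)
  have h2 : Real.cosh (x / 2) = 1 + 2 * Real.sinh (x / 4) ^ 2 := by
    have h3 := Real.cosh_two_mul (x / 4)
    rw [Real.cosh_sq] at h3
    rw [show x / 2 = 2 * (x / 4) by ring, h3]
    ring
  have h4 : (1 + x ^ 2) / 8 ≤ Real.cosh (x / 2) := by
    rw [h2]
    nlinarith
  calc (1 + x ^ 2) ^ 2 / 64 = ((1 + x ^ 2) / 8) ^ 2 := by ring
    _ ≤ _ := pow_le_pow_left₀ (by positivity) h4 2

theorem integrable_mul_inv_cosh_half_sq {φ : ℝ → ℝ} (hφ : Measurable φ) {C : ℝ}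
    (h : ∀ x, |φ x| ≤ C * (1 + x ^ 2)) :
    Integrable fun x => φ x * (Real.cosh (x / 2) ^ 2)⁻¹ := by
  refine (integrable_inv_one_add_sq.const_mul (64 * C)).mono'
    (hφ.mul (continuous_cosh_half.pow 2).measurable.inv).aestronglyMeasurable
    (ae_of_all _ fun x => ?_)
  have hc : 0 < Real.cosh (x / 2) ^ 2 := by have := Real.cosh_pos (x / 2); positivity
  rw [norm_mul, Real.norm_eq_abs, norm_inv, Real.norm_of_nonneg hc.le, ← div_eq_mul_inv,
    ← div_eq_mul_inv, div_le_div_iff₀ hc (by positivity)]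
  have h1 := one_add_sq_le_cosh_half_sq x
  have h2 := h x
  have hC : 0 ≤ C := by
    have := (abs_nonneg _).trans h2
    by_contra hC
    nlinarith [sq_nonneg x]
  calc |φ x| * (1 + x ^ 2) ≤ C * (1 + x ^ 2) * (1 + x ^ 2) := by gcongr
    _ = 64 * C * ((1 + x ^ 2) ^ 2 / 64) := by ring
    _ ≤ _ := by gcongr

theorem integrable_inv_cosh_half_sq :
    Integrable fun x : ℝ => (Real.cosh (x / 2) ^ 2)⁻¹ := by
  have := integrable_mul_inv_cosh_half_sq (φ := fun _ => 1) measurable_const (C := 1)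
    fun x => by rw [abs_one, one_mul]; nlinarith [sq_nonneg x]
  simpa using this

/-- The measure `dx / cosh² (x / 2)`. -/
noncomputable def sechMeasure : Measure ℝ :=
  volume.withDensity fun x => ENNReal.ofReal (Real.cosh (x / 2) ^ 2)⁻¹

instance : IsFiniteMeasure sechMeasure :=
  isFiniteMeasure_withDensity_ofReal integrable_inv_cosh_half_sq.2

instance : NullSingletonClass sechMeasure := by
  unfold sechMeasure
  infer_instance

theorem integral_sechMeasure (s : Set ℝ) (hs : MeasurableSet s) (φ : ℝ → ℂ) :
    ∫ x in s, φ x ∂sechMeasure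
      = ∫ x in s, ((Real.cosh (x / 2) ^ 2 : ℝ) : ℂ)⁻¹ * φ x := by
  rw [sechMeasure, setIntegral_withDensity_eq_setIntegral_toReal_smul]
  · refine integral_congr_ae (ae_of_all _ fun x => ?_)
    simp only
    rw [ENNReal.toReal_ofReal (by positivity), Complex.real_smul, Complex.ofReal_inv]
  · exact (continuous_cosh_half.pow 2).measurable.inv.ennreal_ofReal
  · exact ae_of_all _ fun x => ENNReal.ofReal_lt_top
  · exact hs

theorem integrable_sechMeasure_iff {E : Type*} [NormedAddCommGroup E] [NormedSpace ℝ E]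
    {φ : ℝ → E} :
    Integrable φ sechMeasure ↔ Integrable fun x => (Real.cosh (x / 2) ^ 2)⁻¹ • φ x := by
  rw [sechMeasure, integrable_withDensity_iff_integrable_smul']
  · refine integrable_congr (ae_of_all _ fun x => ?_)
    simp only
    rw [ENNReal.toReal_ofReal (by positivity)]
  · exact (continuous_cosh_half.pow 2).measurable.inv.ennreal_ofReal
  · exact ae_of_all _ fun x => ENNReal.ofReal_lt_top

theorem hasDerivAt_exp_div_cosh_half (x : ℝ) :
    HasDerivAt (fun x => 2 * Real.exp (x / 2) / Real.cosh (x / 2))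
      (Real.cosh (x / 2) ^ 2)⁻¹ x := by
  have he : HasDerivAt (fun x => 2 * Real.exp (x / 2)) (Real.exp (x / 2)) x := by
    have := ((hasDerivAt_id x).div_const 2).exp.const_mul 2
    convert! this using 1
    simp only [id]
    ring
  have hc := (Real.cosh_pos (x / 2)).ne'
  have := he.div (hasDerivAt_cosh_half x) hc
  convert! this using 1
  have h1 : Real.exp (x / 2) = Real.cosh (x / 2) + Real.sinh (x / 2) := (Real.cosh_add_sinh _).symm
  have h2 := Real.cosh_sq (x / 2)
  rw [h1]
  field_simp
  linear_combination -h2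

theorem exp_div_cosh_le (x : ℝ) : 2 * Real.exp (x / 2) / Real.cosh (x / 2) ≤ 4 * Real.exp x := by
  rw [div_le_iff₀ (Real.cosh_pos _), Real.cosh_eq]
  have h1 : Real.exp x * Real.exp (-(x / 2)) = Real.exp (x / 2) := by
    rw [← Real.exp_add]; congr 1; ring
  have h2 : 0 < Real.exp x * Real.exp (x / 2) := by positivity
  nlinarith

theorem tendsto_exp_div_cosh_atBot :
    Tendsto (fun x : ℝ => 2 * Real.exp (x / 2) / Real.cosh (x / 2)) atBot (𝓝 0) := by
  have h := Real.tendsto_exp_atBot.const_mul 4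
  rw [mul_zero] at h
  refine squeeze_zero (fun x => ?_) exp_div_cosh_le h
  have := Real.cosh_pos (x / 2)
  positivity

theorem sechMeasure_real_Iio (x : ℝ) :
    sechMeasure.real (Set.Iio x) = 2 * Real.exp (x / 2) / Real.cosh (x / 2) := by
  have h := integral_Iic_of_hasDerivAt_of_tendsto' (a := x)
    (fun y _ => hasDerivAt_exp_div_cosh_half y)
    integrable_inv_cosh_half_sq.integrableOn tendsto_exp_div_cosh_atBot
  rw [sub_zero] at h
  rw [← h, integral_Iic_eq_integral_Iio, Measure.real, sechMeasure,
    withDensity_apply _ measurableSet_Iio, ← ofReal_integral_eq_lintegral_ofReal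
      integrable_inv_cosh_half_sq.integrableOn (ae_of_all _ fun y => by positivity),
    ENNReal.toReal_ofReal (integral_nonneg fun y => by positivity)]

theorem sechMeasure_real_univ : sechMeasure.real Set.univ = 4 := by
  have h1 : Tendsto (fun x : ℝ => sechMeasure.real (Set.Iio x)) atTop
      (𝓝 (sechMeasure.real Set.univ)) := by
    have h := tendsto_integral_Iio_atTop (m := sechMeasure) (φ := fun _ => 1)
      (integrable_const _)
    have h2 := (Complex.continuous_re.tendsto _).comp h
    simpa [Function.comp_def, Measure.real] using h2
  refine tendsto_nhds_unique h1 ?_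
  have h2 : Tendsto (fun x : ℝ => 4 - 2 * Real.exp (-x / 2) / Real.cosh (-x / 2)) atTop (𝓝 4) := by
    have := (tendsto_exp_div_cosh_atBot.comp tendsto_neg_atTop_atBot).const_sub 4
    simpa [Function.comp_def] using this
  refine h2.congr fun x => ?_
  have hc := Real.cosh_pos (x / 2)
  rw [sechMeasure_real_Iio, neg_div, Real.cosh_neg, sub_eq_iff_eq_add, ← add_div, ← mul_add,
    eq_div_iff hc.ne', Real.cosh_eq]
  ring

theorem sechMeasure_real_Ici (x : ℝ) :
    sechMeasure.real (Set.Ici x) = 2 * Real.exp (-(x / 2)) / Real.cosh (x / 2) := by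
  have hc := Real.cosh_pos (x / 2)
  rw [← Set.compl_Iio, measureReal_compl measurableSet_Iio, sechMeasure_real_univ,
    sechMeasure_real_Iio, sub_eq_iff_eq_add, ← add_div, ← mul_add, eq_div_iff hc.ne', Real.cosh_eq]
  ring

/-- The measure `cosh² (x / 2) dυ`. -/
noncomputable def coshMeasure (u : ℝ → ℝ) (μ : Measure ℝ) : Measure ℝ :=
  (upsilon u μ).withDensity fun x => ENNReal.ofReal (Real.cosh (x / 2) ^ 2)

/-- The antiderivative `cosh² (x / 2) u' - cosh (x / 2) sinh (x / 2) u - ½ ∫ u` that turns the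
distribution `ω` into a function. -/
noncomputable def antideriv (u : ℝ → ℝ) (x : ℝ) : ℝ :=
  deriv u x * Real.cosh (x / 2) ^ 2 - u x * Real.cosh (x / 2) * Real.sinh (x / 2)
    - (∫ y in (0 : ℝ)..x, u y) / 2

theorem MemE.isFiniteMeasure_coshMeasure {u : ℝ → ℝ} {μ : Measure ℝ} (hE : MemE u μ) :
    IsFiniteMeasure (coshMeasure u μ) := by
  have h1 := (le_add_self.trans_lt hE.decay_pos : ∫⁻ x, ENNReal.ofReal (Real.exp (1 * x))
    ∂(upsilon u μ) < ⊤)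
  have h2 := (le_add_self.trans_lt hE.decay_neg : ∫⁻ x, ENNReal.ofReal (Real.exp (-1 * x))
    ∂(upsilon u μ) < ⊤)
  refine isFiniteMeasure_withDensity (ne_of_lt ?_)
  refine lt_of_le_of_lt (lintegral_mono (g := fun x => ENNReal.ofReal (Real.exp (1 * x))
    + ENNReal.ofReal (Real.exp (-1 * x))) fun x => ?_) ?_
  · simp only
    rw [← ENNReal.ofReal_add (Real.exp_pos _).le (Real.exp_pos _).le]
    refine ENNReal.ofReal_le_ofReal ?_
    have e1 : Real.exp (1 * x) = Real.exp (x / 2) ^ 2 := by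
      rw [← Real.exp_nat_mul]; congr 1; push_cast; ring
    have e2 : Real.exp (-1 * x) = Real.exp (-(x / 2)) ^ 2 := by
      rw [← Real.exp_nat_mul]; congr 1; push_cast; ring
    rw [e1, e2, Real.cosh_eq]
    nlinarith [sq_nonneg (Real.exp (x / 2) - Real.exp (-(x / 2)))]
  · rw [lintegral_add_left (by fun_prop)]
    exact ENNReal.add_lt_top.2 ⟨h1, h2⟩

theorem MemE.continuous {u : ℝ → ℝ} {μ : Measure ℝ} (hE : MemE u μ) : Continuous u :=
  hE.memD.h1.locAC.continuous

theorem MemE.measurable_antideriv {u : ℝ → ℝ} {μ : Measure ℝ} (hE : MemE u μ) :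
    Measurable (antideriv u) := by
  have hu := hE.continuous
  have hU : Continuous fun x => ∫ y in (0 : ℝ)..x, u y :=
    intervalIntegral.continuous_primitive (fun a b => hu.intervalIntegrable a b) 0
  exact (((measurable_deriv u).mul (continuous_cosh_half.pow 2).measurable).sub
    ((hu.mul continuous_cosh_half).mul continuous_sinh_half).measurable).sub
      (hU.div_const 2).measurable

theorem MemE.integrable_decay {u : ℝ → ℝ} {μ : Measure ℝ} (hE : MemE u μ) {s : ℝ}
    (hs : DecayCond s u μ) :
    Integrable fun x => Real.exp (s * x) * (deriv u x - s * u x) ^ 2 := by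
  have hm : Measurable fun x => Real.exp (s * x) * (deriv u x - s * u x) ^ 2 :=
    (by fun_prop : Measurable fun x : ℝ => Real.exp (s * x)).mul
      (((measurable_deriv u).sub (hE.continuous.measurable.const_mul s)).pow_const 2)
  refine (lintegral_ofReal_ne_top_iff_integrable hm.aestronglyMeasurable
    (ae_of_all _ fun x => by positivity)).1 (ne_of_lt ?_)
  exact le_self_add.trans_lt hs

/-- The decay condition is precisely square integrability of the antiderivative with
respect to `dx / cosh² (x / 2)`, since the primitive of `u` grows at most linearly. -/
theorem MemE.integrable_antideriv_sq {u : ℝ → ℝ} {μ : Measure ℝ} (hE : MemE u μ) :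
    Integrable (fun x => antideriv u x ^ 2) sechMeasure := by
  rw [integrable_sechMeasure_iff]
  have hu := hE.continuous
  have hU : Continuous fun x => ∫ y in (0 : ℝ)..x, u y :=
    intervalIntegral.continuous_primitive (fun a b => hu.intervalIntegrable a b) 0
  have hu2 : Integrable fun x => u x ^ 2 := hE.memD.h1.sq.integrable_sq
  set Q := ∫ x, u x ^ 2 with hQ
  have hQ0 : 0 ≤ Q := integral_nonneg fun x => sq_nonneg _
  have hUb : ∀ x, |∫ y in (0 : ℝ)..x, u y| ≤ |x| + Q := by
    intro x
    have h1 : |∫ y in (0 : ℝ)..x, u y| ≤ |∫ y in (0 : ℝ)..x, (1 + u y ^ 2)| := by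
      rw [← Real.norm_eq_abs, ← Real.norm_eq_abs]
      refine intervalIntegral.norm_integral_le_abs_of_norm_le (ae_of_all _ fun t => ?_)
        ((continuous_const.add (hu.pow 2)).intervalIntegrable _ _)
      rw [Real.norm_eq_abs]
      nlinarith [sq_nonneg (|u t| - 1), sq_abs (u t)]
    refine h1.trans ?_
    have iu : IntervalIntegrable (fun y => u y ^ 2) volume 0 x :=
      (hu.pow 2).intervalIntegrable _ _
    rw [intervalIntegral.integral_add intervalIntegrable_const iu]
    refine (abs_add_le _ _).trans (add_le_add (by simp) ?_)
    rw [← Real.norm_eq_abs, intervalIntegral.norm_intervalIntegral_eq,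
      Real.norm_of_nonneg (integral_nonneg fun y => sq_nonneg _)]
    exact setIntegral_le_integral hu2 (ae_of_all _ fun y => sq_nonneg _)
  have i1 : Integrable fun x => (∫ y in (0 : ℝ)..x, u y) ^ 2 * (Real.cosh (x / 2) ^ 2)⁻¹ := by
    refine integrable_mul_inv_cosh_half_sq (hU.pow 2).measurable (C := 2 + 2 * Q ^ 2) fun x => ?_
    rw [abs_of_nonneg (sq_nonneg _), ← sq_abs]
    have h1 := hUb x
    have h2 := pow_le_pow_left₀ (abs_nonneg _) h1 2
    have h3 := sq_abs x
    nlinarith [sq_nonneg (|x| - Q), mul_nonneg (sq_nonneg Q) (sq_nonneg x)]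
  have i2 := (hE.integrable_decay hE.decay_pos).add (hE.integrable_decay hE.decay_neg)
  refine (i2.add i1).mono' (((continuous_cosh_half.pow 2).measurable.inv).smul
    (hE.measurable_antideriv.pow_const 2)).aestronglyMeasurable (ae_of_all _ fun x => ?_)
  have hc := Real.cosh_pos (x / 2)
  rw [smul_eq_mul, Real.norm_of_nonneg (by positivity)]
  simp only [Pi.add_apply]
  set U := ∫ y in (0 : ℝ)..x, u y with hUdef
  have e1 : Real.exp (1 * x) = Real.exp (x / 2) ^ 2 := by
    rw [← Real.exp_nat_mul]; congr 1; push_cast; ring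
  have e2 : Real.exp (-1 * x) = Real.exp (-(x / 2)) ^ 2 := by
    rw [← Real.exp_nat_mul]; congr 1; push_cast; ring
  set A := deriv u x * Real.cosh (x / 2) - u x * Real.sinh (x / 2) with hA
  have e3 : antideriv u x = Real.cosh (x / 2) * A - U / 2 := by
    rw [antideriv, hA]; ring
  have e4 : 2 * A = Real.exp (x / 2) * (deriv u x - u x)
      + Real.exp (-(x / 2)) * (deriv u x + u x) := by
    rw [hA, Real.cosh_eq, Real.sinh_eq]; ring
  have e5 : (Real.cosh (x / 2) ^ 2)⁻¹ * antideriv u x ^ 2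
      = (A - U / 2 * (Real.cosh (x / 2))⁻¹) ^ 2 := by
    rw [e3]; field_simp
  have e6 : U ^ 2 * (Real.cosh (x / 2) ^ 2)⁻¹ = (U * (Real.cosh (x / 2))⁻¹) ^ 2 := by
    field_simp
  rw [e5, e6, e1, e2]
  set B := U * (Real.cosh (x / 2))⁻¹
  have e7 : U / 2 * (Real.cosh (x / 2))⁻¹ = B / 2 := by simp only [B]; ring
  rw [e7]
  have e8 : Real.exp (x / 2) ^ 2 * (deriv u x - 1 * u x) ^ 2
      = (Real.exp (x / 2) * (deriv u x - u x)) ^ 2 := by ring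
  have e9 : Real.exp (-(x / 2)) ^ 2 * (deriv u x - -1 * u x) ^ 2
      = (Real.exp (-(x / 2)) * (deriv u x + u x)) ^ 2 := by ring
  rw [e8, e9]
  set a := Real.exp (x / 2) * (deriv u x - u x)
  set b := Real.exp (-(x / 2)) * (deriv u x + u x)
  have hA2 : A = (a + b) / 2 := by linarith
  rw [hA2]
  nlinarith [sq_nonneg (a - b), sq_nonneg (a + b + B), sq_nonneg B]

/-- The coefficients of the first order system belonging to a pair in the class `ℰ`. -/
noncomputable def MemE.coeffData {u : ℝ → ℝ} {μ : Measure ℝ} (hE : MemE u μ) : CoeffData where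
  ν := sechMeasure
  κ := coshMeasure u μ
  w := antideriv u
  finite_ν := inferInstance
  finite_κ := hE.isFiniteMeasure_coshMeasure
  diffuse := inferInstance
  measurable_w := hE.measurable_antideriv
  integrable_sq := hE.integrable_antideriv_sq

/-! ### Solutions of the system solve the differential equation -/

theorem memLp_two_restrict_of_continuous {g : ℝ → ℂ} (hg : Continuous g) (a b : ℝ) :
    MemLp g 2 (volume.restrict (Set.Icc a b)) := by
  obtain ⟨C, hC⟩ := isCompact_Icc.exists_bound_of_continuousOn (s := Set.Icc a b) hg.continuousOn
  refine MemLp.of_bound hg.aestronglyMeasurable C ?_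
  filter_upwards [ae_restrict_mem measurableSet_Icc] with x hx using hC x hx

theorem memH1Loc_of_contDiff {g : ℝ → ℂ} (hg : ContDiff ℝ 1 g) : MemH1Loc g :=
  ⟨LocAC.of_contDiff hg, memLp_two_restrict_of_continuous (hg.continuous_deriv le_rfl)⟩

theorem MemH1Loc.contDiff_mul {f g : ℝ → ℂ} (hf : MemH1Loc f) (hg : ContDiff ℝ 1 g) :
    MemH1Loc fun x => g x * f x := by
  have hgc := hg.continuous
  have hgc' := hg.continuous_deriv le_rfl
  have hfc := hf.locAC.continuous
  refine ⟨(LocAC.of_contDiff hg).mul hf.locAC, fun a b => ?_⟩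
  obtain ⟨C, hC⟩ := isCompact_Icc.exists_bound_of_continuousOn (s := Set.Icc a b) hgc.continuousOn
  have m1 : MemLp (fun x => deriv g x * f x) 2 (volume.restrict (Set.Icc a b)) :=
    memLp_two_restrict_of_continuous (hgc'.mul hfc) a b
  have m2 : MemLp (fun x => g x * deriv f x) 2 (volume.restrict (Set.Icc a b)) := by
    refine (hf.sq_deriv a b).of_le_mul (c := C)
      (hgc.aestronglyMeasurable.mul (hf.sq_deriv a b).1) ?_
    filter_upwards [ae_restrict_mem measurableSet_Icc] with x hx
    rw [norm_mul]
    exact mul_le_mul_of_nonneg_right (hC x hx) (norm_nonneg _)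
  refine (m1.add m2).ae_eq ?_
  filter_upwards [ae_restrict_of_ae ((LocAC.of_contDiff hg).ae_deriv_mul hf.locAC)] with x hx
  exact hx.symm

theorem LocAC.integrable_deriv {f : ℝ → ℂ} (hf : LocAC f) (hs : HasCompactSupport f) :
    Integrable (deriv f) :=
  (integrableOn_iff_integrable_of_support_subset (subset_tsupport _)).1
    (hf.locallyIntegrable_deriv.integrableOn_isCompact hs.deriv)

theorem LocAC.integral_Iio_deriv {f : ℝ → ℂ} (hf : LocAC f) (hs : HasCompactSupport f)
    (r : ℝ) : ∫ x in Set.Iio r, deriv f x = f r := by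
  have hi := hf.integrable_deriv hs
  obtain ⟨R, hR, hR'⟩ := exists_Icc_of_hasCompactSupport hs
  have h1 := intervalIntegral.integral_Iic_sub_Iic (a := -R - 1) (b := r) (f := deriv f)
    (μ := volume) hi.integrableOn hi.integrableOn
  have h2 : ∫ x in Set.Iic (-R - 1), deriv f x = 0 := by
    refine setIntegral_eq_zero_of_forall_eq_zero fun x hx => hR' x fun h => ?_
    linarith [h.1, Set.mem_Iic.1 hx]
  rw [h2, sub_zero, hf.integral_deriv, hR (-R - 1) (fun h => by linarith [h.1]), sub_zero] at h1
  rw [← integral_Iic_eq_integral_Iio, h1]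

/-- The function `cosh (x / 2)`, as a complex number. -/
noncomputable def coshHalf (x : ℝ) : ℂ := ((Real.cosh (x / 2) : ℝ) : ℂ)

theorem coshHalf_ne_zero (x : ℝ) : coshHalf x ≠ 0 :=
  Complex.ofReal_ne_zero.2 (Real.cosh_pos _).ne'

theorem hasDerivAt_coshHalf (x : ℝ) :
    HasDerivAt coshHalf ((Real.sinh (x / 2) : ℂ) / 2) x := by
  have := (hasDerivAt_cosh_half x).ofReal_comp
  convert! this using 1
  push_cast
  rfl

theorem norm_coshHalf (x : ℝ) : ‖coshHalf x‖ = Real.cosh (x / 2) := by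
  rw [coshHalf, Complex.norm_real, Real.norm_of_nonneg (Real.cosh_pos _).le]

theorem contDiff_cosh_half : ContDiff ℝ 1 fun x : ℝ => Real.cosh (x / 2) :=
  Real.contDiff_cosh.comp (contDiff_id.div_const 2)

theorem contDiff_sinh_half : ContDiff ℝ 1 fun x : ℝ => Real.sinh (x / 2) :=
  Real.contDiff_sinh.comp (contDiff_id.div_const 2)

theorem contDiff_coshHalf : ContDiff ℝ 1 coshHalf :=
  Complex.ofRealCLM.contDiff.comp contDiff_cosh_half

theorem contDiff_coshHalf_inv : ContDiff ℝ 1 fun x => (coshHalf x)⁻¹ :=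
  contDiff_coshHalf.inv coshHalf_ne_zero

section System

variable {u : ℝ → ℝ} {μ : Measure ℝ} {hE : MemE u μ} {z : ℂ} {F G : EReal → ℂ}

theorem memLp_inv_coshHalf_mul {φ : ℝ → ℂ}
    (hφ : Integrable (fun y => φ y * starRingEnd ℂ (φ y)) sechMeasure)
    (hm : AEStronglyMeasurable φ volume) :
    MemLp (fun x => (coshHalf x)⁻¹ * φ x) 2 volume := by
  have h := integrable_sechMeasure_iff.1 (CoeffData.integrable_normSq_of_mul_conj hφ)
  refine (memLp_two_iff_integrable_sq_norm
    (contDiff_coshHalf_inv.continuous.aestronglyMeasurable.mul hm)).2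
    (h.congr (ae_of_all _ fun x => ?_))
  change (Real.cosh (x / 2) ^ 2)⁻¹ • Complex.normSq (φ x) = ‖(coshHalf x)⁻¹ * φ x‖ ^ 2
  rw [norm_mul, norm_inv, norm_coshHalf, mul_pow, inv_pow, Complex.normSq_eq_norm_sq, smul_eq_mul]

theorem memLp_inv_coshHalf_mul_P (h : hE.coeffData.IsSys z 1 F G) :
    MemLp (fun x : ℝ => (coshHalf x)⁻¹ * (z * antideriv u x * F x + G x)) 2 volume := by
  refine memLp_inv_coshHalf_mul ?_ ?_
  · have := h.integrable_PP h.conj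
    refine this.congr (ae_of_all _ fun x => ?_)
    simp only [map_add, map_mul, Complex.conj_ofReal]
    rfl
  · exact (((Complex.measurable_ofReal.comp hE.measurable_antideriv).const_mul z |>.mul
      h.bddF.1).add h.bddG.1).aestronglyMeasurable

theorem integrable_inv_coshHalf_sq_mul_P (h : hE.coeffData.IsSys z 1 F G) :
    Integrable fun x : ℝ => ((coshHalf x) ^ 2)⁻¹ * (z * antideriv u x * F x + G x) := by
  refine (integrable_sechMeasure_iff.1 h.integrable_P).congr (ae_of_all _ fun x => ?_)
  simp only [Complex.real_smul, coshHalf]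
  push_cast
  rfl

theorem eq_add_integral (h : hE.coeffData.IsSys z 1 F G) (x : ℝ) : F x = F (0 : ℝ)
    + ∫ y in (0 : ℝ)..x, ((coshHalf y) ^ 2)⁻¹ * (z * antideriv u y * F y + G y) := by
  have hi := integrable_inv_coshHalf_sq_mul_P h
  have key : ∀ x : ℝ, F x = F ⊥
      + ∫ y in Set.Iic x, ((coshHalf y) ^ 2)⁻¹ * (z * antideriv u y * F y + G y) := by
    intro x
    rw [h.eqF x, below_coe, integral_Iic_eq_integral_Iio]
    congr 1
    refine (integral_sechMeasure _ measurableSet_Iio _).trans ?_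
    refine integral_congr_ae (ae_of_all _ fun y => ?_)
    simp only [one_mul, coshHalf]
    push_cast
    rfl
  rw [key x, key 0, ← intervalIntegral.integral_Iic_sub_Iic hi.integrableOn hi.integrableOn]
  ring

theorem locAC_fst (h : hE.coeffData.IsSys z 1 F G) : LocAC fun x : ℝ => F x := by
  have := (LocAC.const (F (0 : ℝ))).add
    (LocAC.integral (integrable_inv_coshHalf_sq_mul_P h).locallyIntegrable 0)
  convert this using 2 with x
  exact eq_add_integral h x

theorem ae_deriv_fst (h : hE.coeffData.IsSys z 1 F G) : ∀ᵐ x : ℝ,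
    deriv (fun x : ℝ => F x) x
      = ((coshHalf x) ^ 2)⁻¹ * (z * antideriv u x * F x + G x) := by
  have hi := (integrable_inv_coshHalf_sq_mul_P h).locallyIntegrable
  filter_upwards [LocallyIntegrable.ae_hasDerivAt_integral hi] with x hx
  have := (hx 0).const_add (F (0 : ℝ))
  have e : (fun x : ℝ => F x) = fun x : ℝ => F (0 : ℝ)
      + ∫ y in (0 : ℝ)..x, ((coshHalf y) ^ 2)⁻¹ * (z * antideriv u y * F y + G y) :=
    funext fun x => eq_add_integral h x
  rw [e]
  exact this.deriv

theorem memH1Loc_fst (h : hE.coeffData.IsSys z 1 F G) : MemH1Loc fun x : ℝ => F x := by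
  refine ⟨locAC_fst h, fun a b => ?_⟩
  refine ((memLp_inv_coshHalf_mul_P h).restrict (Set.Icc a b)).mono
    ((locAC_fst h).locallyIntegrable_deriv.aestronglyMeasurable.restrict) ?_
  filter_upwards [ae_restrict_of_ae (ae_deriv_fst h)] with x hx
  rw [hx, norm_mul, norm_mul, norm_inv, norm_inv, norm_pow, norm_coshHalf]
  gcongr
  exact le_self_pow₀ (Real.one_le_cosh _) two_ne_zero

theorem integral_coshMeasure (φ : ℝ → ℂ) :
    ∫ x, φ x ∂(coshMeasure u μ) = ∫ x, coshHalf x ^ 2 * φ x ∂(upsilon u μ) := by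
  rw [coshMeasure, integral_withDensity_eq_integral_toReal_smul]
  · refine integral_congr_ae (ae_of_all _ fun x => ?_)
    simp only
    rw [ENNReal.toReal_ofReal (by positivity), Complex.real_smul, coshHalf]
    push_cast
    rfl
  · exact (continuous_cosh_half.pow 2).measurable.ennreal_ofReal
  · exact ae_of_all _ fun x => ENNReal.ofReal_lt_top

/-- Integration by parts against the second component of a solution, which is a function of bounded
variation. -/
theorem integral_deriv_mul_snd (h : hE.coeffData.IsSys z 1 F G) {H : ℝ → ℂ} (hH : LocAC H)
    (hs : HasCompactSupport H) :
    ∫ x : ℝ, deriv H x * G x = (∫ x : ℝ, z * antideriv u x * H x * deriv (fun x : ℝ => F x) x)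
      + z ^ 2 * ∫ x : ℝ, coshHalf x ^ 2 * (F x * H x) ∂(upsilon u μ) := by
  have hi := hH.integrable_deriv hs
  have := hE.isFiniteMeasure_coshMeasure
  obtain ⟨i1, -, e1⟩ := integral_mul_integral_eq volume sechMeasure hi h.integrable_G
  obtain ⟨i2, -, e2⟩ := integral_mul_integral_eq volume (coshMeasure u μ) hi
    ((h.bddF.integrable (coshMeasure u μ)).const_mul (z ^ 2 * 1))
  rw [hH.integral_deriv_of_hasCompactSupport hs, zero_mul] at e1 e2
  simp only [hH.integral_Iio_deriv hs] at e1 e2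
  have e3 : ∫ x : ℝ, deriv H x * G x = (∫ x : ℝ, G ⊥ * deriv H x)
      - (∫ x, deriv H x * ∫ r in Set.Iio x, z * 1 * hE.coeffData.w r
          * (z * hE.coeffData.w r * F r + G r) ∂sechMeasure)
      - ∫ x, deriv H x * ∫ r in Set.Iio x, z ^ 2 * 1 * F r ∂(coshMeasure u μ) := by
    have i3 : Integrable fun x => G ⊥ * deriv H x - deriv H x * ∫ r in Set.Iio x,
        z * 1 * hE.coeffData.w r * (z * hE.coeffData.w r * F r + G r) ∂sechMeasure :=
      (hi.const_mul _).sub i1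
    rw [← integral_sub (hi.const_mul _) i1, ← integral_sub i3 i2]
    refine integral_congr_ae (ae_of_all _ fun x => ?_)
    simp only
    have := h.eqG x
    rw [below_coe] at this
    rw [this]
    simp only [MemE.coeffData]
    ring
  rw [integral_const_mul, hH.integral_deriv_of_hasCompactSupport hs, mul_zero, zero_sub] at e3
  have e4 : ∫ r : ℝ, z * 1 * hE.coeffData.w r * (z * hE.coeffData.w r * F r + G r) * H r
        ∂sechMeasure
      = ∫ x : ℝ, z * antideriv u x * H x * deriv (fun x : ℝ => F x) x := by
    have := integral_sechMeasure Set.univ MeasurableSet.univ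
      fun r : ℝ => z * 1 * hE.coeffData.w r * (z * hE.coeffData.w r * F r + G r) * H r
    rw [Measure.restrict_univ, Measure.restrict_univ] at this
    rw [this]
    refine integral_congr_ae ?_
    filter_upwards [ae_deriv_fst h] with x hx
    rw [hx]
    simp only [MemE.coeffData, coshHalf]
    push_cast
    ring
  have e5 : ∫ r : ℝ, z ^ 2 * 1 * F r * H r ∂(coshMeasure u μ)
      = z ^ 2 * ∫ x : ℝ, coshHalf x ^ 2 * (F x * H x) ∂(upsilon u μ) := by
    rw [← integral_coshMeasure, ← integral_const_mul]
    refine integral_congr_ae (ae_of_all _ fun x => ?_)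
    ring
  rw [e4] at e1
  rw [e5] at e2
  rw [e3]
  linear_combination e1 + e2

theorem hasDerivAt_sinh_half_ofReal (x : ℝ) :
    HasDerivAt (fun x : ℝ => (Real.sinh (x / 2) : ℂ)) (coshHalf x / 2) x := by
  have := (hasDerivAt_sinh_half x).ofReal_comp
  convert! this using 1
  rw [coshHalf, Complex.ofReal_div, Complex.ofReal_ofNat]

theorem coshHalf_sq (x : ℝ) : coshHalf x ^ 2 = (Real.sinh (x / 2) : ℂ) ^ 2 + 1 := by
  rw [coshHalf]
  exact_mod_cast Real.cosh_sq (x / 2)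

/-- The substitution `f = cosh (x / 2) F` turns the Dirichlet form of `-f'' + f / 4` into
`∫ cosh² (x / 2) F' H' dx`. -/
theorem integral_deriv_mul_deriv_coshHalf {F H : ℝ → ℂ} (hF : MemH1Loc F) (hH : MemH1 H)
    (hs : HasCompactSupport H) :
    Integrable (fun x => coshHalf x ^ 2 * deriv F x * deriv H x) ∧
    (∫ x, deriv (fun x => coshHalf x * F x) x * deriv (fun x => coshHalf x * H x) x)
      + (1 / 4 : ℂ) * ∫ x, coshHalf x * F x * (coshHalf x * H x)
      = ∫ x, coshHalf x ^ 2 * deriv F x * deriv H x := by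
  have hcc := contDiff_coshHalf.continuous
  have cF := hF.locAC.continuous
  have cH := hH.locAC.continuous
  have hcs : HasCompactSupport fun x => coshHalf x * H x := hs.mul_left
  have hcH : MemH1 fun x => coshHalf x * H x :=
    (memH1Loc_of_contDiff contDiff_coshHalf).mul_memH1 hH hs
  obtain ⟨R, -, hR⟩ := exists_Icc_of_hasCompactSupport hcs
  have i1 := integrable_mul_of_memLp ((hF.contDiff_mul contDiff_coshHalf).sq_deriv (-R) R)
    hcH.sq_deriv hR
  have i2 : Integrable fun x => (1 / 4 : ℂ) * (coshHalf x * F x * (coshHalf x * H x)) :=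
    (((hcc.mul cF).mul (hcc.mul cH)).integrable_of_hasCompactSupport hcs.mul_left).const_mul _
  have hQ : LocAC fun x : ℝ => (Real.sinh (x / 2) : ℂ) * coshHalf x * (F x * H x) :=
    ((LocAC.of_contDiff contDiff_sinh_half).ofReal.mul (LocAC.of_contDiff contDiff_coshHalf)).mul
      (hF.locAC.mul hH.locAC)
  have hQs : HasCompactSupport fun x : ℝ => (Real.sinh (x / 2) : ℂ) * coshHalf x * (F x * H x) :=
    hs.mul_left.mul_left
  have i3 := (hQ.integrable_deriv hQs).const_mul (1 / 2)
  have i12 : Integrable fun x => deriv (fun x => coshHalf x * F x) x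
      * deriv (fun x => coshHalf x * H x) x
      + (1 / 4 : ℂ) * (coshHalf x * F x * (coshHalf x * H x)) := i1.add i2
  have key : (fun x => (deriv (fun x => coshHalf x * F x) x * deriv (fun x => coshHalf x * H x) x
      + (1 / 4 : ℂ) * (coshHalf x * F x * (coshHalf x * H x)))
      - 1 / 2 * deriv (fun x : ℝ => (Real.sinh (x / 2) : ℂ) * coshHalf x * (F x * H x)) x)
      =ᵐ[volume] fun x => coshHalf x ^ 2 * deriv F x * deriv H x := by
    filter_upwards [hF.locAC.ae_differentiableAt, hH.locAC.ae_differentiableAt] with x h1 h2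
    have d1 := hasDerivAt_coshHalf x
    have d2 := hasDerivAt_sinh_half_ofReal x
    rw [(d1.fun_mul h1.hasDerivAt).deriv, (d1.fun_mul h2.hasDerivAt).deriv,
      ((d2.fun_mul d1).fun_mul (h1.hasDerivAt.fun_mul h2.hasDerivAt)).deriv]
    ring
  refine ⟨(i12.sub i3).congr key, ?_⟩
  rw [← integral_const_mul, ← integral_add i1 i2, ← integral_congr_ae key, integral_sub i12 i3,
    integral_const_mul, hQ.integral_deriv_of_hasCompactSupport hQs, mul_zero, sub_zero]

/-- The distribution `ω`, evaluated at `cosh² (x / 2) K`, is integration of `K'` against the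
antiderivative. -/
theorem omega_coshHalf_sq_mul (hE : MemE u μ) {K : ℝ → ℂ} (hK : MemH1 K)
    (hs : HasCompactSupport K) :
    Integrable (fun x => (antideriv u x : ℂ) * deriv K x) ∧
    omega u (fun x => coshHalf x ^ 2 * K x) = ∫ x, (antideriv u x : ℂ) * deriv K x := by
  have hcc := contDiff_coshHalf.continuous
  have hu := hE.continuous
  have cK := hK.locAC.continuous
  have hcs : HasCompactSupport fun x => coshHalf x ^ 2 * K x := hs.mul_left
  have hcK : MemH1 fun x => coshHalf x ^ 2 * K x :=
    (memH1Loc_of_contDiff (contDiff_coshHalf.pow 2)).mul_memH1 hK hs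
  have hU : ∀ x, HasDerivAt (fun x => ∫ y in (0 : ℝ)..x, u y) (u x) x := fun x =>
    intervalIntegral.integral_hasDerivAt_right (hu.intervalIntegrable _ _)
      (hu.stronglyMeasurableAtFilter _ _) hu.continuousAt
  have hUac : LocAC fun x => ((∫ y in (0 : ℝ)..x, u y : ℝ) : ℂ) :=
    (LocAC.real_integral hu.locallyIntegrable 0).ofReal
  have i1 : Integrable fun x => (u x : ℂ) * (coshHalf x ^ 2 * K x) :=
    ((Complex.continuous_ofReal.comp hu).mul
      ((hcc.pow 2).mul cK)).integrable_of_hasCompactSupport hcs.mul_left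
  have i2 : Integrable fun x => ((deriv u x : ℝ) : ℂ) * deriv (fun x => coshHalf x ^ 2 * K x) x :=
    MemLp.integrable_mul (p := 2) (q := 2) hE.memD.h1.sq_deriv.ofReal hcK.sq_deriv
  have i12 : Integrable fun x => (u x : ℂ) * (coshHalf x ^ 2 * K x)
      + ((deriv u x : ℝ) : ℂ) * deriv (fun x => coshHalf x ^ 2 * K x) x := i1.add i2
  set Q : ℝ → ℂ := fun x : ℝ => ((u x : ℂ) * (Real.sinh (x / 2) * coshHalf x)
      + 1 / 2 * ((∫ y in (0 : ℝ)..x, u y : ℝ) : ℂ)) * K x with hQdef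
  have hQ : LocAC Q :=
    ((hE.memD.h1.locAC.ofReal.mul ((LocAC.of_contDiff contDiff_sinh_half).ofReal.mul
      (LocAC.of_contDiff contDiff_coshHalf))).add (hUac.const_mul _)).mul hK.locAC
  have hQs : HasCompactSupport Q := hs.mul_left
  have i3 := hQ.integrable_deriv hQs
  have key : (fun x => ((u x : ℂ) * (coshHalf x ^ 2 * K x)
      + ((deriv u x : ℝ) : ℂ) * deriv (fun x => coshHalf x ^ 2 * K x) x) - deriv Q x)
      =ᵐ[volume] fun x => (antideriv u x : ℂ) * deriv K x := by
    filter_upwards [hE.memD.h1.locAC.ae_differentiableAt_real, hK.locAC.ae_differentiableAt]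
      with x h1 h2
    have d1 := hasDerivAt_coshHalf x
    have d2 := hasDerivAt_sinh_half_ofReal x
    have d3 := h1.hasDerivAt.ofReal_comp
    have d4 := (hU x).ofReal_comp
    have d5 : HasDerivAt Q _ x := (((d3.fun_mul (d2.fun_mul d1)).fun_add
      (d4.const_mul (1 / 2))).fun_mul h2.hasDerivAt)
    have d6 : HasDerivAt (fun x => coshHalf x ^ 2 * K x) _ x :=
      (d1.fun_pow 2).fun_mul h2.hasDerivAt
    rw [d5.deriv, d6.deriv, antideriv]
    have e1 : (Real.cosh (x / 2) : ℂ) = coshHalf x := rfl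
    push_cast [← Complex.ofReal_cosh, ← Complex.ofReal_sinh]
    have e2 := coshHalf_sq x
    simp only [coshHalf] at e2 ⊢
    push_cast at e2 ⊢
    linear_combination (1 / 2 : ℂ) * (u x : ℂ) * K x * e2
  refine ⟨(i12.sub i3).congr key, ?_⟩
  rw [omega, ← integral_add i1 i2, ← integral_congr_ae key, integral_sub i12 i3,
    hQ.integral_deriv_of_hasCompactSupport hQs, sub_zero]

/-- The substitution `f = cosh (x / 2) F` takes solutions of the first order system to weak
solutions of the differential equation. -/
theorem isSolution_of_isSys (h : hE.coeffData.IsSys z 1 F G) :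
    IsSolution u μ z fun x => coshHalf x * F x := by
  have hF := memH1Loc_fst h
  refine ⟨hF.contDiff_mul contDiff_coshHalf, fun φ hφ hs => ?_⟩
  obtain ⟨H, rfl⟩ : ∃ H : ℝ → ℂ, φ = fun x => coshHalf x * H x :=
    ⟨fun x => (coshHalf x)⁻¹ * φ x, funext fun x => by
      rw [mul_inv_cancel_left₀ (coshHalf_ne_zero x)]⟩
  have eH : H = fun x => (coshHalf x)⁻¹ * (coshHalf x * H x) :=
    funext fun x => (inv_mul_cancel_left₀ (coshHalf_ne_zero x) _).symm
  have hH : MemH1 H := by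
    rw [eH]
    exact (memH1Loc_of_contDiff contDiff_coshHalf_inv).mul_memH1 hφ hs
  have hHs : HasCompactSupport H := by
    rw [eH]
    exact hs.mul_left
  obtain ⟨i1, e1⟩ := integral_deriv_mul_deriv_coshHalf hF hH hHs
  obtain ⟨i2, e2⟩ := omega_coshHalf_sq_mul hE (hF.mul_memH1 hH hHs) hHs.mul_left
  have e3 := integral_deriv_mul_snd h hH.locAC hHs
  obtain ⟨C, hC⟩ := h.bddG.2
  have i3 : Integrable fun x : ℝ => deriv H x * G x :=
    (hH.locAC.integrable_deriv hHs).mul_bdd (c := C) h.bddG.1.aestronglyMeasurable (ae_of_all _ hC)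
  have i12 : Integrable fun x : ℝ => coshHalf x ^ 2 * deriv (fun x : ℝ => F x) x * deriv H x
      - z * ((antideriv u x : ℂ) * deriv (fun x : ℝ => F x * H x) x) := i1.sub (i2.const_mul z)
  have key : (fun x : ℝ => deriv H x * G x
      - (coshHalf x ^ 2 * deriv (fun x : ℝ => F x) x * deriv H x
      - z * ((antideriv u x : ℂ) * deriv (fun x : ℝ => F x * H x) x)))
      =ᵐ[volume] fun x => z * antideriv u x * H x * deriv (fun x : ℝ => F x) x := by
    filter_upwards [ae_deriv_fst h, hF.locAC.ae_deriv_mul hH.locAC] with x h1 h2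
    rw [h2, h1]
    have := coshHalf_ne_zero x
    field_simp
    ring
  rw [← integral_congr_ae key, integral_sub i3 i12, integral_sub i1 (i2.const_mul z),
    integral_const_mul] at e3
  have e4 : (fun x => coshHalf x * F x * (coshHalf x * H x))
      = fun x : ℝ => coshHalf x ^ 2 * (F x * H x) := funext fun x => by ring
  rw [e1]
  simp only [e4] at e3 ⊢
  rw [e2]
  linear_combination e3

end System

/-! ### All weak solutions, and their behavior at infinity -/

section System

variable {u : ℝ → ℝ} {μ : Measure ℝ} {hE : MemE u μ} {z : ℂ} {F G F' G' : EReal → ℂ}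

theorem ae_wronskian_of_isSys (h : hE.coeffData.IsSys z 1 F G)
    (h' : hE.coeffData.IsSys z 1 F' G') :
    ∀ᵐ x : ℝ, coshHalf x * F x * deriv (fun x : ℝ => coshHalf x * F' x) x
      - deriv (fun x : ℝ => coshHalf x * F x) x * (coshHalf x * F' x)
      = F x * G' x - G x * F' x := by
  filter_upwards [(locAC_fst h).ae_differentiableAt, (locAC_fst h').ae_differentiableAt,
    ae_deriv_fst h, ae_deriv_fst h'] with x d d' e e'
  rw [((hasDerivAt_coshHalf x).fun_mul d.hasDerivAt).deriv,
    ((hasDerivAt_coshHalf x).fun_mul d'.hasDerivAt).deriv, e, e']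
  have := coshHalf_ne_zero x
  field_simp
  ring

/-- Every weak solution comes from the first order system: its Wronskians with two solutions of
the system are constant, and they are the coefficients of a linear combination. -/
theorem IsSolution.exists_isSys (hE : MemE u μ) {g : ℝ → ℂ} (hg : IsSolution u μ z g) :
    ∃ F G : EReal → ℂ, hE.coeffData.IsSys z 1 F G ∧ g = fun x : ℝ => coshHalf x * F x := by
  have h1 := hE.coeffData.isSys_solX_one z
  have h2 := hE.coeffData.isSys_solF z
  have s1 := isSolution_of_isSys h1
  have s2 := isSolution_of_isSys h2
  obtain ⟨α, hα⟩ := hg.wronskian_ae_const s2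
  obtain ⟨β, hβ⟩ := s1.wronskian_ae_const hg
  refine ⟨_, _, (h1.const_mul α).add (h2.const_mul β), ?_⟩
  refine (Continuous.ae_eq_iff_eq volume hg.1.locAC.continuous ?_).1 ?_
  · exact ((isSolution_of_isSys ((h1.const_mul α).add (h2.const_mul β))).1).locAC.continuous
  filter_upwards [hα, hβ, ae_wronskian_of_isSys h1 h2] with x e1 e2 e3
  rw [hE.coeffData.wronskian_sol] at e3
  linear_combination (-g x) * e3 + (coshHalf x * hE.coeffData.solX 1 0 z x) * e1
    + (coshHalf x * hE.coeffData.solF 0 1 z x) * e2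

/-- A solution whose initial values at some point vanish is trivial. -/
theorem fst_eq_zero (h : hE.coeffData.IsSys z 1 F G) {e : EReal} (hF : F e = 0) (hG : G e = 0)
    (x : EReal) : F x = 0 := by
  have h1 := hE.coeffData.isSys_solX_one z
  have h2 := hE.coeffData.isSys_solF z
  have e1 := (h.wronskian_eq h1 x).trans (h.wronskian_eq h1 e).symm
  have e2 := (h.wronskian_eq h2 x).trans (h.wronskian_eq h2 e).symm
  rw [hF, hG, mul_zero, mul_zero, sub_zero] at e1 e2
  linear_combination -F x * hE.coeffData.wronskian_sol z x
    + hE.coeffData.solF 0 1 z x * e1 - hE.coeffData.solX 1 0 z x * e2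

theorem isLittleO_coshHalf_mul_bot (h : hE.coeffData.IsSys z 1 F G) (hF : F ⊥ = 0) :
    (fun x : ℝ => coshHalf x * F x - 2 * G ⊥ * (Real.exp (x / 2) : ℂ)) =o[atBot]
      fun x : ℝ => (Real.exp (x / 2) : ℂ) := by
  have e : ∀ x : ℝ, (Real.exp (x / 2) : ℂ)
      = coshHalf x * (1 / 2 * (sechMeasure.real (Set.Iio x) : ℂ)) := by
    intro x
    have := (Real.cosh_pos (x / 2)).ne'
    have e1 : Real.exp (x / 2) = Real.cosh (x / 2) * (1 / 2 * sechMeasure.real (Set.Iio x)) := by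
      rw [sechMeasure_real_Iio]
      field_simp
    rw [e1, coshHalf, Complex.ofReal_mul, Complex.ofReal_mul]
    norm_num
  have h1 : (fun x : ℝ => F x - G ⊥ * (sechMeasure.real (Set.Iio x) : ℂ)) =o[atBot]
      fun x : ℝ => sechMeasure.real (Set.Iio x) :=
    h.isLittleO_bot hF
  have h2 : (fun x : ℝ => F x - G ⊥ * (sechMeasure.real (Set.Iio x) : ℂ)) =o[atBot]
      fun x : ℝ => 1 / 2 * (sechMeasure.real (Set.Iio x) : ℂ) :=
    (Asymptotics.IsLittleO.of_norm_right (by simpa using h1.norm_right)).trans_isBigO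
      (Asymptotics.isBigO_self_const_mul (by norm_num) _ _)
  refine ((Asymptotics.isBigO_refl coshHalf atBot).mul_isLittleO h2).congr (fun x => ?_)
    fun x => (e x).symm
  rw [e x]
  ring

theorem isLittleO_coshHalf_mul_top (h : hE.coeffData.IsSys z 1 F G) (hF : F ⊤ = 0) :
    (fun x : ℝ => coshHalf x * F x + 2 * G ⊤ * (Real.exp (-(x / 2)) : ℂ)) =o[atTop]
      fun x : ℝ => (Real.exp (-(x / 2)) : ℂ) := by
  have e : ∀ x : ℝ, (Real.exp (-(x / 2)) : ℂ)
      = coshHalf x * (1 / 2 * (sechMeasure.real (Set.Ici x) : ℂ)) := by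
    intro x
    have := (Real.cosh_pos (x / 2)).ne'
    have e1 : Real.exp (-(x / 2)) = Real.cosh (x / 2) * (1 / 2 * sechMeasure.real (Set.Ici x)) := by
      rw [sechMeasure_real_Ici]
      field_simp
    rw [e1, coshHalf, Complex.ofReal_mul, Complex.ofReal_mul]
    norm_num
  have h1 : (fun x : ℝ => F x + G ⊤ * (sechMeasure.real (Set.Ici x) : ℂ)) =o[atTop]
      fun x : ℝ => sechMeasure.real (Set.Ici x) :=
    h.isLittleO_top hF
  have h2 : (fun x : ℝ => F x + G ⊤ * (sechMeasure.real (Set.Ici x) : ℂ)) =o[atTop]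
      fun x : ℝ => 1 / 2 * (sechMeasure.real (Set.Ici x) : ℂ) :=
    (Asymptotics.IsLittleO.of_norm_right (by simpa using h1.norm_right)).trans_isBigO
      (Asymptotics.isBigO_self_const_mul (by norm_num) _ _)
  refine ((Asymptotics.isBigO_refl coshHalf atTop).mul_isLittleO h2).congr (fun x => ?_)
    fun x => (e x).symm
  rw [e x]
  ring

theorem norm_coshHalf_mul_bound (x : ℝ) (w : ℂ) : ‖w‖ ≤ ‖coshHalf x * w‖ := by
  rw [norm_mul, norm_coshHalf]
  exact le_mul_of_one_le_left (norm_nonneg _) (Real.one_le_cosh _)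

theorem isPhiMinus_of_isSys (h : hE.coeffData.IsSys z 1 F G) (hF : F ⊥ = 0) (hG : G ⊥ = 1 / 2) :
    IsPhiMinus u μ z fun x => coshHalf x * F x := by
  refine ⟨isSolution_of_isSys h, ?_⟩
  refine (isLittleO_coshHalf_mul_bot h hF).congr_left fun x => ?_
  rw [hG]
  simp

theorem isPhiPlus_of_isSys (h : hE.coeffData.IsSys z 1 F G) (hF : F ⊤ = 0)
    (hG : G ⊤ = -(1 / 2)) : IsPhiPlus u μ z fun x => coshHalf x * F x := by
  refine ⟨isSolution_of_isSys h, ?_⟩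
  refine (isLittleO_coshHalf_mul_top h hF).congr_left fun x => ?_
  rw [hG]
  simp
  ring

/-- If a multiple of a function that does not vanish is negligible with respect to that function
then the coefficient vanishes. -/
theorem eq_zero_of_const_mul_isLittleO {l : Filter ℝ} [l.NeBot] {c : ℂ} {e : ℝ → ℂ}
    (he : ∀ x, e x ≠ 0) (h : (fun x => c * e x) =o[l] e) : c = 0 := by
  by_contra hc
  refine Asymptotics.isLittleO_irrefl (f'' := e) (l := l) (Frequently.of_forall he) ?_
  exact (Asymptotics.isLittleO_const_mul_left_iff hc).1 h

theorem fst_eq_zero_of_isLittleO_bot (h : hE.coeffData.IsSys z 1 F G)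
    (ho : (fun x : ℝ => coshHalf x * F x) =o[atBot] fun x : ℝ => (Real.exp (x / 2) : ℂ))
    (x : EReal) : F x = 0 := by
  have hexp : Tendsto (fun x : ℝ => (Real.exp (x / 2) : ℂ)) atBot (𝓝 0) := by
    have := Real.tendsto_exp_atBot.comp (tendsto_id.atBot_div_const (two_pos : (0 : ℝ) < 2))
    rw [← Complex.ofReal_zero]
    exact (Complex.continuous_ofReal.tendsto _).comp this
  have hF : F ⊥ = 0 := by
    refine tendsto_nhds_unique h.tendsto_F_bot ?_
    refine squeeze_zero_norm (fun x => norm_coshHalf_mul_bound x _) ?_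
    simpa using (ho.isBigO.trans_tendsto hexp).norm
  have hG : 2 * G ⊥ = 0 := by
    refine eq_zero_of_const_mul_isLittleO (l := atBot)
      (e := fun x : ℝ => (Real.exp (x / 2) : ℂ))
      (fun x => Complex.ofReal_ne_zero.2 (Real.exp_pos _).ne') ?_
    refine (ho.sub (isLittleO_coshHalf_mul_bot h hF)).congr_left fun x => ?_
    ring
  exact fst_eq_zero h hF (by simpa using hG) x

theorem fst_eq_zero_of_isLittleO_top (h : hE.coeffData.IsSys z 1 F G)
    (ho : (fun x : ℝ => coshHalf x * F x) =o[atTop] fun x : ℝ => (Real.exp (-(x / 2)) : ℂ))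
    (x : EReal) : F x = 0 := by
  have hexp : Tendsto (fun x : ℝ => (Real.exp (-(x / 2)) : ℂ)) atTop (𝓝 0) := by
    have := Real.tendsto_exp_neg_atTop_nhds_zero.comp
      (tendsto_id.atTop_div_const (two_pos : (0 : ℝ) < 2))
    rw [← Complex.ofReal_zero]
    exact (Complex.continuous_ofReal.tendsto _).comp this
  have hF : F ⊤ = 0 := by
    refine tendsto_nhds_unique h.tendsto_F_top ?_
    refine squeeze_zero_norm (fun x => norm_coshHalf_mul_bound x _) ?_
    simpa using (ho.isBigO.trans_tendsto hexp).norm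
  have hG : 2 * G ⊤ = 0 := by
    refine eq_zero_of_const_mul_isLittleO (l := atTop)
      (e := fun x : ℝ => (Real.exp (-(x / 2)) : ℂ))
      (fun x => Complex.ofReal_ne_zero.2 (Real.exp_pos _).ne') ?_
    refine ((isLittleO_coshHalf_mul_top h hF).sub ho).congr_left fun x => ?_
    ring
  exact fst_eq_zero h hF (by simpa using hG) x

theorem exists_isSys_sub {hE : MemE u μ} {f g : ℝ → ℂ} (hf : IsSolution u μ z f)
    (hg : IsSolution u μ z g) : ∃ F G : EReal → ℂ, hE.coeffData.IsSys z 1 F G ∧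
      ∀ x : ℝ, f x - g x = coshHalf x * F x := by
  obtain ⟨F, G, h, rfl⟩ := hf.exists_isSys hE
  obtain ⟨F', G', h', rfl⟩ := hg.exists_isSys hE
  refine ⟨_, _, h.add (h'.const_mul (-1)), fun x => ?_⟩
  ring

theorem IsPhiMinus.unique (hE : MemE u μ) {f g : ℝ → ℂ} (hf : IsPhiMinus u μ z f)
    (hg : IsPhiMinus u μ z g) : f = g := by
  obtain ⟨F, G, h, e⟩ := exists_isSys_sub (hE := hE) hf.1 hg.1
  have ho : (fun x : ℝ => coshHalf x * F x) =o[atBot] fun x : ℝ => (Real.exp (x / 2) : ℂ) := by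
    refine (hf.2.isLittleO.sub hg.2.isLittleO).congr_left fun x => ?_
    rw [← e x]
    simp
  funext x
  rw [← sub_eq_zero, e x, fst_eq_zero_of_isLittleO_bot h ho, mul_zero]

theorem IsPhiPlus.unique (hE : MemE u μ) {f g : ℝ → ℂ} (hf : IsPhiPlus u μ z f)
    (hg : IsPhiPlus u μ z g) : f = g := by
  obtain ⟨F, G, h, e⟩ := exists_isSys_sub (hE := hE) hf.1 hg.1
  have ho : (fun x : ℝ => coshHalf x * F x) =o[atTop]
      fun x : ℝ => (Real.exp (-(x / 2)) : ℂ) := by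
    refine (hf.2.isLittleO.sub hg.2.isLittleO).congr_left fun x => ?_
    rw [← e x]
    simp
  funext x
  rw [← sub_eq_zero, e x, fst_eq_zero_of_isLittleO_top h ho, mul_zero]

/-! ### The spectrum -/

theorem integrableAtFilter_exp_bot : IntegrableAtFilter (fun x : ℝ => Real.exp x) atBot :=
  ⟨Set.Iic 0, Iic_mem_atBot 0, integrableOn_exp_Iic 0⟩

theorem integrableAtFilter_exp_neg_top :
    IntegrableAtFilter (fun x : ℝ => Real.exp (-x)) atTop :=
  ⟨Set.Ioi 0, Ioi_mem_atTop 0, integrableOn_exp_neg_Ioi 0⟩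

/-- Solutions of the system that vanish at both endpoints belong to `H¹(ℝ)`. -/
theorem memH1_of_isSys (h : hE.coeffData.IsSys z 1 F G) (hb : F ⊥ = 0) (ht : F ⊤ = 0) :
    MemH1 fun x : ℝ => coshHalf x * F x := by
  have hs := (isSolution_of_isSys h).1
  have hc := hs.locAC.continuous
  have b1 : (fun x : ℝ => coshHalf x * F x) =O[atBot] fun x : ℝ => (Real.exp (x / 2) : ℂ) := by
    have h1 := (isLittleO_coshHalf_mul_bot h hb).isBigO
    have h2 := Asymptotics.isBigO_const_mul_self (2 * G ⊥)
      (fun x : ℝ => (Real.exp (x / 2) : ℂ)) atBot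
    exact (h1.add h2).congr_left fun x => by ring
  have b2 : (fun x : ℝ => coshHalf x * F x) =O[atTop]
      fun x : ℝ => (Real.exp (-(x / 2)) : ℂ) := by
    have h1 := (isLittleO_coshHalf_mul_top h ht).isBigO
    have h2 := Asymptotics.isBigO_const_mul_self (2 * G ⊤)
      (fun x : ℝ => (Real.exp (-(x / 2)) : ℂ)) atTop
    exact (h1.sub h2).congr_left fun x => by ring
  have m1 : MemLp (fun x : ℝ => coshHalf x * F x) 2 := by
    refine (memLp_two_iff_integrable_sq_norm hc.aestronglyMeasurable).2 ?_
    refine ((hc.norm.pow 2).locallyIntegrable).integrable_of_isBigO_atBot_atTop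
      (g := fun x => Real.exp x) (g' := fun x => Real.exp (-x)) ?_ integrableAtFilter_exp_bot ?_
      integrableAtFilter_exp_neg_top
    · refine (b1.norm_norm.pow 2).congr_right fun x => ?_
      rw [Complex.norm_real, Real.norm_of_nonneg (Real.exp_pos _).le, ← Real.exp_nat_mul]
      congr 1
      push_cast
      ring
    · refine (b2.norm_norm.pow 2).congr_right fun x => ?_
      rw [Complex.norm_real, Real.norm_of_nonneg (Real.exp_pos _).le, ← Real.exp_nat_mul]
      congr 1
      push_cast
      ring
  refine ⟨hs.ac, m1, ?_⟩
  have m2 : MemLp (fun x : ℝ => (Real.sinh (x / 2) : ℂ) / 2 * F x) 2 := by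
    refine m1.mono (((Complex.continuous_ofReal.comp continuous_sinh_half).div_const 2).mul
      (locAC_fst h).continuous).aestronglyMeasurable (ae_of_all _ fun x => ?_)
    rw [norm_mul, norm_mul, norm_coshHalf, norm_div, Complex.norm_real, Real.norm_eq_abs]
    refine mul_le_mul_of_nonneg_right ?_ (norm_nonneg _)
    have h1 := Real.cosh_pos (x / 2)
    have h2 : |Real.sinh (x / 2)| ≤ Real.cosh (x / 2) :=
      abs_le_of_sq_le_sq (by rw [Real.cosh_sq]; linarith) h1.le
    simp only [RCLike.norm_ofNat]
    linarith [abs_nonneg (Real.sinh (x / 2))]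
  refine (m2.add (memLp_inv_coshHalf_mul_P h)).ae_eq ?_
  filter_upwards [(locAC_fst h).ae_differentiableAt, ae_deriv_fst h] with x d e
  rw [((hasDerivAt_coshHalf x).fun_mul d.hasDerivAt).deriv, e, Pi.add_apply]
  have := coshHalf_ne_zero x
  field_simp

/-- A square integrable function whose modulus dominates a convergent function forces the limit to
vanish. -/
theorem eq_zero_of_memLp_of_tendsto {f g : ℝ → ℂ} {l : Filter ℝ} {L : ℂ} (hf : MemLp f 2)
    (hg : ∀ x, ‖g x‖ ≤ ‖f x‖) (hl : ∀ s ∈ l, volume s = ⊤) (ht : Tendsto g l (𝓝 L)) : L = 0 := by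
  by_contra hL
  have hL' : 0 < ‖L‖ := norm_pos_iff.2 hL
  have h1 := ht.norm.eventually (lt_mem_nhds (half_lt_self hL'))
  have h2 := (hf.integrable_norm_pow two_ne_zero).measure_norm_ge_lt_top
    (ε := (‖L‖ / 2) ^ 2) (by positivity)
  refine h2.ne (hl _ (mem_of_superset h1 fun x hx => ?_))
  simp only [Set.mem_ofPred_eq, norm_pow, norm_norm] at hx ⊢
  exact pow_le_pow_left₀ (by positivity) (hx.le.trans (hg x)) 2

theorem fst_eq_zero_of_memLp (h : hE.coeffData.IsSys z 1 F G)
    (hf : MemLp (fun x : ℝ => coshHalf x * F x) 2) : F ⊥ = 0 ∧ F ⊤ = 0 := by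
  constructor
  · refine eq_zero_of_memLp_of_tendsto hf (fun x => norm_coshHalf_mul_bound x _) (fun s hs => ?_)
      h.tendsto_F_bot
    obtain ⟨a, ha⟩ := mem_atBot_sets.1 hs
    exact measure_mono_top (fun x hx => ha x hx) Real.volume_Iic
  · refine eq_zero_of_memLp_of_tendsto hf (fun x => norm_coshHalf_mul_bound x _) (fun s hs => ?_)
      h.tendsto_F_top
    obtain ⟨a, ha⟩ := mem_atTop_sets.1 hs
    exact measure_mono_top (fun x hx => ha x hx) Real.volume_Ici

theorem sechMeasure_Iio_ne_zero (r : ℝ) : sechMeasure (Set.Iio r) ≠ 0 := by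
  have h := sechMeasure_real_Iio r
  intro h0
  have := Real.cosh_pos (r / 2)
  have h1 : 0 < 2 * Real.exp (r / 2) / Real.cosh (r / 2) := by positivity
  rw [← h, Measure.real, h0, ENNReal.toReal_zero] at h1
  exact h1.false

theorem sechMeasure_Ici_ne_zero (r : ℝ) : sechMeasure (Set.Ici r) ≠ 0 := by
  have h := sechMeasure_real_Ici r
  intro h0
  have := Real.cosh_pos (r / 2)
  have h1 : 0 < 2 * Real.exp (-(r / 2)) / Real.cosh (r / 2) := by positivity
  rw [← h, Measure.real, h0, ENNReal.toReal_zero] at h1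
  exact h1.false

theorem mem_spectralSet_iff (hE : MemE u μ) (z : ℂ) :
    z ∈ spectralSet u μ ↔ hE.coeffData.solF 0 1 z ⊤ = 0 := by
  have h2 := hE.coeffData.isSys_solF z
  constructor
  · rintro ⟨f, hs, hf0, hf⟩
    obtain ⟨F, G, h, rfl⟩ := hs.exists_isSys hE
    obtain ⟨hb, ht⟩ := fst_eq_zero_of_memLp h hf.sq
    have e := h.wronskian_eq h2 ⊤
    rw [hb, ht, CoeffData.solF_bot] at e
    simp only [mul_zero, sub_zero, zero_mul] at e
    refine (mul_eq_zero.1 e).resolve_right fun hG => hf0 ?_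
    funext x
    rw [fst_eq_zero h ht hG, mul_zero]
    rfl
  · intro h0
    refine ⟨_, isSolution_of_isSys h2, fun hf => ?_, memH1_of_isSys h2 (by simp) h0⟩
    have hF : ∀ x : ℝ, hE.coeffData.solF 0 1 z x = 0 := fun x =>
      (mul_eq_zero.1 (congrFun hf x)).resolve_left (coshHalf_ne_zero x)
    -- the solution vanishes identically, but its second component tends to one at the left endpoint
    have ho : (fun x : ℝ => (2 : ℂ) * (Real.exp (x / 2) : ℂ)) =o[atBot]
        fun x : ℝ => (Real.exp (x / 2) : ℂ) := by
      refine (isLittleO_coshHalf_mul_bot h2 (by simp)).neg_left.congr_left fun x => ?_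
      simp [hF x]
    exact two_ne_zero (eq_zero_of_const_mul_isLittleO
      (fun x => Complex.ofReal_ne_zero.2 (Real.exp_pos _).ne') ho)

end System

/-! ### The solutions `φ₊` and `φ₋` and their Wronskian -/

section System

variable {u : ℝ → ℝ} {μ : Measure ℝ}

theorem IsRealCartwright.const_mul {F : ℂ → ℂ} (hF : IsRealCartwright F) (c : ℝ) :
    IsRealCartwright fun z => (c : ℂ) * F z :=
  (isRealCartwright_const c).mul hF

theorem HasOnlyNonzeroRealRoots.const_mul {F : ℂ → ℂ} (hF : HasOnlyNonzeroRealRoots F) {c : ℝ}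
    (hc : c ≠ 0) : HasOnlyNonzeroRealRoots fun z => (c : ℂ) * F z := fun z hz =>
  hF z ((mul_eq_zero.1 hz).resolve_left (Complex.ofReal_ne_zero.2 hc))

/-- The solution `φ₋(z, ·)`. -/
noncomputable def phiMinus (hE : MemE u μ) (z : ℂ) (x : ℝ) : ℂ :=
  ((Real.cosh (x / 2) / 2 : ℝ) : ℂ) * hE.coeffData.solF 0 1 z x

/-- The solution `φ₊(z, ·)`. -/
noncomputable def phiPlus (hE : MemE u μ) (z : ℂ) (x : ℝ) : ℂ :=
  ((Real.cosh (x / 2) / 2 : ℝ) : ℂ) * hE.coeffData.topF z x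

/-- The Wronskian of `φ₊` and `φ₋`. -/
noncomputable def wronskian (hE : MemE u μ) (z : ℂ) : ℂ :=
  ((1 / 4 : ℝ) : ℂ) * hE.coeffData.solF 0 1 z ⊤

variable (hE : MemE u μ) (z : ℂ)

theorem phiMinus_eq : phiMinus hE z =
    fun x : ℝ => coshHalf x * (1 / 2 * hE.coeffData.solF 0 1 z x) := by
  funext x
  rw [phiMinus, coshHalf]
  push_cast
  ring

theorem phiPlus_eq : phiPlus hE z =
    fun x : ℝ => coshHalf x * (1 / 2 * hE.coeffData.topF z x) := by
  funext x
  rw [phiPlus, coshHalf]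
  push_cast
  ring

theorem isPhiMinus_phiMinus : IsPhiMinus u μ z (phiMinus hE z) := by
  rw [phiMinus_eq]
  exact isPhiMinus_of_isSys ((hE.coeffData.isSys_solF z).const_mul (1 / 2)) (by simp) (by simp)

theorem isPhiPlus_phiPlus : IsPhiPlus u μ z (phiPlus hE z) := by
  rw [phiPlus_eq]
  exact isPhiPlus_of_isSys ((hE.coeffData.isSys_top z).const_mul (1 / 2)) (by simp) (by simp)

theorem ae_wronskian_eq : ∀ᵐ x : ℝ, wronskian hE z
    = phiPlus hE z x * deriv (phiMinus hE z) x - deriv (phiPlus hE z) x * phiMinus hE z x := by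
  have h := ae_wronskian_of_isSys ((hE.coeffData.isSys_top z).const_mul (1 / 2))
    ((hE.coeffData.isSys_solF z).const_mul (1 / 2))
  filter_upwards [h] with x hx
  rw [phiMinus_eq, phiPlus_eq, hx, wronskian, ← hE.coeffData.wronskian_top z x]
  push_cast
  ring

theorem setOf_wronskian_eq_zero : spectralSet u μ = {z : ℂ | wronskian hE z = 0} := by
  ext z
  rw [mem_spectralSet_iff hE]
  simp [wronskian]

theorem isRealCartwright_phiPlus (x : ℝ) : IsRealCartwright fun z => phiPlus hE z x :=
  (hE.coeffData.isRealCartwright_topF x).const_mul _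

theorem isRealCartwright_phiMinus (x : ℝ) : IsRealCartwright fun z => phiMinus hE z x :=
  (hE.coeffData.isRealCartwright_solF x).const_mul _

theorem isRealCartwright_wronskian : IsRealCartwright (wronskian hE) :=
  (hE.coeffData.isRealCartwright_solF ⊤).const_mul _

theorem hasOnlyNonzeroRealRoots_phiPlus (x : ℝ) :
    HasOnlyNonzeroRealRoots fun z => phiPlus hE z x :=
  (CoeffData.hasOnlyNonzeroRealRoots_topF (D := hE.coeffData) sechMeasure_Ici_ne_zero x).const_mul
    (div_pos (Real.cosh_pos _) two_pos).ne'

theorem hasOnlyNonzeroRealRoots_phiMinus (x : ℝ) :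
    HasOnlyNonzeroRealRoots fun z => phiMinus hE z x :=
  (CoeffData.hasOnlyNonzeroRealRoots_solF (D := hE.coeffData) sechMeasure_Iio_ne_zero
    (EReal.coe_ne_bot x)).const_mul (div_pos (Real.cosh_pos _) two_pos).ne'

theorem hasOnlyNonzeroRealRoots_wronskian : HasOnlyNonzeroRealRoots (wronskian hE) :=
  (CoeffData.hasOnlyNonzeroRealRoots_solF (D := hE.coeffData) sechMeasure_Iio_ne_zero
    top_ne_bot).const_mul (by norm_num)

theorem isMeromorphicHerglotz_phi (x : ℝ) : IsMeromorphicHerglotz fun z =>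
    z * phiMinus hE z x * phiPlus hE z x / wronskian hE z := by
  have h := CoeffData.isMeromorphicHerglotz_green (D := hE.coeffData) sechMeasure_Iio_ne_zero
    (c := Real.cosh (x / 2) ^ 2) (sq_nonneg _) x
  convert! h using 1
  funext z
  rw [phiMinus, phiPlus, wronskian]
  push_cast
  ring

end System

end CamassaHolm

theorem mainTheorem10 (u : ℝ → ℝ) (μ : MeasureTheory.Measure ℝ)
    (hE : CamassaHolm.MemE u μ) :
    ∃ (φp φm : ℂ → ℝ → ℂ) (W : ℂ → ℂ),
      -- `φ₊(z, ·)` and `φ₋(z, ·)` are the unique solutions with the prescribed asymptotics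
      (∀ z : ℂ, CamassaHolm.IsPhiPlus u μ z (φp z) ∧
        ∀ g : ℝ → ℂ, CamassaHolm.IsPhiPlus u μ z g → g = φp z) ∧
      (∀ z : ℂ, CamassaHolm.IsPhiMinus u μ z (φm z) ∧
        ∀ g : ℝ → ℂ, CamassaHolm.IsPhiMinus u μ z g → g = φm z) ∧
      -- `W` is their Wronskian
      (∀ z : ℂ, ∀ᵐ x : ℝ, W z = φp z x * deriv (φm z) x - deriv (φp z) x * φm z x) ∧
      -- real entire of Cartwright class, with only nonzero and real roots
      (∀ x : ℝ, CamassaHolm.IsRealCartwright (fun z => φp z x) ∧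
        CamassaHolm.HasOnlyNonzeroRealRoots (fun z => φp z x)) ∧
      (∀ x : ℝ, CamassaHolm.IsRealCartwright (fun z => φm z x) ∧
        CamassaHolm.HasOnlyNonzeroRealRoots (fun z => φm z x)) ∧
      CamassaHolm.IsRealCartwright W ∧ CamassaHolm.HasOnlyNonzeroRealRoots W ∧
      -- `z φ₋ φ₊ / W` is a meromorphic Herglotz–Nevanlinna function
      (∀ x : ℝ, CamassaHolm.IsMeromorphicHerglotz (fun z => z * φm z x * φp z x / W z)) ∧
      -- the spectrum is the zero set of `W`, hence a discrete set of nonzero reals, with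
      -- convergence exponent at most one
      CamassaHolm.spectralSet u μ = {z : ℂ | W z = 0} ∧
      (∀ z ∈ CamassaHolm.spectralSet u μ, z.im = 0 ∧ z ≠ 0) ∧
      (∀ r : ℝ, {z ∈ CamassaHolm.spectralSet u μ | ‖z‖ ≤ r}.Finite) ∧
      (∀ p : ℝ, 1 < p → Summable fun z : CamassaHolm.spectralSet u μ => ‖(z : ℂ)‖ ^ (-p)) := by
  open CamassaHolm in
  have hW := isRealCartwright_wronskian hE
  have hW' := hasOnlyNonzeroRealRoots_wronskian hE
  have hW0 : wronskian hE 0 ≠ 0 := fun h => (hW' 0 h).2 rfl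
  have hσ := setOf_wronskian_eq_zero hE
  refine ⟨phiPlus hE, phiMinus hE, wronskian hE,
    fun z => ⟨isPhiPlus_phiPlus hE z, fun g hg => hg.unique hE (isPhiPlus_phiPlus hE z)⟩,
    fun z => ⟨isPhiMinus_phiMinus hE z, fun g hg => hg.unique hE (isPhiMinus_phiMinus hE z)⟩,
    ae_wronskian_eq hE,
    fun x => ⟨isRealCartwright_phiPlus hE x, hasOnlyNonzeroRealRoots_phiPlus hE x⟩,
    fun x => ⟨isRealCartwright_phiMinus hE x, hasOnlyNonzeroRealRoots_phiMinus hE x⟩,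
    hW, hW', isMeromorphicHerglotz_phi hE, hσ, ?_⟩
  rw [hσ]
  exact ⟨hW', finite_zeros_norm_le hW.entire hW.expType hW0,
    fun p hp => summable_zeros_rpow hW.entire hW.expType hW0 hp⟩
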